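/- Let $D\subset\mathbb R^3$ be a bounded connected open set. For $\omega\in\mathbb C$ let $\mathcal K_D^\omega[f](x)=\int_D \frac{e^{i\omega|x-y|}}{4\pi|x-y|}f(y)\,dy$, and let $\mathcal K_D=\mathcal K_D^0$ be the Newtonian potential on $L^2(D)$. Put $N(z)=z+|z|^2z$ and $\langle f,g\rangle_D=\int_D\overline f\,g\,dx$. For $\tau>0$, a *nonlinear dielectric resonance* at contrast $\tau$ is an $\omega\in\mathbb C$ for which there is a *resonant state* $0\ne u\in H^2(D)$ with $N(u)\in L^2(D)$ (automatic if $\partial D$ is smooth) and $$u=\tau\omega^2\,\mathcal K_D^\omega[N(u)]\quad\text{on } D ;$$ a *linear dielectric resonance* is defined in the same way with $u$ in place of $N(u)$. Let $\lambda_j$ be a simple eigenvalue of $\mathcal K_D$ with eigenfunction $\varphi_j\in L^2(D)$, $\|\varphi_j\|_{L^2(D)}=1$. Call $\tau\mapsto(\omega_*(\tau),\varphi_*(\tau))\in\mathbb C\times H^2(D)$ an *associated linear family* if, for all large $\tau$, $\omega_*(\tau)$ is a linear dielectric resonance with resonant state $\varphi_*(\tau)$ and $\varphi_*(\tau)-\varphi_j\perp\varphi_j$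 in $L^2(D)$, and if, as $\tau\to\infty$, $\omega_*(\tau)=\frac1{\sqrt{\lambda_j\tau}}+\mathcal O(\tau^{-1})$ and $\varphi_*(\tau)=\varphi_j+\mathcal O(\tau^{-1/2})$ in $L^2(D)$. Then associated linear families exist. Moreover, for every associated linear family $(\omega_*,\varphi_*)$ there are $\delta>0$ and, with $U=\{(a,\tau)\in\mathbb R^2:\ a>0,\ \tau>0,\ a+\tau^{-1}<\delta\}$, functions $\omega:U\to\mathbb C$ and $u,h:U\to H^2(D)$ such that: 1. (Existence.) For all $(a,\tau)\in U$, $\omega(a,\tau)$ is a nonlinear dielectric resonance at contrast $\tau$ with resonant state $u(a,\tau)=a\varphi_j+h(a,\tau)$, where $\langle\varphi_j,h(a,\tau)\rangle_D=0$. 2. (Local uniqueness up to phase.) There is $\rho>0$ such that for all $(a,\tau)\in U$ one has $|\sqrt\tau\,\omega(a,\tau)-\lambda_j^{-1/2}|<\rho$ and $\|u(a,\tau)\|_{H^2(D)}<\rho$, and if $\omega'$ is any nonlinear dielectric resonance at contrast $\tau$ with resonant state $u'$ such that $|\sqrt\tau\,\omega'-\lambda_j^{-1/2}|<\rho$, $\|u'\|_{H^2(D)}<\rho$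 and $|\langle\varphi_j,u'\rangle_D|=a$, then $\omega'=\omega(a,\tau)$ and $u'=e^{i\theta}u(a,\tau)$ for some $\theta\in\mathbb R$. 3. (Analyticity.) $\omega:U\to\mathbb C$ and $u:U\to H^2(D)$ are real analytic in $(a,\tau)$. 4. (Asymptotics.) With implied constants independent of $(a,\tau)\in U$, and with $\mathcal O$ for functions understood in the norm of $H^2(D)$, $$\omega(a,\tau)=\omega_*(\tau)+\mathcal O\Big(\frac{a^2}{\sqrt\tau}+\frac a\tau\Big),\qquad u(a,\tau)=a\varphi_*(\tau)+\mathcal O(a^2),\qquad u(a,\tau)=a\varphi_j+\mathcal O\Big(a^2+\frac1\tau\Big),$$ $$\omega(a,\tau)=\frac1{\sqrt{\lambda_j\tau}}-\frac{i}{8\pi\lambda_j^2\tau}\Big|\int_D\varphi_j\,dx\Big|^2+\mathcal O\Big(\frac{a^2}{\sqrt\tau}+\frac1{\tau^{3/2}}\Big).$$ (For a real-valued $\varphi_j$, $|\int_D\varphi_j|^2=(\int_D\varphi_j)^2$.) -/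

import Mathlib

open MeasureTheory Filter Topology Asymptotics

namespace NonlinearResonance

/-- Three-dimensional Euclidean space. -/
abbrev R3 : Type := EuclideanSpace ℝ (Fin 3)

/-- The complex Hilbert space `L²(D)`. -/
abbrev L2 (D : Set R3) : Type := Lp ℂ 2 (volume.restrict D)

/-- `g` is the weak `i`-th partial derivative of `f` in `D`:
`∫_D ∂ᵢψ f = - ∫_D ψ g` for every test function `ψ ∈ C_c^∞(D)`. -/
def IsWeakPartial (D : Set R3) (i : Fin 3) (f g : L2 D) : Prop :=
  ∀ ψ : R3 → ℝ, ContDiff ℝ (⊤ : ℕ∞) ψ → HasCompactSupport ψ → tsupport ψ ⊆ D →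
    ∫ x in D, (fderiv ℝ ψ x (EuclideanSpace.single i 1)) • f x = - ∫ x in D, ψ x • g x

theorem IsWeakPartial.zero (D : Set R3) (i : Fin 3) : IsWeakPartial D i 0 0 := by
  intro ψ _ _ _
  have h : (fun x => ((0 : L2 D) : R3 → ℂ) x) =ᵐ[volume.restrict D] fun _ => (0 : ℂ) :=
    Lp.coeFn_zero ℂ 2 (volume.restrict D)
  rw [integral_congr_ae (g := fun _ => (0 : ℂ)) (h.mono fun x hx => smul_eq_zero.2 (Or.inr hx)),
    integral_congr_ae (f := fun x => ψ x • ((0 : L2 D) : R3 → ℂ) x) (g := fun _ => (0 : ℂ))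
      (h.mono fun x hx => smul_eq_zero.2 (Or.inr hx))]
  simp

theorem L2.integrable_smul {D : Set R3} (f : L2 D) {ψ : R3 → ℝ} (hψ : Continuous ψ)
    (hc : HasCompactSupport ψ) : Integrable (fun x => ψ x • f x) (volume.restrict D) :=
  ((Lp.memLp f).locallyIntegrable one_le_two).integrable_smul_left_of_hasCompactSupport hψ hc

theorem continuous_partial {ψ : R3 → ℝ} (h : ContDiff ℝ (⊤ : ℕ∞) ψ) (v : R3) :
    Continuous fun x => fderiv ℝ ψ x v :=
  (h.continuous_fderiv (by simp)).clm_apply continuous_const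

theorem L2.setIntegral_smul_add {D : Set R3} (f g : L2 D) {ψ : R3 → ℝ} (hψ : Continuous ψ)
    (hc : HasCompactSupport ψ) :
    ∫ x in D, ψ x • (f + g : L2 D) x = (∫ x in D, ψ x • f x) + ∫ x in D, ψ x • g x := by
  rw [← integral_add (L2.integrable_smul f hψ hc) (L2.integrable_smul g hψ hc)]
  refine integral_congr_ae ((Lp.coeFn_add f g).mono fun x hx => ?_)
  simp only [hx, Pi.add_apply, smul_add]

theorem L2.setIntegral_smul_smul {D : Set R3} (c : ℂ) (f : L2 D) (ψ : R3 → ℝ) :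
    ∫ x in D, ψ x • (c • f : L2 D) x = c * ∫ x in D, ψ x • f x := by
  rw [← integral_const_mul]
  refine integral_congr_ae ((Lp.coeFn_smul c f).mono fun x hx => ?_)
  simp only [hx, Pi.smul_apply, smul_eq_mul, Complex.real_smul]
  ring

theorem IsWeakPartial.add {D : Set R3} {i : Fin 3} {f g f' g' : L2 D}
    (h : IsWeakPartial D i f g) (h' : IsWeakPartial D i f' g') :
    IsWeakPartial D i (f + f') (g + g') := by
  intro ψ hψ hc hs
  rw [L2.setIntegral_smul_add f f' (continuous_partial hψ _) (hc.fderiv_apply ℝ _),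
    L2.setIntegral_smul_add g g' hψ.continuous hc, h ψ hψ hc hs, h' ψ hψ hc hs, neg_add]

theorem IsWeakPartial.smul {D : Set R3} {i : Fin 3} {f g : L2 D} (c : ℂ)
    (h : IsWeakPartial D i f g) : IsWeakPartial D i (c • f) (c • g) := by
  intro ψ hψ hc hs
  rw [L2.setIntegral_smul_smul, L2.setIntegral_smul_smul, h ψ hψ hc hs, mul_neg]

/-- Indices of the second-order jet `(u, (∂ᵢu)ᵢ, (∂ⱼ∂ᵢu)ᵢⱼ)` of a function on `ℝ³`. -/
abbrev JetIndex : Type := Unit ⊕ Fin 3 ⊕ Fin 3 × Fin 3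

/-- The Sobolev space `H²(D)`. A function `u ∈ L²(D)` with weak derivatives of order one and two
in `L²(D)` is represented by the (uniquely determined) tuple of `u` and these derivatives. As a
subspace of the Hilbert sum of copies of `L²(D)` it carries the norm
`‖u‖² = ‖u‖²_{L²} + ∑ᵢ ‖∂ᵢu‖²_{L²} + ∑ᵢⱼ ‖∂ⱼ∂ᵢu‖²_{L²}`. -/
noncomputable def H2 (D : Set R3) : Submodule ℂ (PiLp 2 fun _ : JetIndex => L2 D) where
  carrier := {U |
    (∀ i : Fin 3, IsWeakPartial D i (U (Sum.inl ())) (U (Sum.inr (Sum.inl i)))) ∧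
    ∀ i j : Fin 3,
      IsWeakPartial D j (U (Sum.inr (Sum.inl i))) (U (Sum.inr (Sum.inr (i, j))))}
  zero_mem' := ⟨fun i => IsWeakPartial.zero D i, fun _ j => IsWeakPartial.zero D j⟩
  add_mem' := fun hU hV => ⟨fun i => (hU.1 i).add (hV.1 i), fun i j => (hU.2 i j).add (hV.2 i j)⟩
  smul_mem' := fun c _ hU => ⟨fun i => (hU.1 i).smul c, fun i j => (hU.2 i j).smul c⟩

/-- The function underlying an element of `H²(D)`, as an element of `L²(D)`. -/
noncomputable def toL2 {D : Set R3} (u : H2 D) : L2 D :=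
  (u : PiLp 2 fun _ : JetIndex => L2 D) (Sum.inl ())

/-- The outgoing Green's function `G^ω(x) = e^{iω|x|} / (4π|x|)` of `-(Δ + ω²)` on `ℝ³`. -/
noncomputable def green (ω : ℂ) (x : R3) : ℂ :=
  Complex.exp (Complex.I * ω * (‖x‖ : ℂ)) / (4 * Real.pi * ‖x‖)

/-- The volume potential `K_D^ω[f](x) = ∫_D G^ω(x - y) f(y) dy`. The integral converges for all
`x` when `D` is bounded and `f ∈ L²(D)`, the only case in which it is used. -/
noncomputable def volumePotential (D : Set R3) (ω : ℂ) (f : R3 → ℂ) (x : R3) : ℂ :=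
  ∫ y in D, green ω (x - y) * f y

/-- The Newtonian potential `K_D[f](x) = ∫_D f(y) / (4π|x - y|) dy`. -/
noncomputable def newtonianPotential (D : Set R3) (f : R3 → ℂ) (x : R3) : ℂ :=
  ∫ y in D, (1 / (4 * Real.pi * ‖x - y‖) : ℂ) * f y

/-- `K_D[f] = lam f` in `L²(D)`. -/
def IsNewtonianEigen (D : Set R3) (lam : ℝ) (f : L2 D) : Prop :=
  ∀ᵐ x ∂(volume.restrict D), newtonianPotential D f x = lam * f x

/-- `lam` is a simple eigenvalue of the Newtonian potential on `L²(D)`, and `φ` is an eigenfunction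
with `‖φ‖_{L²(D)} = 1`: the eigenspace of `lam` is the complex line spanned by `φ`. -/
def IsSimpleNewtonianEigenpair (D : Set R3) (lam : ℝ) (φ : L2 D) : Prop :=
  ‖φ‖ = 1 ∧ IsNewtonianEigen D lam φ ∧ ∀ f : L2 D, IsNewtonianEigen D lam f → ∃ c : ℂ, f = c • φ

/-- The Kerr nonlinearity `N(z) = z + |z|² z`. -/
noncomputable def kerr (z : ℂ) : ℂ := z + (‖z‖ : ℂ) ^ 2 * z

/-- `ω` is a nonlinear dielectric resonance at contrast `τ` with resonant state `u`: `u` is a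
nontrivial element of `H²(D)` with `u = τ ω² K_D^ω[N(u)]` on `D`. The requirement `N(u) ∈ L²(D)`
gives a meaning to the potential; it is automatic when `H²(D)` embeds into `L^∞(D)`, as it does
for a domain with smooth boundary. -/
def IsNonlinearResonance (D : Set R3) (τ : ℝ) (ω : ℂ) (u : H2 D) : Prop :=
  u ≠ 0 ∧ MemLp (fun x => kerr (toL2 u x)) 2 (volume.restrict D) ∧
    ∀ᵐ x ∂(volume.restrict D),
      toL2 u x = τ * ω ^ 2 * volumePotential D ω (fun y => kerr (toL2 u y)) x

/-- `ω` is a linear dielectric resonance at contrast `τ` with resonant state `u`: `u` is a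
nontrivial element of `H²(D)` with `u = τ ω² K_D^ω[u]` on `D`. -/
def IsLinearResonance (D : Set R3) (τ : ℝ) (ω : ℂ) (u : H2 D) : Prop :=
  u ≠ 0 ∧ ∀ᵐ x ∂(volume.restrict D), toL2 u x = τ * ω ^ 2 * volumePotential D ω (toL2 u) x

/-- `τ ↦ (ω τ, φs τ)` is, for large contrast `τ`, a family of linear dielectric resonances and
resonant states associated with the eigenpair `(lam, φ)` of the Newtonian potential:
`ω(τ) = (lam τ)^{-1/2} + O(τ⁻¹)`, `φs(τ) = φ + O(τ^{-1/2})` in `L²(D)`, `φs(τ) - φ ⊥ φ`. -/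
def IsLinearResonanceFamily (D : Set R3) (lam : ℝ) (φ : L2 D) (ω : ℝ → ℂ) (φs : ℝ → H2 D) :
    Prop :=
  (∀ᶠ τ in atTop, IsLinearResonance D τ (ω τ) (φs τ) ∧ inner ℂ φ (toL2 (φs τ) - φ) = 0) ∧
  (fun τ => ω τ - ((1 / Real.sqrt (lam * τ) : ℝ) : ℂ)) =O[atTop] (fun τ : ℝ => τ⁻¹) ∧
  (fun τ => toL2 (φs τ) - φ) =O[atTop] (fun τ : ℝ => (Real.sqrt τ)⁻¹)

/-- The parameter region `{(a, τ) : a > 0, τ > 0, a + τ⁻¹ < δ}`. -/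
def paramRegion (δ : ℝ) : Set (ℝ × ℝ) :=
  {p | 0 < p.1 ∧ 0 < p.2 ∧ p.1 + p.2⁻¹ < δ}

end NonlinearResonance

/-! Put ε = τ^{-1/2} and ω = κε, and take the source f = N(u) as unknown instead of u. Since τω² =
κ², the state is u = κ² K^{κε}[f] and the equation reads f = u + |u|²u. Scaling f = a w and b = a²
turns this, together with the normalization ⟨φ, u⟩ = a, into a system `residual` = 0 for (κ, w) with
parameters (b, ε). It is real analytic up to and including b = ε = 0, where it is solved by κ₀ =
λ^{-1/2} and w = φ. Working with sources has a second benefit: in three dimensions the potential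
maps L²(D) into L^∞(D), so the cubic term is a bounded trilinear expression in potentials, and no
embedding of H²(D), hence no regularity of ∂D, is needed.

At the base point the linearization in (κ, w) is bijective (`linearized_ker`, `linearized_range`).
The only obstruction, the kernel of λ - K, is spanned by φ because λ is simple, and the frequency
variable together with the normalization removes it. Concretely, S = λ - K + ⟨φ,·⟩φ is invertible by
the Fredholm alternative (`exists_shifted_equiv`). The analytic implicit function theorem then gives
one branch Φ(b, ε) (`exists_branch`). It serves b = a² for the nonlinear resonances and b = 0 for
the linear ones, and every linear family eventually coincides with it at b = 0
(`IsLinFamily.eventually_eq`).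

Comparisons between the two kinds of resonances are Lipschitz bounds along Φ. The second-order
formula for ω is the Taylor expansion of κ(0, ε), whose slope (`hasDerivAt_branch`) comes from
differentiating ⟨φ, u⟩ = 1 and from ∂_ω K^ω = i/(4π) ∫_D at ω = 0 (`hasDerivAt_inner_radialOpTwo`).

Uniqueness among all small H² states needs more than the implicit function theorem, which only sees
sources with f/a close to φ. Since -(Δ + ω²)u = τω² f, a small u has a small source. The cubic term
is then relatively small, and invertibility of S forces f to be nearly aφ (`norm_source_sub_le`,
`exists_near`). A phase rotation reduces ⟨φ, u⟩ to a positive number.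

The analytic input is collected in `exists_cavityModel`. Holomorphy in ω follows from an exponential
in the Banach algebra of bounded functions of |x - y|. Values in H²(D) follow from interior
estimates in a larger ball (`interior_estimate`, `exists_potential`), and positivity of λ from that
of the Newtonian energy (`newton_energy_nonneg`). -/

namespace NonlinearResonance

open scoped ComplexConjugate BoundedContinuousFunction ENNReal

set_option linter.unusedSectionVars false

/-! ### Abstract resonance problem and its linearization -/

section

/-- An abstract version of the resonance problem. `H` plays the role of `L²(D)`, `X` that of
`L^∞(D)` and `V` that of `H²(D)`; `pot ω` and `potX ω` are the volume potential with values in `V`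
and `X`, and `x ↦ N (M x (C x)) x` is the cubic nonlinearity. -/
structure CavityModel (H X V : Type*) [NormedAddCommGroup H] [InnerProductSpace ℂ H]
    [NormedAddCommGroup X] [NormedSpace ℂ X] [NormedAddCommGroup V] [NormedSpace ℂ V] where
  pot : ℂ → H →L[ℂ] V
  potX : ℂ → H →L[ℂ] X
  ι : V →L[ℂ] H
  M : X →L[ℂ] X →L[ℂ] X
  N : X →L[ℂ] X →L[ℂ] H
  C : X →ₗ⋆[ℂ] X
  lam : ℝ
  φ : H
  S : H ≃L[ℂ] H
  m : ℂ
  c : ℝ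
  pot_diff : Differentiable ℂ pot
  potX_diff : Differentiable ℂ potX
  ι_inj : Function.Injective ι
  norm_C : ∀ x, ‖C x‖ = ‖x‖
  norm_le : ∀ ω f, ‖ω‖ ≤ 1 → ‖f‖ ≤ c * ‖pot ω f‖
  lam_pos : 0 < lam
  norm_φ : ‖φ‖ = 1
  eigen : ι (pot 0 φ) = (lam : ℂ) • φ
  inner_pot : ∀ f, inner ℂ φ (ι (pot 0 f)) = lam * inner ℂ φ f
  S_apply : ∀ f, S f = (lam : ℂ) • f - ι (pot 0 f) + inner ℂ φ f • φ
  deriv_pot : HasDerivAt (fun ω => inner ℂ φ (ι (pot ω φ))) m 0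

namespace CavityModel

variable {H X V : Type*} [NormedAddCommGroup H] [InnerProductSpace ℂ H] [CompleteSpace H]
  [NormedAddCommGroup X] [NormedSpace ℂ X] [CompleteSpace X]
  [NormedAddCommGroup V] [NormedSpace ℂ V] [CompleteSpace V]
  (Q : CavityModel H X V)

/-- The cubic nonlinearity. -/
noncomputable def cubic (x : X) : H := Q.N (Q.M x (Q.C x)) x

/-- For real c = a this produces the factor a² that becomes the parameter b; for |c| = 1 it is the
phase invariance of the problem. -/
theorem cubic_smul (c : ℂ) (x : X) : Q.cubic (c • x) = ((‖c‖ : ℂ) ^ 2 * c) • Q.cubic x := by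
  have h : (‖c‖ : ℂ) ^ 2 * c = c * conj c * c := by
    rw [Complex.mul_conj, Complex.normSq_eq_norm_sq]; push_cast; rfl
  rw [h]
  simp only [cubic, map_smulₛₗ, _root_.smul_apply, smul_smul,
    RingHom.id_apply]
  congr 1; ring

theorem norm_cubic_le (x : X) : ‖Q.cubic x‖ ≤ ‖Q.N‖ * ‖Q.M‖ * ‖x‖ ^ 3 := by
  calc ‖Q.cubic x‖ ≤ ‖Q.N‖ * ‖Q.M x (Q.C x)‖ * ‖x‖ := Q.N.le_opNorm₂ _ _
    _ ≤ ‖Q.N‖ * (‖Q.M‖ * ‖x‖ * ‖Q.C x‖) * ‖x‖ := by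
        gcongr
        exact Q.M.le_opNorm₂ _ _
    _ = _ := by rw [Q.norm_C]; ring

/-- Conjugation is only real linear, which is why analyticity is real throughout. The exponent `⊤`
in `WithTop ℕ∞` means analytic, not merely smooth. -/
theorem contDiff_cubic : ContDiff ℝ ⊤ Q.cubic := by
  have hC : ContDiff ℝ ⊤ Q.C := by
    have hc : Continuous Q.C := (AddMonoidHomClass.isometry_of_norm Q.C Q.norm_C).continuous
    exact ((Q.C : X →+ X).toRealLinearMap hc).contDiff
  have hM : ContDiff ℂ ⊤ (fun p : X × X × X => Q.N (Q.M p.1 p.2.1) p.2.2) :=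
    (Q.N.contDiff.comp ((Q.M.contDiff.comp contDiff_fst).clm_apply
      (contDiff_fst.comp contDiff_snd))).clm_apply (contDiff_snd.comp contDiff_snd)
  exact (hM.restrict_scalars ℝ).comp (contDiff_id.prodMk (hC.prodMk contDiff_id))

theorem contDiff_pot : ContDiff ℂ ⊤ (fun p : ℂ × H => Q.pot p.1 p.2) :=
  (Q.pot_diff.contDiff.comp contDiff_fst).clm_apply contDiff_snd

theorem contDiff_potX : ContDiff ℂ ⊤ (fun p : ℂ × H => Q.potX p.1 p.2) :=
  (Q.potX_diff.contDiff.comp contDiff_fst).clm_apply contDiff_snd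

/-- Scaled variables: parameters `(b, ε)` and unknowns `(κ, w)`, with frequency `κ ε` and source
`κ² w`. -/
noncomputable def scaled (p : (ℝ × ℝ) × (ℂ × H)) : ℂ × H := (p.2.1 * (p.1.2 : ℂ), p.2.1 ^ 2 • p.2.2)

theorem contDiff_scaled : ContDiff ℝ ⊤ (scaled (H := H)) := by
  have h1 : ContDiff ℝ ⊤ (fun p : (ℝ × ℝ) × (ℂ × H) => (p.1.2 : ℂ)) :=
    Complex.ofRealCLM.contDiff.comp (contDiff_snd.comp contDiff_fst)
  have h2 : ContDiff ℝ ⊤ (fun p : (ℝ × ℝ) × (ℂ × H) => p.2.1) := contDiff_fst.comp contDiff_snd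
  have h3 : ContDiff ℝ ⊤ (fun p : (ℝ × ℝ) × (ℂ × H) => p.2.2) := contDiff_snd.comp contDiff_snd
  have h4 : ContDiff ℝ ⊤ (fun p : ℂ × H => p.1 • p.2) :=
    ContDiff.restrict_scalars ℝ (𝕜' := ℂ) contDiff_smul
  exact (h2.mul h1).prodMk (h4.comp ((h2.pow 2).prodMk h3))

/-- The state generated by the unknowns `(κ, w)`. -/
noncomputable def state (p : (ℝ × ℝ) × (ℂ × H)) : V := Q.pot (scaled p).1 (scaled p).2

theorem contDiff_state : ContDiff ℝ ⊤ Q.state :=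
  (Q.contDiff_pot.restrict_scalars ℝ).comp contDiff_scaled

/-- The equation to be solved for `(κ, w)` in terms of `(b, ε)`. -/
noncomputable def residual (p : (ℝ × ℝ) × (ℂ × H)) : ℂ × H :=
  (inner ℂ Q.φ (Q.ι (Q.state p)) - 1,
    p.2.2 - Q.ι (Q.state p) - (p.1.1 : ℂ) • Q.cubic (Q.potX (scaled p).1 (scaled p).2))

theorem contDiff_residual : ContDiff ℝ ⊤ Q.residual := by
  have hι : ContDiff ℝ ⊤ (fun p => Q.ι (Q.state p)) :=
    (Q.ι.contDiff.restrict_scalars ℝ).comp Q.contDiff_state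
  have h1 : ContDiff ℝ ⊤ (fun p => inner ℂ Q.φ (Q.ι (Q.state p))) :=
    ((innerSL ℂ Q.φ).contDiff.restrict_scalars ℝ).comp hι
  have h2 : ContDiff ℝ ⊤ (fun p : (ℝ × ℝ) × (ℂ × H) => (p.1.1 : ℂ)) :=
    Complex.ofRealCLM.contDiff.comp (contDiff_fst.comp contDiff_fst)
  have h3 : ContDiff ℝ ⊤
      (fun p : (ℝ × ℝ) × (ℂ × H) => Q.cubic (Q.potX (scaled p).1 (scaled p).2)) :=
    Q.contDiff_cubic.comp ((Q.contDiff_potX.restrict_scalars ℝ).comp contDiff_scaled)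
  have h4 : ContDiff ℝ ⊤ (fun p : ℂ × H => p.1 • p.2) :=
    ContDiff.restrict_scalars ℝ (𝕜' := ℂ) contDiff_smul
  exact (h1.sub contDiff_const).prodMk (((contDiff_snd.comp contDiff_snd).sub hι).sub
    (h4.comp (h2.prodMk h3)))

/-- The limiting scaled frequency `lam^{-1/2}`. -/
noncomputable def κ₀ : ℝ := 1 / Real.sqrt Q.lam

theorem κ₀_pos : 0 < Q.κ₀ := by
  have := Real.sqrt_pos.2 Q.lam_pos
  unfold κ₀; positivity

theorem κ₀_sq_mul : (Q.κ₀ : ℂ) ^ 2 * Q.lam = 1 := by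
  have h : Q.κ₀ ^ 2 * Q.lam = 1 := by
    have := Real.sq_sqrt Q.lam_pos.le
    have h2 := (Real.sqrt_pos.2 Q.lam_pos).ne'
    unfold κ₀; field_simp; rw [this]
  exact_mod_cast h

theorem inner_φ_φ : inner ℂ Q.φ Q.φ = 1 := by
  rw [inner_self_eq_norm_sq_to_K, Q.norm_φ]; simp

theorem state_base : Q.ι (Q.state ((0, 0), ((Q.κ₀ : ℂ), Q.φ))) = Q.φ := by
  simp only [state, scaled, Complex.ofReal_zero, mul_zero, map_smul, Q.eigen, smul_smul,
    Q.κ₀_sq_mul, one_smul]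

theorem residual_base : Q.residual ((0, 0), ((Q.κ₀ : ℂ), Q.φ)) = 0 := by
  simp only [residual, state_base, inner_φ_φ, Complex.ofReal_zero, zero_smul, sub_self]
  rfl

theorem S_φ : Q.S Q.φ = Q.φ := by
  rw [Q.S_apply, Q.eigen, Q.inner_φ_φ]; simp

/-- By symmetry of the potential, pairing with φ annihilates (λ - K)f, so only the rank-one part of
S survives. -/
theorem inner_φ_S (f : H) : inner ℂ Q.φ (Q.S f) = inner ℂ Q.φ f := by
  rw [Q.S_apply, inner_add_right, inner_sub_right, inner_smul_right, inner_smul_right, Q.inner_pot,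
    Q.inner_φ_φ]
  ring

theorem inner_φ_S_symm (f : H) : inner ℂ Q.φ (Q.S.symm f) = inner ℂ Q.φ f := by
  conv_rhs => rw [← Q.S.apply_symm_apply f, inner_φ_S]

/-- The linearization of the residual in the unknowns. -/
noncomputable def linearized : (ℂ × H) →L[ℂ] (ℂ × H) :=
  let P : (ℂ × H) →L[ℂ] ℂ := (innerSL ℂ Q.φ) ∘L (.snd ℂ ℂ H)
  let q : (ℂ × H) →L[ℂ] ℂ := (2 * Q.κ₀ * Q.lam : ℂ) • .fst ℂ ℂ H
  (P + q).prod
    (.snd ℂ ℂ H - (Q.κ₀ : ℂ) ^ 2 • (Q.ι ∘L Q.pot 0 ∘L .snd ℂ ℂ H) - q.smulRight Q.φ)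

theorem linearized_apply (k : ℂ) (v : H) : Q.linearized (k, v) =
    (inner ℂ Q.φ v + 2 * Q.κ₀ * Q.lam * k,
      v - (Q.κ₀ : ℂ) ^ 2 • Q.ι (Q.pot 0 v) - (2 * Q.κ₀ * Q.lam * k : ℂ) • Q.φ) := by
  simp [linearized]

/-- Multiplying by λ = κ₀^{-2} turns 1 - κ₀²K into λ - K, which is S minus its rank-one part. Both
halves of the bijectivity proof, and the a priori bound on sources, are read off from this form. -/
theorem lam_smul_linearized (v : H) (q : ℂ) :
    (Q.lam : ℂ) • (v - (Q.κ₀ : ℂ) ^ 2 • Q.ι (Q.pot 0 v) - q • Q.φ) =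
      Q.S v - (inner ℂ Q.φ v + Q.lam * q) • Q.φ := by
  rw [Q.S_apply, smul_sub, smul_sub, smul_smul, mul_comm (Q.lam : ℂ) (_ ^ 2), Q.κ₀_sq_mul,
    smul_smul]
  module

theorem lam_ne_zero : (Q.lam : ℂ) ≠ 0 := by exact_mod_cast Q.lam_pos.ne'

theorem κ₀_ne_zero : (Q.κ₀ : ℂ) ≠ 0 := by exact_mod_cast Q.κ₀_pos.ne'

/-- Pairing the second equation with φ kills v and leaves k = 0; the first equation then gives ⟨φ,
v⟩ = 0, and S v = 0 follows. -/
theorem linearized_ker : LinearMap.ker (Q.linearized : (ℂ × H) →ₗ[ℂ] ℂ × H) = ⊥ := by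
  rw [LinearMap.ker_eq_bot']
  rintro ⟨k, v⟩ h
  simp only [ContinuousLinearMap.coe_coe, linearized_apply, Prod.mk_eq_zero] at h
  obtain ⟨h1, h2⟩ := h
  have h3 := Q.lam_smul_linearized v (2 * Q.κ₀ * Q.lam * k)
  rw [h2, smul_zero, eq_comm, sub_eq_zero] at h3
  have h4 := congrArg (inner ℂ Q.φ) h3
  rw [inner_φ_S, inner_smul_right, Q.inner_φ_φ, mul_one, left_eq_add, mul_eq_zero] at h4
  have h5 : 2 * (Q.κ₀ : ℂ) * Q.lam * k = 0 := h4.resolve_left Q.lam_ne_zero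
  have hk : k = 0 := by
    simpa [Q.lam_ne_zero, Q.κ₀_ne_zero] using h5
  rw [h5, add_zero] at h1
  rw [h1, h5, mul_zero, add_zero, zero_smul] at h3
  have hv : v = 0 := by simpa using h3
  rw [hk, hv]; rfl

theorem linearized_range : LinearMap.range (Q.linearized : (ℂ × H) →ₗ[ℂ] ℂ × H) = ⊤ := by
  rw [LinearMap.range_eq_top]
  rintro ⟨d, f⟩
  set t : ℂ := inner ℂ Q.φ f
  -- Pairing the second equation with φ forces 2κ₀λk = -t, and the first then forces ⟨φ, v⟩ = d + t;
  -- the multiple of φ corrects λ S⁻¹f, whose φ-component is λt.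
  refine ⟨(-t / (2 * Q.κ₀ * Q.lam), (Q.lam : ℂ) • Q.S.symm f + (d + t - Q.lam * t) • Q.φ), ?_⟩
  have hq : (2 * Q.κ₀ * Q.lam : ℂ) * (-t / (2 * Q.κ₀ * Q.lam)) = -t := by
    have := Q.lam_ne_zero; have := Q.κ₀_ne_zero; field_simp
  have hin : inner ℂ Q.φ ((Q.lam : ℂ) • Q.S.symm f + (d + t - Q.lam * t) • Q.φ) = d + t := by
    rw [inner_add_right, inner_smul_right, inner_smul_right, inner_φ_S_symm, Q.inner_φ_φ]
    ring
  simp only [ContinuousLinearMap.coe_coe, linearized_apply, hq]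
  refine Prod.ext ?_ ?_
  · simp only [hin]; ring
  · refine smul_right_injective H Q.lam_ne_zero ?_
    simp only
    rw [lam_smul_linearized, hin, map_add, map_smul, map_smul, Q.S_φ, Q.S.apply_symm_apply]
    module

/-- For b = ε = 0 the cubic term is absent and the operator is frozen at frequency κε = 0, so the
residual is polynomial in (κ, w) and complex differentiable. -/
theorem hasFDerivAt_residual_snd : HasFDerivAt (fun y : ℂ × H => Q.residual ((0, 0), y))
    (Q.linearized.restrictScalars ℝ) ((Q.κ₀ : ℂ), Q.φ) := by
  have h : (fun y : ℂ × H => Q.residual ((0, 0), y)) = fun y =>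
      (y.1 ^ 2 * (Q.lam * inner ℂ Q.φ y.2) - 1, y.2 - y.1 ^ 2 • Q.ι (Q.pot 0 y.2)) := by
    funext y
    simp [residual, state, scaled, Q.inner_pot]
  rw [h]
  refine HasFDerivAt.restrictScalars ℝ ?_
  have h1 : HasFDerivAt (fun y : ℂ × H => y.1) (.fst ℂ ℂ H) ((Q.κ₀ : ℂ), Q.φ) := hasFDerivAt_fst
  have h2 : HasFDerivAt (fun y : ℂ × H => y.2) (.snd ℂ ℂ H) ((Q.κ₀ : ℂ), Q.φ) := hasFDerivAt_snd
  have h3 := (innerSL ℂ Q.φ).hasFDerivAt.comp ((Q.κ₀ : ℂ), Q.φ) h2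
  have h4 := (Q.ι ∘L Q.pot 0).hasFDerivAt.comp ((Q.κ₀ : ℂ), Q.φ) h2
  have h5 := (((h1.pow 2).mul (h3.const_mul (Q.lam : ℂ))).sub_const 1).prodMk
    (h2.sub ((h1.pow 2).smul h4))
  refine h5.congr_fderiv ?_
  ext y
  · simp [linearized_apply, Q.norm_φ]; ring
  · simp [linearized_apply, Q.eigen, smul_smul, ← Complex.coe_smul]
  · simp [linearized_apply, ← mul_assoc, Q.κ₀_sq_mul]
  · simp [linearized_apply]

theorem isInvertible_fderiv : (fderiv ℝ Q.residual ((0, 0), ((Q.κ₀ : ℂ), Q.φ)) ∘L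
    .inr ℝ (ℝ × ℝ) (ℂ × H)).IsInvertible := by
  have hd : DifferentiableAt ℝ Q.residual ((0, 0), ((Q.κ₀ : ℂ), Q.φ)) :=
    (Q.contDiff_residual.differentiable (by simp)).differentiableAt
  have h1 : HasFDerivAt (fun y : ℂ × H => (((0, 0) : ℝ × ℝ), y)) (.inr ℝ (ℝ × ℝ) (ℂ × H))
      ((Q.κ₀ : ℂ), Q.φ) := hasFDerivAt_prodMk_right _ _
  have h2 := hd.hasFDerivAt.comp ((Q.κ₀ : ℂ), Q.φ) h1
  rw [h2.unique Q.hasFDerivAt_residual_snd]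
  refine ⟨(ContinuousLinearEquiv.ofBijective Q.linearized Q.linearized_ker
    Q.linearized_range).restrictScalars ℝ, ?_⟩
  ext <;> simp

end CavityModel

end

/-! ### Solution branch, rescaling, and a priori control of small solutions -/

section

namespace CavityModel

variable {H X V : Type*} [NormedAddCommGroup H] [InnerProductSpace ℂ H] [CompleteSpace H]
  [NormedAddCommGroup X] [NormedSpace ℂ X] [CompleteSpace X]
  [NormedAddCommGroup V] [NormedSpace ℂ V] [CompleteSpace V]
  (Q : CavityModel H X V)

/-- The base point of the bifurcation problem. -/
noncomputable def base : ℂ × H := ((Q.κ₀ : ℂ), Q.φ)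

/-- The solution branch of the scaled problem given by the implicit function theorem. -/
theorem exists_branch : ∃ (Φ : ℝ × ℝ → ℂ × H) (r K : ℝ), 0 < r ∧ 0 ≤ K ∧ Φ 0 = Q.base ∧
    (∀ p, ‖p‖ < r → AnalyticAt ℝ Φ p ∧ AnalyticAt ℝ (fun p => Q.state (p, Φ p)) p ∧
      Q.residual (p, Φ p) = 0) ∧
    (∀ p y, ‖p‖ < r → ‖y - Q.base‖ < r → Q.residual (p, y) = 0 → y = Φ p) ∧
    (∀ p q, ‖p‖ < r → ‖q‖ < r → ‖Φ p - Φ q‖ ≤ K * ‖p - q‖ ∧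
      ‖Q.state (p, Φ p) - Q.state (q, Φ q)‖ ≤ K * ‖p - q‖) := by
  have cdf : ContDiffAt ℝ ⊤ Q.residual ((0 : ℝ × ℝ), Q.base) := Q.contDiff_residual.contDiffAt
  have hb : Q.residual ((0 : ℝ × ℝ), Q.base) = 0 := Q.residual_base
  have hn : (⊤ : WithTop ℕ∞) ≠ 0 := by simp
  have inv : (fderiv ℝ Q.residual ((0 : ℝ × ℝ), Q.base) ∘L
    .inr ℝ (ℝ × ℝ) (ℂ × H)).IsInvertible := Q.isInvertible_fderiv
  set Φ := cdf.implicitFunction hn inv with hΦ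
  have h0 : Φ 0 = Q.base := cdf.implicitFunction_apply_self hn inv
  have h1 : ContDiffAt ℝ ⊤ Φ 0 := cdf.contDiffAt_implicitFunction hn inv
  have h2 : ∀ᶠ p in 𝓝 (0 : ℝ × ℝ), Q.residual (p, Φ p) = 0 := by
    simpa only [hb] using cdf.eventually_apply_implicitFunction hn inv
  -- The equivalence on a full neighbourhood of the base point supplies local uniqueness.
  have h3 : ∀ᶠ v in 𝓝 ((0 : ℝ × ℝ), Q.base), Q.residual v = 0 ↔ Φ v.1 = v.2 := by
    simpa only [hb] using cdf.eventually_apply_eq_iff_implicitFunction hn inv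
  have h4 : ContDiffAt ℝ ⊤ (fun p => Q.state (p, Φ p)) 0 :=
    Q.contDiff_state.contDiffAt.comp 0 (contDiffAt_id.prodMk h1)
  have a1 := h1.analyticAt.eventually_analyticAt
  have a2 := h4.analyticAt.eventually_analyticAt
  -- A C¹ map is locally Lipschitz; these bounds for Φ and for the state are behind all comparisons
  -- of families.
  obtain ⟨K1, s1, hs1, hL1⟩ := (h1.of_le (m := 1) le_top).exists_lipschitzOnWith
  obtain ⟨K2, s2, hs2, hL2⟩ := (h4.of_le (m := 1) le_top).exists_lipschitzOnWith
  obtain ⟨r1, hr1, H1⟩ := Metric.eventually_nhds_iff.1 (a1.and (a2.and (h2.and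
    (Filter.Eventually.and hs1 hs2))))
  obtain ⟨r2, hr2, H2⟩ := Metric.eventually_nhds_iff.1 h3
  simp only [dist_zero_right] at H1
  refine ⟨Φ, min r1 r2, max K1 K2, lt_min hr1 hr2, le_max_of_le_left K1.2, h0, ?_, ?_, ?_⟩
  · intro p hp
    have := H1 (hp.trans_le (min_le_left _ _))
    exact ⟨this.1, this.2.1, this.2.2.1⟩
  · intro p y hp hy hres
    have : dist (p, y) ((0 : ℝ × ℝ), Q.base) < r2 := by
      rw [Prod.dist_eq, max_lt_iff, dist_zero_right, dist_eq_norm]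
      exact ⟨hp.trans_le (min_le_right _ _), hy.trans_le (min_le_right _ _)⟩
    exact ((H2 this).1 hres).symm
  · intro p q hp hq
    have hp' := H1 (hp.trans_le (min_le_left _ _))
    have hq' := H1 (hq.trans_le (min_le_left _ _))
    have e1 := hL1.dist_le_mul p hp'.2.2.2.1 q hq'.2.2.2.1
    have e2 := hL2.dist_le_mul p hp'.2.2.2.2 q hq'.2.2.2.2
    rw [dist_eq_norm, dist_eq_norm] at e1 e2
    exact ⟨e1.trans (by gcongr; exact le_max_left _ _),
      e2.trans (by gcongr; exact le_max_right _ _)⟩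

/-- `ω` is a nonlinear resonance at contrast `τ` with state `u` and source `f = N(u)`. -/
def IsNonlinRes (τ : ℝ) (ω : ℂ) (u : V) : Prop :=
  u ≠ 0 ∧ ∃ f : H, u = (τ * ω ^ 2 : ℂ) • Q.pot ω f ∧
    f = Q.ι u + Q.cubic ((τ * ω ^ 2 : ℂ) • Q.potX ω f)

/-- `ω` is a linear resonance at contrast `τ` with state `u`. -/
def IsLinRes (τ : ℝ) (ω : ℂ) (u : V) : Prop :=
  u ≠ 0 ∧ u = (τ * ω ^ 2 : ℂ) • Q.pot ω (Q.ι u)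

theorem residual_eq_zero_iff (b ε : ℝ) (κ : ℂ) (w : H) : Q.residual ((b, ε), (κ, w)) = 0 ↔
    inner ℂ Q.φ (Q.ι (Q.state ((b, ε), (κ, w)))) = 1 ∧
    w = Q.ι (Q.state ((b, ε), (κ, w))) + (b : ℂ) • Q.cubic (κ ^ 2 • Q.potX (κ * ε) w) := by
  simp only [residual, scaled, map_smul, Prod.mk_eq_zero, sub_eq_zero]
  refine and_congr_right fun _ => ?_
  rw [sub_eq_iff_eq_add']

theorem state_eq (b ε : ℝ) (κ : ℂ) (w : H) :
    Q.state ((b, ε), (κ, w)) = κ ^ 2 • Q.pot (κ * ε) w := by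
  simp [state, scaled]

theorem contrast_eq {τ ε : ℝ} (h : τ * ε ^ 2 = 1) (κ : ℂ) : (τ * (κ * ε) ^ 2 : ℂ) = κ ^ 2 := by
  have : (τ : ℂ) * (ε : ℂ) ^ 2 = 1 := by exact_mod_cast h
  linear_combination κ ^ 2 * this

/-- The source is f = a w: the cubic term scales by a³ = a · b with b = a². The state is nonzero
because its φ-component is a. -/
theorem isNonlinRes_of_residual {τ ε a : ℝ} (h : τ * ε ^ 2 = 1) (ha : 0 < a) {κ : ℂ} {w : H}
    (hr : Q.residual ((a ^ 2, ε), (κ, w)) = 0) :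
    Q.IsNonlinRes τ (κ * ε) ((a : ℂ) • Q.state ((a ^ 2, ε), (κ, w))) := by
  obtain ⟨h1, h2⟩ := (Q.residual_eq_zero_iff _ _ _ _).1 hr
  refine ⟨?_, (a : ℂ) • w, ?_, ?_⟩
  · intro h0
    have h3 := congrArg (fun v => inner ℂ Q.φ (Q.ι v)) h0
    simp only [map_smul, inner_smul_right, h1, map_zero, inner_zero_right, mul_one] at h3
    exact ha.ne' (by exact_mod_cast h3)
  · rw [contrast_eq h, state_eq, map_smul, smul_comm]
  · rw [contrast_eq h, (Q.potX _).map_smul, smul_comm (κ ^ 2) (a : ℂ), cubic_smul, map_smul]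
    conv_lhs => rw [h2]
    rw [smul_add, smul_smul, Complex.norm_real, Real.norm_of_nonneg ha.le]
    congr 2
    push_cast; ring

/-- The converse rescaling, available once the phase has been chosen so that the φ-component of u is
real and positive. -/
theorem residual_of_nonlin {τ ε a : ℝ} (h : τ * ε ^ 2 = 1) (ha : 0 < a) {κ : ℂ} {u : V} {f : H}
    (hu : u = (τ * (κ * ε) ^ 2 : ℂ) • Q.pot (κ * ε) f)
    (hf : f = Q.ι u + Q.cubic ((τ * (κ * ε) ^ 2 : ℂ) • Q.potX (κ * ε) f))
    (hi : inner ℂ Q.φ (Q.ι u) = a) :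
    Q.residual ((a ^ 2, ε), (κ, (a : ℂ)⁻¹ • f)) = 0 ∧
      u = (a : ℂ) • Q.state ((a ^ 2, ε), (κ, (a : ℂ)⁻¹ • f)) := by
  have ha' : (a : ℂ) ≠ 0 := by exact_mod_cast ha.ne'
  rw [contrast_eq h] at hu hf
  have hs : Q.state ((a ^ 2, ε), (κ, (a : ℂ)⁻¹ • f)) = (a : ℂ)⁻¹ • u := by
    rw [state_eq, map_smul, hu, smul_comm]
  refine ⟨(Q.residual_eq_zero_iff _ _ _ _).2 ⟨?_, ?_⟩, ?_⟩
  · rw [hs, map_smul, inner_smul_right, hi, inv_mul_cancel₀ ha']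
  · rw [hs, map_smul, map_smul, smul_comm (κ ^ 2) (a : ℂ)⁻¹, cubic_smul]
    conv_lhs => rw [hf]
    rw [smul_add, smul_smul, norm_inv, Complex.norm_real, Real.norm_of_nonneg ha.le]
    congr 2
    push_cast; field_simp
  · rw [hs, smul_inv_smul₀ ha']

theorem isLinRes_of_residual {τ ε : ℝ} (h : τ * ε ^ 2 = 1) {κ : ℂ} {w : H}
    (hr : Q.residual ((0, ε), (κ, w)) = 0) :
    Q.IsLinRes τ (κ * ε) (Q.state ((0, ε), (κ, w))) ∧
      inner ℂ Q.φ (Q.ι (Q.state ((0, ε), (κ, w)))) = 1 ∧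
      Q.ι (Q.state ((0, ε), (κ, w))) = w := by
  obtain ⟨h1, h2⟩ := (Q.residual_eq_zero_iff _ _ _ _).1 hr
  rw [Complex.ofReal_zero, zero_smul, add_zero] at h2
  refine ⟨⟨fun h0 => ?_, ?_⟩, h1, h2.symm⟩
  · rw [h0] at h1; simp at h1
  · rw [← h2, contrast_eq h, state_eq]

theorem residual_of_linRes {τ ε : ℝ} (h : τ * ε ^ 2 = 1) {κ : ℂ} {u : V}
    (hu : Q.IsLinRes τ (κ * ε) u) (hi : inner ℂ Q.φ (Q.ι u - Q.φ) = 0) :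
    Q.residual ((0, ε), (κ, Q.ι u)) = 0 ∧ Q.state ((0, ε), (κ, Q.ι u)) = u := by
  have hs : Q.state ((0, ε), (κ, Q.ι u)) = u := by
    rw [state_eq, ← contrast_eq h]; exact hu.2.symm
  refine ⟨(Q.residual_eq_zero_iff _ _ _ _).2 ⟨?_, ?_⟩, hs⟩
  · rw [hs]
    rwa [inner_sub_right, Q.inner_φ_φ, sub_eq_zero] at hi
  · simp [hs]

/-- The source satisfies f - κ₀²Kf = (perturbation of the operator) f + (cubic term), and the right
side is at most E‖f‖. Applying λS⁻¹ controls the part of f orthogonal to φ. The φ-component differs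
from a only by that of the cubic term, since f = u + cubic term and ⟨φ, u⟩ = a. -/
theorem norm_source_sub_le {κ : ℂ} {ε a : ℝ} {u : V} {f : H} {E : ℝ}
    (hu : u = κ ^ 2 • Q.pot (κ * ε) f) (hf : f = Q.ι u + Q.cubic (κ ^ 2 • Q.potX (κ * ε) f))
    (hi : inner ℂ Q.φ (Q.ι u) = a)
    (hE : ‖κ ^ 2 • (Q.ι ∘L Q.pot (κ * ε)) - (Q.κ₀ : ℂ) ^ 2 • (Q.ι ∘L Q.pot 0)‖ +
      ‖Q.N‖ * ‖Q.M‖ * (‖κ ^ 2‖ * ‖Q.potX (κ * ε)‖) ^ 3 * ‖f‖ ^ 2 ≤ E) :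
    ‖f - (a : ℂ) • Q.φ‖ ≤
      (Q.lam * ‖(Q.S.symm : H →L[ℂ] H)‖ + 1) * E * ‖f‖ := by
  set Δ := κ ^ 2 • (Q.ι ∘L Q.pot (κ * ε)) - (Q.κ₀ : ℂ) ^ 2 • (Q.ι ∘L Q.pot 0) with hΔ
  set T := Q.cubic (κ ^ 2 • Q.potX (κ * ε) f) with hT
  have hTn : ‖T‖ ≤ ‖Q.N‖ * ‖Q.M‖ * (‖κ ^ 2‖ * ‖Q.potX (κ * ε)‖) ^ 3 * ‖f‖ ^ 2 * ‖f‖ := by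
    refine (Q.norm_cubic_le _).trans ?_
    rw [norm_smul]
    calc _ ≤ ‖Q.N‖ * ‖Q.M‖ * (‖κ ^ 2‖ * (‖Q.potX (κ * ε)‖ * ‖f‖)) ^ 3 := by
          gcongr; exact ContinuousLinearMap.le_opNorm _ _
      _ = _ := by ring
  have hDn : ‖Δ f‖ ≤ ‖Δ‖ * ‖f‖ := Δ.le_opNorm f
  have hg : f - (Q.κ₀ : ℂ) ^ 2 • Q.ι (Q.pot 0 f) = Δ f + T := by
    have : Δ f = Q.ι u - (Q.κ₀ : ℂ) ^ 2 • Q.ι (Q.pot 0 f) := by simp [hΔ, hu]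
    rw [this, sub_add_eq_add_sub, ← hf]
  have hgn : ‖Δ f + T‖ ≤ E * ‖f‖ := by
    calc _ ≤ ‖Δ f‖ + ‖T‖ := norm_add_le _ _
      _ ≤ _ := add_le_add hDn hTn
      _ = _ := by rw [← add_mul]
      _ ≤ _ := by gcongr
  have hT' : ‖T‖ ≤ E * ‖f‖ := hTn.trans (by
    gcongr; exact (le_add_of_nonneg_left (norm_nonneg _)).trans hE)
  have h1 := Q.lam_smul_linearized f 0
  rw [zero_smul, sub_zero, hg, mul_zero, add_zero] at h1
  have h2 : f - inner ℂ Q.φ f • Q.φ = Q.S.symm ((Q.lam : ℂ) • (Δ f + T)) := by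
    rw [h1, map_sub, map_smul, Q.S.symm_apply_apply]
    congr 2
    rw [Q.S.eq_symm_apply, Q.S_φ]
  have h3 : ‖f - inner ℂ Q.φ f • Q.φ‖ ≤ ‖(Q.S.symm : H →L[ℂ] H)‖ * (Q.lam * (E * ‖f‖)) := by
    rw [h2]
    refine ((Q.S.symm : H →L[ℂ] H).le_opNorm _).trans ?_
    rw [norm_smul, Complex.norm_real, Real.norm_of_nonneg Q.lam_pos.le]
    have := Q.lam_pos
    gcongr
  have h4 : inner ℂ Q.φ f - a = inner ℂ Q.φ T := by
    rw [← hi]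
    conv_lhs => rw [hf]
    rw [inner_add_right]; ring
  have h5 : ‖(inner ℂ Q.φ f - a : ℂ) • Q.φ‖ ≤ E * ‖f‖ := by
    rw [norm_smul, Q.norm_φ, mul_one, h4]
    refine (norm_inner_le_norm _ _).trans ?_
    rwa [Q.norm_φ, one_mul]
  calc ‖f - (a : ℂ) • Q.φ‖
      = ‖(f - inner ℂ Q.φ f • Q.φ) + (inner ℂ Q.φ f - a : ℂ) • Q.φ‖ := by
        congr 1; module
    _ ≤ _ := (norm_add_le _ _).trans (add_le_add h3 h5)
    _ = _ := by ring

/-- Small solutions of the nonlinear problem have an almost parallel source. -/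
theorem exists_near (η : ℝ) (hη : 0 < η) : ∃ ρ > 0, ∀ (κ : ℂ) (ε a : ℝ) (u : V) (f : H),
    ‖κ - Q.κ₀‖ < ρ → |ε| < ρ → ‖u‖ < ρ → 0 < a → u = κ ^ 2 • Q.pot (κ * ε) f →
    f = Q.ι u + Q.cubic (κ ^ 2 • Q.potX (κ * ε) f) → inner ℂ Q.φ (Q.ι u) = a →
    ‖(a : ℂ)⁻¹ • f - Q.φ‖ < η := by
  set s := Q.lam * ‖(Q.S.symm : H →L[ℂ] H)‖ + 1 with hs
  have hs0 : 0 < s := by have := Q.lam_pos; positivity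
  -- The relative error as a function of (κ, ε, ‖u‖), with ‖f‖ replaced by its bound in terms of
  -- ‖u‖. It is continuous and vanishes at (κ₀, 0, 0).
  let E : ℂ × ℝ × ℝ → ℝ := fun p =>
    ‖p.1 ^ 2 • (Q.ι ∘L Q.pot (p.1 * p.2.1)) - (Q.κ₀ : ℂ) ^ 2 • (Q.ι ∘L Q.pot 0)‖ +
      ‖Q.N‖ * ‖Q.M‖ * (‖p.1 ^ 2‖ * ‖Q.potX (p.1 * p.2.1)‖) ^ 3 *
        (Q.c * (p.2.2 / ‖p.1 ^ 2‖)) ^ 2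
  have hκ : (Q.κ₀ : ℂ) ≠ 0 := Q.κ₀_ne_zero
  have hcont : ContinuousAt E ((Q.κ₀ : ℂ), 0, 0) := by
    have c1 : Continuous Q.pot := Q.pot_diff.continuous
    have c2 : Continuous Q.potX := Q.potX_diff.continuous
    have c3 : Continuous (fun p : ℂ × ℝ × ℝ => p.1 * (p.2.1 : ℂ)) := by fun_prop
    have c4 : Continuous (fun p : ℂ × ℝ × ℝ =>
        p.1 ^ 2 • (Q.ι ∘L Q.pot (p.1 * p.2.1)) - (Q.κ₀ : ℂ) ^ 2 • (Q.ι ∘L Q.pot 0)) :=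
      ((continuous_fst.pow 2).smul (continuous_const.clm_comp (c1.comp c3))).sub continuous_const
    have c5 : Continuous (fun p : ℂ × ℝ × ℝ => Q.potX (p.1 * p.2.1)) := c2.comp c3
    have c6 : ContinuousAt (fun p : ℂ × ℝ × ℝ => p.2.2 / ‖p.1 ^ 2‖) ((Q.κ₀ : ℂ), 0, 0) := by
      refine ContinuousAt.div (by fun_prop) (by fun_prop) ?_
      simpa using hκ
    refine c4.norm.continuousAt.add (ContinuousAt.mul ?_ ((continuousAt_const.mul c6).pow 2))
    exact (continuous_const.mul (((continuous_fst.pow 2).norm.mul c5.norm).pow 3)).continuousAt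
  have hE0 : E ((Q.κ₀ : ℂ), 0, 0) = 0 := by simp [E]
  have hev : ∀ᶠ p in 𝓝 ((Q.κ₀ : ℂ), (0 : ℝ), (0 : ℝ)), E p < min (1 / 2) (η / 2) / s ∧
      ‖p.1 * (p.2.1 : ℂ)‖ < 1 ∧ p.1 ≠ 0 := by
    refine (hcont.eventually_lt continuousAt_const (by rw [hE0]; positivity)).and
      (Filter.Eventually.and ?_ ?_)
    · have : ContinuousAt (fun p : ℂ × ℝ × ℝ => ‖p.1 * (p.2.1 : ℂ)‖) ((Q.κ₀ : ℂ), 0, 0) := by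
        fun_prop
      exact this.eventually_lt continuousAt_const (by simp)
    · exact continuousAt_fst.eventually_ne hκ
  obtain ⟨ρ, hρ, Hρ⟩ := Metric.eventually_nhds_iff.1 hev
  refine ⟨ρ, hρ, fun κ ε a u f h1 h2 h3 ha hu hf hi => ?_⟩
  obtain ⟨g1, g2, g3⟩ := Hρ (y := (κ, ε, ‖u‖)) (by
    rw [Prod.dist_eq, Prod.dist_eq, max_lt_iff, max_lt_iff, dist_eq_norm, dist_eq_norm,
      dist_eq_norm, sub_zero, sub_zero, norm_norm]
    exact ⟨h1, h2, h3⟩)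
  simp only at g1 g2 g3
  -- A small state has a small source, because `norm_le` recovers the source from its potential.
  have hfn : ‖f‖ ≤ Q.c * (‖u‖ / ‖κ ^ 2‖) := by
    have : ‖u‖ / ‖κ ^ 2‖ = ‖Q.pot (κ * ε) f‖ := by
      have : ‖κ ^ 2‖ ≠ 0 := by simpa using g3
      rw [hu, norm_smul]; field_simp
    rw [this]
    exact Q.norm_le _ _ g2.le
  have key := Q.norm_source_sub_le hu hf hi (E := E (κ, ε, ‖u‖)) (by
    simp only [E]; gcongr)
  rw [← hs] at key
  have hsE : s * E (κ, ε, ‖u‖) < min (1 / 2) (η / 2) := by rwa [lt_div_iff₀' hs0] at g1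
  have ha' : ‖(a : ℂ)‖ = a := by rw [Complex.norm_real, Real.norm_of_nonneg ha.le]
  have hac : (a : ℂ) ≠ 0 := by exact_mod_cast ha.ne'
  -- With relative error at most 1/2 the term on the right is absorbed; this makes the final bound
  -- proportional to a, so that division by a is harmless.
  have hf2 : ‖f‖ ≤ 2 * a := by
    have t1 : ‖f‖ ≤ ‖f - (a : ℂ) • Q.φ‖ + ‖(a : ℂ) • Q.φ‖ := by
      simpa using norm_add_le (f - (a : ℂ) • Q.φ) ((a : ℂ) • Q.φ)
    rw [norm_smul, Q.norm_φ, ha', mul_one] at t1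
    have t2 : s * E (κ, ε, ‖u‖) * ‖f‖ ≤ 1 / 2 * ‖f‖ := by
      gcongr; exact hsE.le.trans (min_le_left _ _)
    linarith
  have hf0 : 0 < ‖f‖ := by
    rw [norm_pos_iff]
    rintro rfl
    rw [map_zero, smul_zero] at hu
    rw [hu] at hi; simp at hi; exact hac hi.symm
  have : (a : ℂ)⁻¹ • f - Q.φ = (a : ℂ)⁻¹ • (f - (a : ℂ) • Q.φ) := by
    rw [smul_sub, inv_smul_smul₀ hac]
  rw [this, norm_smul, norm_inv, ha', inv_mul_lt_iff₀ ha]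
  calc _ ≤ _ := key
    _ < (η / 2) * ‖f‖ := by gcongr; exact hsE.trans_le (min_le_right _ _)
    _ ≤ (η / 2) * (2 * a) := by gcongr
    _ = a * η := by ring

end CavityModel

end

/-! ### First-order expansion in ε and linear families -/

section

/-- Used for κ(0, ε): a quadratic error there becomes order τ^{-3/2} after multiplication by ε in ω
= κε. -/
theorem AnalyticAt.exists_norm_sub_taylor_le {f : ℝ → ℂ} {f' : ℂ} (hf : AnalyticAt ℝ f 0)
    (hd : HasDerivAt f f' 0) :
    ∃ C r : ℝ, 0 ≤ C ∧ 0 < r ∧ ∀ ε : ℝ, |ε| < r → ‖f ε - (f 0 + ε * f')‖ ≤ C * ε ^ 2 := by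
  obtain ⟨p, hp⟩ := hf
  have h := hp.isBigO_sub_partialSum_pow 2
  obtain ⟨C, hC, hb⟩ := h.exists_nonneg
  rw [isBigOWith_iff] at hb
  obtain ⟨r, hr, H⟩ := Metric.eventually_nhds_iff.1 hb
  refine ⟨C, r, hC, hr, fun ε hε => ?_⟩
  have h1 := H (y := ε) (by simpa using hε)
  have h2 : p.partialSum 2 ε = f 0 + ε * f' := by
    have e1 : (p 1 fun _ => (1 : ℝ)) = f' := by rw [← hp.deriv, hd.deriv]
    have e2 : (p 1 fun _ => ε) = ε • f' := by
      have := ContinuousMultilinearMap.map_smul_univ (p 1) (fun _ => ε) (fun _ => (1 : ℝ))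
      simpa [e1] using this
    have e0 : (p 0 fun _ => ε) = f 0 := hp.coeff_zero _
    rw [FormalMultilinearSeries.partialSum, Finset.sum_range_succ, Finset.sum_range_one, e0, e2,
      Complex.real_smul]
  rw [h2, zero_add] at h1
  simpa using h1

namespace CavityModel

variable {H X V : Type*} [NormedAddCommGroup H] [InnerProductSpace ℂ H] [CompleteSpace H]
  [NormedAddCommGroup X] [NormedSpace ℂ X] [CompleteSpace X]
  [NormedAddCommGroup V] [NormedSpace ℂ V] [CompleteSpace V]
  (Q : CavityModel H X V)

/-- For b = 0 the source equals the state, so ⟨φ, w⟩ = 1 and κ²⟨φ, K^{κε}w⟩ = 1 along the branch.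
Differentiating at ε = 0 gives 2κ₀k'λ + κ₀³m = 0; the derivative of w does not enter. -/
theorem hasDerivAt_branch {Φ : ℝ × ℝ → ℂ × H} (h0 : Φ 0 = Q.base) (hΦ : AnalyticAt ℝ Φ 0)
    (hr : ∀ᶠ ε in 𝓝 (0 : ℝ), Q.residual ((0, ε), Φ (0, ε)) = 0) :
    HasDerivAt (fun ε : ℝ => (Φ (0, ε)).1) (-(Q.κ₀ ^ 4 * Q.m / 2)) 0 := by
  have hΨ : HasDerivAt (fun ε : ℝ => Φ (0, ε)) (fderiv ℝ Φ 0 (0, 1)) 0 := by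
    have h1 : HasDerivAt (fun ε : ℝ => ((0 : ℝ), ε)) ((0 : ℝ), (1 : ℝ)) 0 :=
      (hasDerivAt_const _ _).prodMk (hasDerivAt_id _)
    exact HasFDerivAt.comp_hasDerivAt (x := (0 : ℝ)) hΦ.differentiableAt.hasFDerivAt h1
  set k' := (fderiv ℝ Φ 0 (0, 1)).1
  set w' := (fderiv ℝ Φ 0 (0, 1)).2
  have hk : HasDerivAt (fun ε : ℝ => (Φ (0, ε)).1) k' 0 :=
    HasFDerivAt.comp_hasDerivAt (x := (0 : ℝ)) (ContinuousLinearMap.fst ℝ ℂ H).hasFDerivAt hΨ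
  have hw : HasDerivAt (fun ε : ℝ => (Φ (0, ε)).2) w' 0 :=
    HasFDerivAt.comp_hasDerivAt (x := (0 : ℝ)) (ContinuousLinearMap.snd ℝ ℂ H).hasFDerivAt hΨ
  have hb : Φ (0, 0) = ((Q.κ₀ : ℂ), Q.φ) := h0
  have hres : ∀ᶠ ε in 𝓝 (0 : ℝ), inner ℂ Q.φ (Φ (0, ε)).2 = 1 ∧
      (Φ (0, ε)).1 ^ 2 * inner ℂ Q.φ (Q.ι (Q.pot ((Φ (0, ε)).1 * ε) (Φ (0, ε)).2)) = 1 := by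
    filter_upwards [hr] with ε hε
    obtain ⟨e1, e2⟩ := (Q.residual_eq_zero_iff 0 ε (Φ (0, ε)).1 (Φ (0, ε)).2).1 hε
    rw [Complex.ofReal_zero, zero_smul, add_zero] at e2
    refine ⟨by rwa [← e2] at e1, ?_⟩
    rwa [state_eq, map_smul, inner_smul_right] at e1
  have hw' : inner ℂ Q.φ w' = 0 := by
    have h1 : HasDerivAt (fun ε : ℝ => inner ℂ Q.φ (Φ (0, ε)).2) (inner ℂ Q.φ w') 0 :=
      HasFDerivAt.comp_hasDerivAt (x := (0 : ℝ))
        ((innerSL ℂ Q.φ).restrictScalars ℝ).hasFDerivAt hw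
    refine h1.unique ((hasDerivAt_const (0 : ℝ) (1 : ℂ)).congr_of_eventuallyEq ?_)
    filter_upwards [hres] with ε hε using hε.1
  let P : ℂ × H → ℂ := fun p => inner ℂ Q.φ (Q.ι (Q.pot p.1 p.2))
  have hPd : DifferentiableAt ℂ P (0, Q.φ) :=
    ((innerSL ℂ Q.φ).differentiable.comp (Q.ι.differentiable.comp
      (Q.contDiff_pot.differentiable (by simp)))).differentiableAt
  set P' := fderiv ℂ P (0, Q.φ)
  have hP1 : P' (1, 0) = Q.m := by
    have h1 : HasDerivAt (fun z : ℂ => (z, Q.φ)) ((1 : ℂ), (0 : H)) 0 :=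
      (hasDerivAt_id _).prodMk (hasDerivAt_const _ _)
    have h3 : HasFDerivAt P P' ((0 : ℂ), Q.φ) := hPd.hasFDerivAt
    have h2 : HasDerivAt (fun z : ℂ => P (z, Q.φ)) (P' (1, 0)) 0 :=
      HasFDerivAt.comp_hasDerivAt_of_eq (0 : ℂ) h3 h1 rfl
    exact h2.unique Q.deriv_pot
  -- By symmetry ⟨φ, K w'⟩ = λ⟨φ, w'⟩, and this vanishes because ⟨φ, w⟩ is constant.
  have hP2 : P' (0, w') = 0 := by
    have h1 := hPd.hasFDerivAt.comp Q.φ (hasFDerivAt_prodMk_right (𝕜 := ℂ) (0 : ℂ) Q.φ)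
    have h2 : HasFDerivAt (fun v => P (0, v)) (innerSL ℂ Q.φ ∘L Q.ι ∘L Q.pot 0) Q.φ :=
      (innerSL ℂ Q.φ ∘L Q.ι ∘L Q.pot 0).hasFDerivAt
    have h3 := congrArg (fun T => T w') (h1.unique h2)
    simpa [Q.inner_pot, hw'] using h3
  have hcurve : HasDerivAt (fun ε : ℝ => ((Φ (0, ε)).1 * (ε : ℂ), (Φ (0, ε)).2))
      ((Q.κ₀ : ℂ), w') 0 := by
    have h1 : HasDerivAt (fun ε : ℝ => (ε : ℂ)) 1 0 := Complex.ofRealCLM.hasDerivAt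
    have h2 := hk.mul h1
    rw [hb, Complex.ofReal_zero, mul_zero, zero_add, mul_one] at h2
    exact h2.prodMk hw
  have hG : HasDerivAt (fun ε : ℝ => P ((Φ (0, ε)).1 * ε, (Φ (0, ε)).2))
      (P' ((Q.κ₀ : ℂ), w')) 0 := by
    have h1 : HasFDerivAt P (P'.restrictScalars ℝ)
        ((Φ (0, (0 : ℝ))).1 * ((0 : ℝ) : ℂ), (Φ (0, (0 : ℝ))).2) := by
      rw [hb, Complex.ofReal_zero, mul_zero]; exact hPd.hasFDerivAt.restrictScalars ℝ
    exact HasFDerivAt.comp_hasDerivAt (x := (0 : ℝ)) h1 hcurve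
  have hPv : P' ((Q.κ₀ : ℂ), w') = Q.κ₀ * Q.m := by
    have : ((Q.κ₀ : ℂ), w') = (Q.κ₀ : ℂ) • ((1 : ℂ), (0 : H)) + (0, w') := by simp
    rw [this, map_add, map_smul, hP1, hP2, add_zero, smul_eq_mul]
  rw [hPv] at hG
  have hprod := (hk.pow 2).mul hG
  have hzero := hprod.unique ((hasDerivAt_const (0 : ℝ) (1 : ℂ)).congr_of_eventuallyEq (by
    filter_upwards [hres] with ε hε using hε.2))
  have hP0 : P (0, Q.φ) = Q.lam := by
    simp [P, Q.eigen, Q.norm_φ]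
  simp only [hb, Complex.ofReal_zero, mul_zero, hP0, Pi.pow_apply] at hzero
  have hsq := Q.κ₀_sq_mul
  convert hk using 1
  have hκ := Q.κ₀_ne_zero
  have h5 : 2 * k' * Q.lam + Q.κ₀ ^ 2 * Q.m = 0 := by
    refine mul_left_cancel₀ hκ ?_
    simp at hzero
    linear_combination hzero
  linear_combination (k') * hsq - Q.κ₀ ^ 2 / 2 * h5

/-- The abstract counterpart of `IsLinearResonanceFamily`. -/
def IsLinFamily (ωs : ℝ → ℂ) (φs : ℝ → V) : Prop :=
  (∀ᶠ τ in atTop, Q.IsLinRes τ (ωs τ) (φs τ) ∧ inner ℂ Q.φ (Q.ι (φs τ) - Q.φ) = 0) ∧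
  (fun τ => ωs τ - ((1 / Real.sqrt (Q.lam * τ) : ℝ) : ℂ)) =O[atTop] (fun τ : ℝ => τ⁻¹) ∧
  (fun τ => Q.ι (φs τ) - Q.φ) =O[atTop] (fun τ : ℝ => (Real.sqrt τ)⁻¹)

theorem inv_sqrt_lam_mul (τ : ℝ) :
    1 / Real.sqrt (Q.lam * τ) = Q.κ₀ * (Real.sqrt τ)⁻¹ := by
  rw [κ₀, Real.sqrt_mul Q.lam_pos.le, one_div, one_div, mul_inv]

theorem tendsto_inv_sqrt : Tendsto (fun τ : ℝ => (Real.sqrt τ)⁻¹) atTop (𝓝 0) :=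
  tendsto_inv_atTop_zero.comp Real.tendsto_sqrt_atTop

theorem mul_inv_sqrt_sq {τ : ℝ} (hτ : 0 < τ) : τ * (Real.sqrt τ)⁻¹ ^ 2 = 1 := by
  rw [inv_pow, Real.sq_sqrt hτ.le, mul_inv_cancel₀ hτ.ne']

theorem inv_sqrt_sq {τ : ℝ} (hτ : 0 < τ) : (Real.sqrt τ)⁻¹ ^ 2 = τ⁻¹ := by
  rw [inv_pow, Real.sq_sqrt hτ.le]

theorem exists_isLinFamily : ∃ (ωs : ℝ → ℂ) (φs : ℝ → V), Q.IsLinFamily ωs φs := by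
  obtain ⟨Φ, r, K, hr, hK, h0, hA, hU, hL⟩ := Q.exists_branch
  have hev : ∀ᶠ τ : ℝ in atTop, 0 < τ ∧ ‖((0 : ℝ), (Real.sqrt τ)⁻¹)‖ < r := by
    refine (eventually_gt_atTop 0).and ?_
    have h1 : Tendsto (fun τ : ℝ => ‖((0 : ℝ), (Real.sqrt τ)⁻¹)‖) atTop (𝓝 0) := by
      have := (tendsto_const_nhds (x := (0 : ℝ))).prodMk_nhds tendsto_inv_sqrt
      simpa using this.norm
    exact h1.eventually_lt_const hr
  have hlip : ∀ᶠ τ : ℝ in atTop, 0 < τ ∧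
      ‖(Φ (0, (Real.sqrt τ)⁻¹)).1 - Q.κ₀‖ ≤ K * (Real.sqrt τ)⁻¹ ∧
      ‖(Φ (0, (Real.sqrt τ)⁻¹)).2 - Q.φ‖ ≤ K * (Real.sqrt τ)⁻¹ := by
    filter_upwards [hev] with τ hτ
    have h1 := (hL _ 0 hτ.2 (by simpa using hr)).1
    have h2 : (0 : ℝ) ≤ (Real.sqrt τ)⁻¹ := by positivity
    have h4 : ‖((0 : ℝ), (Real.sqrt τ)⁻¹)‖ = (Real.sqrt τ)⁻¹ := by
      rw [Prod.norm_mk, norm_zero, Real.norm_of_nonneg h2, max_eq_right h2]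
    rw [h0, sub_zero, h4] at h1
    exact ⟨hτ.1, (norm_fst_le _).trans h1, (norm_snd_le _).trans h1⟩
  have hres : ∀ τ : ℝ, 0 < τ ∧ ‖((0 : ℝ), (Real.sqrt τ)⁻¹)‖ < r → _ := fun τ hτ =>
    Q.isLinRes_of_residual (mul_inv_sqrt_sq hτ.1) (hA _ hτ.2).2.2
  refine ⟨fun τ => (Φ (0, (Real.sqrt τ)⁻¹)).1 * ((Real.sqrt τ)⁻¹ : ℝ),
    fun τ => Q.state ((0, (Real.sqrt τ)⁻¹), Φ (0, (Real.sqrt τ)⁻¹)), ?_, ?_, ?_⟩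
  · filter_upwards [hev] with τ hτ
    obtain ⟨e1, e2, e3⟩ := hres τ hτ
    refine ⟨e1, ?_⟩
    rw [inner_sub_right, e2, Q.inner_φ_φ, sub_self]
  · refine IsBigO.of_bound K ?_
    filter_upwards [hlip] with τ hτ
    rw [Q.inv_sqrt_lam_mul, Complex.ofReal_mul, ← sub_mul, norm_mul, Complex.norm_real,
      Real.norm_of_nonneg (inv_nonneg.2 (Real.sqrt_nonneg τ)), norm_inv,
      Real.norm_of_nonneg hτ.1.le, ← inv_sqrt_sq hτ.1]
    calc _ ≤ K * (Real.sqrt τ)⁻¹ * (Real.sqrt τ)⁻¹ := by gcongr; exact hτ.2.1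
      _ = _ := by ring
  · refine IsBigO.of_bound K ?_
    filter_upwards [hlip, hev] with τ hτ hτ'
    rw [(hres τ hτ').2.2, norm_inv, Real.norm_of_nonneg (Real.sqrt_nonneg τ)]
    exact hτ.2.2

/-- A linear family is eventually the branch at `b = 0`. -/
theorem IsLinFamily.eventually_eq {ωs : ℝ → ℂ} {φs : ℝ → V} (hf : Q.IsLinFamily ωs φs)
    {Φ : ℝ × ℝ → ℂ × H} {r : ℝ} (hr : 0 < r)
    (hU : ∀ p y, ‖p‖ < r → ‖y - Q.base‖ < r → Q.residual (p, y) = 0 → y = Φ p) :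
    ∀ᶠ τ in atTop, ωs τ = (Φ (0, (Real.sqrt τ)⁻¹)).1 * ((Real.sqrt τ)⁻¹ : ℝ) ∧
      φs τ = Q.state ((0, (Real.sqrt τ)⁻¹), Φ (0, (Real.sqrt τ)⁻¹)) := by
  obtain ⟨h1, h2, h3⟩ := hf
  have t3 : Tendsto (fun τ => Q.ι (φs τ) - Q.φ) atTop (𝓝 0) := h3.trans_tendsto tendsto_inv_sqrt
  -- The assumed O(τ⁻¹) error, multiplied by √τ, becomes O(τ^{-1/2}); so the scaled pair (κ, w)
  -- enters the neighbourhood where the branch is the only solution.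
  have t2 : Tendsto (fun τ : ℝ => (Real.sqrt τ : ℂ) * ωs τ - Q.κ₀) atTop (𝓝 0) := by
    have e1 : (fun τ : ℝ => (Real.sqrt τ : ℂ) * ωs τ - Q.κ₀) =O[atTop]
        fun τ : ℝ => (Real.sqrt τ)⁻¹ := by
      have e0 : (fun τ : ℝ => (Real.sqrt τ : ℂ)) =O[atTop] fun τ : ℝ => Real.sqrt τ :=
        IsBigO.of_bound 1 (Eventually.of_forall fun τ => by rw [Complex.norm_real, one_mul])
      refine (e0.mul h2).congr' ?_ ?_
      · filter_upwards [eventually_gt_atTop 0] with τ hτ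
        have : (Real.sqrt τ : ℂ) ≠ 0 := by exact_mod_cast (Real.sqrt_pos.2 hτ).ne'
        rw [Q.inv_sqrt_lam_mul]
        push_cast
        field_simp
      · filter_upwards [eventually_gt_atTop 0] with τ hτ
        have hs := Real.sq_sqrt hτ.le
        have : Real.sqrt τ ≠ 0 := (Real.sqrt_pos.2 hτ).ne'
        rw [← inv_sqrt_sq hτ]
        field_simp
    exact e1.trans_tendsto tendsto_inv_sqrt
  have t1 : Tendsto (fun τ : ℝ => ‖((0 : ℝ), (Real.sqrt τ)⁻¹)‖) atTop (𝓝 0) := by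
    have := (tendsto_const_nhds (x := (0 : ℝ))).prodMk_nhds tendsto_inv_sqrt
    simpa using this.norm
  filter_upwards [h1, t1.eventually_lt_const hr,
    (by simpa using t2.norm : Tendsto (fun τ : ℝ => ‖(Real.sqrt τ : ℂ) * ωs τ - Q.κ₀‖) atTop
      (𝓝 0)).eventually_lt_const hr,
    (by simpa using t3.norm : Tendsto (fun τ : ℝ => ‖Q.ι (φs τ) - Q.φ‖) atTop
      (𝓝 0)).eventually_lt_const hr, eventually_gt_atTop 0] with τ a1 a2 a3 a4 hτ
  have hs : (Real.sqrt τ : ℂ) ≠ 0 := by exact_mod_cast (Real.sqrt_pos.2 hτ).ne'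
  have hω : ωs τ = ((Real.sqrt τ : ℂ) * ωs τ) * ((Real.sqrt τ)⁻¹ : ℝ) := by
    push_cast; field_simp
  have a1' := a1.1
  rw [hω] at a1'
  obtain ⟨b1, b2⟩ := Q.residual_of_linRes (mul_inv_sqrt_sq hτ) a1' a1.2
  have b3 := hU _ _ a2 (by
    rw [base, Prod.mk_sub_mk, Prod.norm_mk]; exact max_lt a3 a4) b1
  rw [← b3]
  exact ⟨hω, b2.symm⟩

end CavityModel

end

/-! ### The nonlinear family: existence, uniqueness, analyticity, asymptotics -/

section

namespace CavityModel

variable {H X V : Type*} [NormedAddCommGroup H] [InnerProductSpace ℂ H] [CompleteSpace H]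
  [NormedAddCommGroup X] [NormedSpace ℂ X] [CompleteSpace X]
  [NormedAddCommGroup V] [NormedSpace ℂ V] [CompleteSpace V]
  (Q : CavityModel H X V)

theorem source_smul {s ω ζ : ℂ} (hζ : ‖ζ‖ = 1) {u : V} {f : H} (hu : u = s • Q.pot ω f)
    (hf : f = Q.ι u + Q.cubic (s • Q.potX ω f)) :
    ζ • u = s • Q.pot ω (ζ • f) ∧
      ζ • f = Q.ι (ζ • u) + Q.cubic (s • Q.potX ω (ζ • f)) := by
  constructor
  · rw [map_smul, hu, smul_comm]
  · rw [(Q.potX ω).map_smul, smul_comm s ζ, cubic_smul, hζ, map_smul]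
    conv_lhs => rw [hf]
    simp

theorem analyticAt_params {q : ℝ × ℝ} (hq : 0 < q.2) :
    AnalyticAt ℝ (fun q : ℝ × ℝ => (q.1 ^ 2, (Real.sqrt q.2)⁻¹)) q := by
  have h1 : ContDiffAt ℝ ⊤ (fun q : ℝ × ℝ => Real.sqrt q.2) q :=
    (Real.contDiffAt_sqrt hq.ne').comp q contDiffAt_snd
  exact ((contDiffAt_fst.pow 2).prodMk (h1.inv (Real.sqrt_pos.2 hq).ne')).analyticAt

/-- The threshold is r² because τ⁻¹ = ε²; for a itself r² ≤ r suffices. -/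
theorem norm_params_lt {a τ r : ℝ} (hr : 0 < r) (hr1 : r ≤ 1)
    (h : (a, τ) ∈ paramRegion (r ^ 2)) : ‖(a ^ 2, (Real.sqrt τ)⁻¹)‖ < r ∧ a < r ∧
      (Real.sqrt τ)⁻¹ < r := by
  obtain ⟨ha, hτ, hs⟩ := h
  simp only at ha hτ hs
  have h1 : 0 < τ⁻¹ := inv_pos.2 hτ
  have h2 : r ^ 2 ≤ r := by nlinarith
  have h3 : a < r := by linarith
  have h4 : (Real.sqrt τ)⁻¹ < r := by
    refine lt_of_pow_lt_pow_left₀ 2 hr.le ?_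
    rw [inv_sqrt_sq hτ]; linarith
  refine ⟨?_, h3, h4⟩
  rw [Prod.norm_mk, max_lt_iff, Real.norm_of_nonneg (by positivity),
    Real.norm_of_nonneg (by positivity)]
  exact ⟨by nlinarith, h4⟩

set_option maxHeartbeats 1000000 in
theorem exists_nonlinear_family {ωs : ℝ → ℂ} {φs : ℝ → V} (hf : Q.IsLinFamily ωs φs) :
    ∃ δ > (0 : ℝ), ∃ (ω : ℝ × ℝ → ℂ) (u h : ℝ × ℝ → V),
      (∀ a τ : ℝ, (a, τ) ∈ paramRegion δ → Q.IsNonlinRes τ (ω (a, τ)) (u (a, τ)) ∧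
        Q.ι (u (a, τ)) = (a : ℂ) • Q.φ + Q.ι (h (a, τ)) ∧
        inner ℂ Q.φ (Q.ι (h (a, τ))) = 0) ∧
      (∃ ρ > (0 : ℝ), ∀ a τ : ℝ, (a, τ) ∈ paramRegion δ →
        (‖(Real.sqrt τ : ℂ) * ω (a, τ) - ((1 / Real.sqrt Q.lam : ℝ) : ℂ)‖ < ρ ∧
          ‖u (a, τ)‖ < ρ) ∧
        ∀ (ω' : ℂ) (u' : V), Q.IsNonlinRes τ ω' u' →
          ‖(Real.sqrt τ : ℂ) * ω' - ((1 / Real.sqrt Q.lam : ℝ) : ℂ)‖ < ρ →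
          ‖u'‖ < ρ → ‖inner ℂ Q.φ (Q.ι u')‖ = a →
          ω' = ω (a, τ) ∧ ∃ θ : ℝ, u' = Complex.exp (Complex.I * (θ : ℂ)) • u (a, τ)) ∧
      AnalyticOnNhd ℝ ω (paramRegion δ) ∧ AnalyticOnNhd ℝ u (paramRegion δ) ∧
      ∃ C : ℝ, ∀ a τ : ℝ, (a, τ) ∈ paramRegion δ →
        ‖ω (a, τ) - ωs τ‖ ≤ C * (a ^ 2 / Real.sqrt τ + a / τ) ∧
        ‖u (a, τ) - (a : ℂ) • φs τ‖ ≤ C * a ^ 2 ∧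
        ‖h (a, τ)‖ ≤ C * (a ^ 2 + 1 / τ) ∧
        ‖ω (a, τ) - (((1 / Real.sqrt (Q.lam * τ) : ℝ) : ℂ) - Q.κ₀ ^ 4 * Q.m / 2 / τ)‖ ≤
          C * (a ^ 2 / Real.sqrt τ + 1 / τ ^ (3 / 2 : ℝ)) := by
  obtain ⟨Φ, r, K, hr, hK, h0, hA, hU, hL⟩ := Q.exists_branch
  have hfst : AnalyticAt ℝ (fun ε : ℝ => (Φ (0, ε)).1) 0 := by
    have h1 : AnalyticAt ℝ (fun ε : ℝ => ((0 : ℝ), ε)) 0 := analyticAt_const.prod analyticAt_id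
    have h2 : AnalyticAt ℝ Φ ((0 : ℝ), (0 : ℝ)) := (hA 0 (by simpa using hr)).1
    exact analyticAt_fst.comp (h2.comp (f := fun ε : ℝ => ((0 : ℝ), ε)) h1)
  have hderiv := Q.hasDerivAt_branch h0 (hA 0 (by simpa using hr)).1 (by
    have : Tendsto (fun ε : ℝ => ‖((0 : ℝ), ε)‖) (𝓝 0) (𝓝 0) := by
      have h1 : Continuous (fun ε : ℝ => ‖((0 : ℝ), ε)‖) := by fun_prop
      simpa using h1.tendsto 0
    filter_upwards [this.eventually_lt_const hr] with ε hε using (hA _ hε).2.2)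
  obtain ⟨CT, rT, hCT, hrT, hTaylor⟩ := AnalyticAt.exists_norm_sub_taylor_le hfst hderiv
  have hb : Φ (0, 0) = ((Q.κ₀ : ℂ), Q.φ) := h0
  rw [hb] at hTaylor
  obtain ⟨T, hT⟩ := eventually_atTop.1 (hf.eventually_eq Q hr hU)
  obtain ⟨ρ₀, hρ₀, hnear⟩ := Q.exists_near r hr
  set ρ := min ρ₀ r with hρdef
  have hρ : 0 < ρ := lt_min hρ₀ hr
  set Ψ : ℝ × ℝ → V := fun p => Q.state (p, Φ p) with hΨ
  set B := ‖Ψ 0‖ + K with hB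
  have hB0 : 0 ≤ B := by positivity
  -- In order: convexity-type bounds a² ≤ a, the domain of Φ, the domain of the Taylor bound,
  -- closeness of κ to κ₀ within ρ, smallness of u, applicability of `exists_near`, and τ beyond the
  -- threshold T of the linear family.
  obtain ⟨s, hs0, hs1, hsr, hsT, hsK, hsB, hsρ, hsT'⟩ : ∃ s : ℝ, 0 < s ∧ s ≤ 1 ∧ s ≤ r ∧ s ≤ rT ∧
      s ≤ ρ / (K + 1) ∧ s ≤ ρ / (B + 1) ∧ s ≤ ρ ∧ s ≤ 1 / (|T| + 1) := by
    refine ⟨min 1 (min r (min rT (min (ρ / (K + 1)) (min (ρ / (B + 1)) (min ρ (1 / (|T| + 1))))))),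
      by positivity, ?_, ?_, ?_, ?_, ?_, ?_, ?_⟩ <;> simp
  let ω : ℝ × ℝ → ℂ := fun q => (Φ (q.1 ^ 2, (Real.sqrt q.2)⁻¹)).1 * ((Real.sqrt q.2)⁻¹ : ℝ)
  let u : ℝ × ℝ → V := fun q => (q.1 : ℂ) • Ψ (q.1 ^ 2, (Real.sqrt q.2)⁻¹)
  -- Ψ 0 = κ₀² K[φ] is φ regarded as an element of V, so h is the remainder u - aφ measured there.
  let h : ℝ × ℝ → V := fun q => u q - (q.1 : ℂ) • Ψ 0
  have hΨ0 : Q.ι (Ψ 0) = Q.φ := by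
    rw [hΨ]; simp only [h0]; exact Q.state_base
  have hlip : ∀ a τ : ℝ, (a, τ) ∈ paramRegion (s ^ 2) →
      ‖Φ (a ^ 2, (Real.sqrt τ)⁻¹) - Q.base‖ ≤ K * ‖(a ^ 2, (Real.sqrt τ)⁻¹)‖ ∧
      ‖Ψ (a ^ 2, (Real.sqrt τ)⁻¹) - Ψ 0‖ ≤ K * ‖(a ^ 2, (Real.sqrt τ)⁻¹)‖ := by
    intro a τ haτ
    have h1 := norm_params_lt hs0 hs1 haτ
    have h2 := hL _ 0 (h1.1.trans_le hsr) (by simpa using hr)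
    rw [sub_zero] at h2
    exact ⟨h0 ▸ h2.1, h2.2⟩
  have hlipb : ∀ a τ : ℝ, (a, τ) ∈ paramRegion (s ^ 2) →
      ‖(Φ (a ^ 2, (Real.sqrt τ)⁻¹)).1 - (Φ (0, (Real.sqrt τ)⁻¹)).1‖ ≤ K * a ^ 2 ∧
      ‖Ψ (a ^ 2, (Real.sqrt τ)⁻¹) - Ψ (0, (Real.sqrt τ)⁻¹)‖ ≤ K * a ^ 2 := by
    intro a τ haτ
    have h1 := norm_params_lt hs0 hs1 haτ
    have h3 : ‖((0 : ℝ), (Real.sqrt τ)⁻¹)‖ < r := by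
      refine lt_of_le_of_lt ?_ (h1.1.trans_le hsr)
      rw [Prod.norm_mk, Prod.norm_mk, norm_zero]
      exact max_le_max (norm_nonneg _) le_rfl
    have h2 := hL _ _ (h1.1.trans_le hsr) h3
    have h4 : ‖((a ^ 2, (Real.sqrt τ)⁻¹) : ℝ × ℝ) - (0, (Real.sqrt τ)⁻¹)‖ = a ^ 2 := by
      rw [Prod.mk_sub_mk, sub_zero, sub_self, Prod.norm_mk, norm_zero,
        max_eq_left (norm_nonneg _), Real.norm_of_nonneg (sq_nonneg a)]
    rw [h4] at h2
    exact ⟨(norm_fst_le (Φ (a ^ 2, (Real.sqrt τ)⁻¹) - Φ (0, (Real.sqrt τ)⁻¹))).trans h2.1, h2.2⟩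
  refine ⟨s ^ 2, by positivity, ω, u, h, ?_, ⟨ρ, hρ, ?_⟩, ?_, ?_, 2 * K + CT, ?_⟩
  · intro a τ haτ
    have h1 := norm_params_lt hs0 hs1 haτ
    have h2 := (hA _ (h1.1.trans_le hsr)).2.2
    have h3 : inner ℂ Q.φ (Q.ι (Ψ (a ^ 2, (Real.sqrt τ)⁻¹))) = 1 :=
      ((Q.residual_eq_zero_iff _ _ _ _).1 h2).1
    refine ⟨Q.isNonlinRes_of_residual (mul_inv_sqrt_sq haτ.2.1) haτ.1 h2, ?_, ?_⟩
    · simp [h, hΨ0]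
    · simp only [h, u, map_sub, map_smul, hΨ0, inner_sub_right, inner_smul_right, Q.inner_φ_φ,
        h3, sub_self]
  · intro a τ haτ
    have h1 := norm_params_lt hs0 hs1 haτ
    have hτ : 0 < τ := haτ.2.1
    have ha : 0 < a := haτ.1
    have hsq : (Real.sqrt τ : ℂ) ≠ 0 := by exact_mod_cast (Real.sqrt_pos.2 hτ).ne'
    have hcancel : ∀ z : ℂ, (Real.sqrt τ : ℂ) * (z * ((Real.sqrt τ)⁻¹ : ℝ)) = z := by
      intro z; push_cast; field_simp
    have hcancel' : ∀ z : ℂ, (Real.sqrt τ : ℂ) * z * ((Real.sqrt τ)⁻¹ : ℝ) = z := by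
      intro z; push_cast; field_simp
    refine ⟨⟨?_, ?_⟩, ?_⟩
    · simp only [ω]
      rw [hcancel]
      refine ((norm_fst_le (Φ (a ^ 2, (Real.sqrt τ)⁻¹) - Q.base)).trans (hlip a τ haτ).1).trans_lt
        ?_
      calc K * ‖(a ^ 2, (Real.sqrt τ)⁻¹)‖ ≤ K * (ρ / (K + 1)) := by
            gcongr; exact h1.1.le.trans hsK
        _ = ρ * (K / (K + 1)) := by ring
        _ < ρ * 1 := by gcongr; rw [div_lt_one (by positivity)]; linarith
        _ = ρ := mul_one ρ
    · simp only [u]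
      rw [norm_smul, Complex.norm_real, Real.norm_of_nonneg ha.le]
      have h2 : ‖Ψ (a ^ 2, (Real.sqrt τ)⁻¹)‖ ≤ B := by
        calc _ ≤ ‖Ψ 0‖ + ‖Ψ (a ^ 2, (Real.sqrt τ)⁻¹) - Ψ 0‖ := norm_le_norm_add_norm_sub' _ _
          _ ≤ ‖Ψ 0‖ + K * 1 := by
            gcongr
            exact (hlip a τ haτ).2.trans (by gcongr; exact h1.1.le.trans hs1)
          _ = B := by rw [mul_one]
      calc a * ‖Ψ (a ^ 2, (Real.sqrt τ)⁻¹)‖ ≤ (ρ / (B + 1)) * B := by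
            gcongr; exact h1.2.1.le.trans hsB
        _ = ρ * (B / (B + 1)) := by ring
        _ < ρ * 1 := by gcongr; rw [div_lt_one (by positivity)]; linarith
        _ = ρ := mul_one ρ
    · intro ω' u' hres hω' hu' hin
      obtain ⟨-, f, hu, hfe⟩ := hres
      set c := inner ℂ Q.φ (Q.ι u') with hc
      -- The phase of ⟨φ, u'⟩; after division by it the competitor satisfies the normalization with
      -- the real number a.
      set ζ := Complex.exp (Complex.I * (c.arg : ℂ)) with hζ
      have hζ1 : ‖ζ‖ = 1 := by rw [hζ, mul_comm]; exact Complex.norm_exp_ofReal_mul_I _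
      have hζ0 : ζ ≠ 0 := Complex.exp_ne_zero _
      have hca : c = a * ζ := by
        have := Complex.norm_mul_exp_arg_mul_I c
        rw [hin] at this
        rw [hζ, mul_comm Complex.I]; exact this.symm
      have hζi : ‖ζ⁻¹‖ = 1 := by rw [norm_inv, hζ1, inv_one]
      obtain ⟨k1, k2⟩ := Q.source_smul hζi hu hfe
      have k3 : inner ℂ Q.φ (Q.ι (ζ⁻¹ • u')) = a := by
        rw [map_smul, inner_smul_right, ← hc, hca]; field_simp
      rw [← hcancel' ω'] at k1 k2
      have k4 := Q.residual_of_nonlin (mul_inv_sqrt_sq hτ) ha k1 k2 k3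
      rw [contrast_eq (mul_inv_sqrt_sq hτ)] at k1 k2
      -- Smallness of u' in V alone puts the rescaled source near φ, so uniqueness along Φ applies.
      have k5 := hnear _ (Real.sqrt τ)⁻¹ a (ζ⁻¹ • u') (ζ⁻¹ • f)
        (hω'.trans_le (min_le_left _ _)) (by
          rw [abs_of_nonneg (by positivity)]
          exact (h1.2.2.trans_le hsρ).trans_le (min_le_left _ _))
        (by rw [norm_smul, hζi, one_mul]; exact hu'.trans_le (min_le_left _ _)) ha k1 k2 k3
      have k6 := hU _ _ (h1.1.trans_le hsr) (by
        rw [base, Prod.mk_sub_mk, Prod.norm_mk]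
        exact max_lt (hω'.trans_le (min_le_right _ _)) k5) k4.1
      have k7 : (Real.sqrt τ : ℂ) * ω' = (Φ (a ^ 2, (Real.sqrt τ)⁻¹)).1 := by rw [← k6]
      refine ⟨?_, c.arg, ?_⟩
      · simp only [ω]; rw [← k7, hcancel']
      · have k8 : ζ⁻¹ • u' = u (a, τ) := by
          rw [k4.2, k6]
        rw [← k8, ← hζ, smul_inv_smul₀ hζ0]
  · rintro ⟨a, τ⟩ haτ
    have h1 := norm_params_lt hs0 hs1 haτ
    have hp := analyticAt_params (q := (a, τ)) haτ.2.1
    have h2 : AnalyticAt ℝ (fun q : ℝ × ℝ => (Φ (q.1 ^ 2, (Real.sqrt q.2)⁻¹)).1) (a, τ) :=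
      analyticAt_fst.comp ((hA _ (h1.1.trans_le hsr)).1.comp
        (f := fun q : ℝ × ℝ => (q.1 ^ 2, (Real.sqrt q.2)⁻¹)) hp)
    have h3 : AnalyticAt ℝ (fun q : ℝ × ℝ => (((Real.sqrt q.2)⁻¹ : ℝ) : ℂ)) (a, τ) :=
      (Complex.ofRealCLM.analyticAt _).comp
        (f := fun q : ℝ × ℝ => (Real.sqrt q.2)⁻¹) (analyticAt_snd.comp hp)
    exact h2.mul h3
  · rintro ⟨a, τ⟩ haτ
    have h1 := norm_params_lt hs0 hs1 haτ
    have hp := analyticAt_params (q := (a, τ)) haτ.2.1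
    have h2 : AnalyticAt ℝ (fun q : ℝ × ℝ => Ψ (q.1 ^ 2, (Real.sqrt q.2)⁻¹)) (a, τ) :=
      AnalyticAt.comp (g := Ψ) (hA _ (h1.1.trans_le hsr)).2.1
        (f := fun q : ℝ × ℝ => (q.1 ^ 2, (Real.sqrt q.2)⁻¹)) hp
    have h3 : AnalyticAt ℝ (fun q : ℝ × ℝ => q.1 • Ψ (q.1 ^ 2, (Real.sqrt q.2)⁻¹)) (a, τ) :=
      analyticAt_fst.smul h2
    simpa only [u, Complex.coe_smul] using h3
  · intro a τ haτ
    have h1 := norm_params_lt hs0 hs1 haτ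
    have hτ : 0 < τ := haτ.2.1
    have ha : 0 < a := haτ.1
    have ha1 : a ≤ 1 := h1.2.1.le.trans hs1
    -- This makes the identification of the linear family with Φ(0, ε) valid on the whole parameter
    -- region.
    have hTτ : T ≤ τ := by
      have e1 : τ⁻¹ < 1 / (|T| + 1) := by
        have := haτ.2.2
        simp only at this
        have h2 : s ^ 2 ≤ s := by nlinarith
        linarith
      have e2 : |T| + 1 < τ := by
        rw [inv_eq_one_div] at e1
        exact (one_div_lt_one_div hτ (by positivity)).1 e1
      linarith [le_abs_self T]
    obtain ⟨hω, hφ⟩ := hT τ hTτ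
    obtain ⟨l1, l2⟩ := hlipb a τ haτ
    set e := (Real.sqrt τ)⁻¹ with he
    have he0 : 0 < e := inv_pos.2 (Real.sqrt_pos.2 hτ)
    have hes : e ^ 2 = τ⁻¹ := inv_sqrt_sq hτ
    have hea : |e| < rT := by rw [abs_of_pos he0]; exact h1.2.2.trans_le hsT
    have d1 : a ^ 2 / Real.sqrt τ = a ^ 2 * e := div_eq_mul_inv _ _
    have en : ‖((e : ℝ) : ℂ)‖ = e := by rw [Complex.norm_real, Real.norm_of_nonneg he0.le]
    have d2 : 1 / τ ^ (3 / 2 : ℝ) = e ^ 3 := by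
      rw [he, Real.sqrt_eq_rpow, ← Real.rpow_neg hτ.le, ← Real.rpow_natCast, ← Real.rpow_mul hτ.le,
        one_div, ← Real.rpow_neg hτ.le]
      norm_num
    refine ⟨?_, ?_, ?_, ?_⟩
    · rw [hω, d1]
      simp only [ω]
      rw [← sub_mul, norm_mul, en]
      calc _ ≤ K * a ^ 2 * e := by gcongr
        _ = K * (a ^ 2 * e + 0) := by ring
        _ ≤ _ := by
          gcongr
          · linarith
          · positivity
    · rw [hφ]
      simp only [u]
      rw [← smul_sub, norm_smul, Complex.norm_real, Real.norm_of_nonneg ha.le]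
      calc _ ≤ 1 * (K * a ^ 2) := by gcongr
        _ ≤ _ := by rw [one_mul]; gcongr; linarith
    · simp only [h, u]
      rw [← smul_sub, norm_smul, Complex.norm_real, Real.norm_of_nonneg ha.le, one_div, ← hes]
      have m1 : ‖(a ^ 2, e)‖ ≤ a ^ 2 + e := by
        rw [Prod.norm_mk, Real.norm_of_nonneg (by positivity), Real.norm_of_nonneg he0.le]
        exact max_le (by linarith) (by nlinarith)
      calc _ ≤ a * (K * (a ^ 2 + e)) := by
            gcongr; exact (hlip a τ haτ).2.trans (by gcongr)
        _ = K * (a * a ^ 2 + a * e) := by ring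
        -- The mixed term a e is dominated by a² + e², which turns the Lipschitz error in e =
        -- τ^{-1/2} into O(a² + 1/τ).
        _ ≤ K * (1 * a ^ 2 + (a ^ 2 + e ^ 2)) := by
            gcongr
            nlinarith [sq_nonneg (a - e)]
        _ ≤ 2 * K * (a ^ 2 + e ^ 2) := by nlinarith [mul_nonneg hK (sq_nonneg e)]
        _ ≤ _ := by gcongr; linarith
    · rw [Q.inv_sqrt_lam_mul, d1, d2, ← he]
      simp only [ω]
      -- The frequency is compared first with the linear branch at the same ε, then with the Taylor
      -- polynomial of that branch.
      have hsplit : (Φ (a ^ 2, e)).1 * (e : ℂ) -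
          (((Q.κ₀ * e : ℝ) : ℂ) - Q.κ₀ ^ 4 * Q.m / 2 / τ) =
          (((Φ (a ^ 2, e)).1 - (Φ (0, e)).1) +
            ((Φ (0, e)).1 - (Q.κ₀ + e * (-(Q.κ₀ ^ 4 * Q.m / 2))))) * (e : ℂ) := by
        have : (τ : ℂ)⁻¹ = (e : ℂ) ^ 2 := by exact_mod_cast hes.symm
        rw [div_eq_mul_inv _ (τ : ℂ), this]
        push_cast; ring
      rw [hsplit, norm_mul, en]
      calc _ ≤ (K * a ^ 2 + CT * e ^ 2) * e := by
            gcongr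
            exact (norm_add_le _ _).trans (add_le_add l1 (hTaylor e hea))
        _ = K * (a ^ 2 * e) + CT * e ^ 3 := by ring
        _ ≤ (2 * K + CT) * (a ^ 2 * e) + (2 * K + CT) * e ^ 3 := by
            gcongr <;> linarith
        _ = _ := by ring

end CavityModel

end

/-! ### Potentials with radial kernels as operators from L² to L^∞ -/

section

/-- The radial kernel `m(|z|) / (4π|z|)`. -/
noncomputable def kernel (m : ℝ →ᵇ ℂ) (z : R3) : ℂ := m ‖z‖ / (4 * Real.pi * ‖z‖)

theorem measurable_kernel (m : ℝ →ᵇ ℂ) : Measurable (kernel m) := by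
  unfold kernel
  have h1 : Measurable (fun z : R3 => m ‖z‖) := (m.continuous.comp continuous_norm).measurable
  fun_prop

theorem norm_kernel_le (m : ℝ →ᵇ ℂ) (z : R3) : ‖kernel m z‖ ≤ ‖m‖ / (4 * Real.pi) * ‖z‖⁻¹ := by
  have hpi := Real.pi_pos
  rw [kernel, norm_div, norm_mul, norm_mul, Complex.norm_real, Complex.norm_real, norm_norm,
    Real.norm_of_nonneg Real.pi_pos.le, Complex.norm_ofNat]
  calc _ ≤ ‖m‖ / (4 * Real.pi * ‖z‖) := by gcongr; exact m.norm_coe_le_norm _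
    _ = _ := by rw [← div_div, div_eq_mul_inv _ ‖z‖]

/-- In polar coordinates the Jacobian ρ² cancels the singularity ρ^{-2}; this is where dimension
three makes the kernel square integrable. -/
theorem integrableOn_inv_norm_sq (r : ℝ) :
    IntegrableOn (fun z : R3 => (‖z‖⁻¹) ^ 2) (Metric.ball 0 r) := by
  rw [integrableOn_fun_norm_addHaar volume (f := fun y : ℝ => (y⁻¹) ^ 2)]
  have : IntegrableOn (fun _ : ℝ => (1 : ℝ)) (Set.Ioo 0 r) := by simp
  refine this.congr_fun (fun y hy => ?_) measurableSet_Ioo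
  have := hy.1.ne'
  simp only [finrank_euclideanSpace, Fintype.card_fin, smul_eq_mul]
  norm_num
  field_simp

/-- A bound for `∫_D |x - y|^{-2} dy`, uniform in `x`. -/
noncomputable def kernelConst (D : Set R3) : ℝ :=
  (∫ z in Metric.ball (0 : R3) 1, (‖z‖⁻¹) ^ 2) + volume.real D

variable {D B : Set R3}

theorem kernelConst_nonneg : 0 ≤ kernelConst D := by
  unfold kernelConst
  have : 0 ≤ ∫ z in Metric.ball (0 : R3) 1, (‖z‖⁻¹) ^ 2 := integral_nonneg fun z => by positivity
  positivity

theorem inv_norm_sq_le (z : R3) :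
    (‖z‖⁻¹) ^ 2 ≤ (Metric.ball (0 : R3) 1).indicator (fun z => (‖z‖⁻¹) ^ 2) z + 1 := by
  by_cases hz : z ∈ Metric.ball (0 : R3) 1
  · rw [Set.indicator_of_mem hz]; linarith
  · rw [Set.indicator_of_notMem hz, zero_add]
    have h1 : 1 ≤ ‖z‖ := by simpa using hz
    exact pow_le_one₀ (by positivity) (inv_le_one_of_one_le₀ h1)

theorem integrable_indicator_sub (x : R3) : Integrable
    (fun y : R3 => (Metric.ball (0 : R3) 1).indicator (fun z => (‖z‖⁻¹) ^ 2) (x - y)) :=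
  ((integrableOn_inv_norm_sq 1).integrable_indicator measurableSet_ball).comp_sub_left x

theorem integrableOn_inv_norm_sub_sq [IsFiniteMeasure (volume.restrict D)] (x : R3) :
    Integrable (fun y : R3 => (‖x - y‖⁻¹) ^ 2) (volume.restrict D) := by
  refine ((integrable_indicator_sub x).restrict.add (integrable_const (1 : ℝ))).mono'
    (by fun_prop) (ae_of_all _ fun y => ?_)
  rw [Real.norm_of_nonneg (by positivity)]
  exact inv_norm_sq_le _

theorem setIntegral_inv_norm_sub_sq_le [IsFiniteMeasure (volume.restrict D)] (x : R3) :
    ∫ y in D, (‖x - y‖⁻¹) ^ 2 ≤ kernelConst D := by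
  calc ∫ y in D, (‖x - y‖⁻¹) ^ 2
      ≤ ∫ y in D, ((Metric.ball (0 : R3) 1).indicator (fun z => (‖z‖⁻¹) ^ 2) (x - y) + 1) :=
        integral_mono (integrableOn_inv_norm_sub_sq x)
          ((integrable_indicator_sub x).restrict.add (integrable_const (1 : ℝ)))
          fun y => inv_norm_sq_le _
    _ = (∫ y in D, (Metric.ball (0 : R3) 1).indicator (fun z => (‖z‖⁻¹) ^ 2) (x - y)) +
        volume.real D := by
        rw [integral_add (integrable_indicator_sub x).restrict (integrable_const _)]
        simp
    _ ≤ (∫ y, (Metric.ball (0 : R3) 1).indicator (fun z => (‖z‖⁻¹) ^ 2) (x - y)) +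
        volume.real D := by
        gcongr
        · exact Eventually.of_forall fun y => Set.indicator_nonneg (fun z _ => by positivity) _
        · exact integrable_indicator_sub x
        · exact Measure.restrict_le_self
    _ = kernelConst D := by
        rw [integral_sub_left_eq_self
          (fun z => (Metric.ball (0 : R3) 1).indicator (fun z => (‖z‖⁻¹) ^ 2) z) volume x,
          integral_indicator measurableSet_ball, kernelConst]

theorem norm_kernel_sq_le (m : ℝ →ᵇ ℂ) (z : R3) :
    ‖kernel m z‖ ^ 2 ≤ (‖m‖ / (4 * Real.pi)) ^ 2 * (‖z‖⁻¹) ^ 2 := by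
  rw [← mul_pow]
  exact pow_le_pow_left₀ (norm_nonneg _) (norm_kernel_le m z) 2

/-- The conjugate compensates for conjugate linearity of the inner product in its first slot: the
potential at x becomes a pairing with this vector. -/
theorem memLp_kernel [IsFiniteMeasure (volume.restrict D)] (m : ℝ →ᵇ ℂ) (x : R3) :
    MemLp (fun y => conj (kernel m (x - y))) 2 (volume.restrict D) := by
  have hm : Measurable (fun y => conj (kernel m (x - y))) :=
    Complex.continuous_conj.measurable.comp ((measurable_kernel m).comp (by fun_prop))
  rw [memLp_two_iff_integrable_sq_norm hm.aestronglyMeasurable]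
  refine ((integrableOn_inv_norm_sub_sq (D := D) x).const_mul ((‖m‖ / (4 * Real.pi)) ^ 2)).mono'
    (hm.norm.pow_const 2).aestronglyMeasurable (ae_of_all _ fun y => ?_)
  rw [Real.norm_of_nonneg (by positivity), RCLike.norm_conj]
  exact norm_kernel_sq_le m _

/-- The kernel as an element of `L²(D)`. -/
noncomputable def kernelVec (D : Set R3) [IsFiniteMeasure (volume.restrict D)] (m : ℝ →ᵇ ℂ)
    (x : R3) : L2 D :=
  (memLp_kernel m x).toLp _

/-- The potential with kernel `m(|z|) / (4π|z|)`. -/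
noncomputable def radialPotential (D : Set R3) (m : ℝ →ᵇ ℂ) (f : R3 → ℂ) (x : R3) : ℂ :=
  ∫ y in D, kernel m (x - y) * f y

section Potential

variable [IsFiniteMeasure (volume.restrict D)]

theorem inner_kernelVec (m : ℝ →ᵇ ℂ) (f : L2 D) (x : R3) :
    inner ℂ (kernelVec D m x) f = radialPotential D m f x := by
  rw [L2.inner_def, radialPotential]
  refine integral_congr_ae ?_
  filter_upwards [(memLp_kernel (D := D) m x).coeFn_toLp] with y hy
  rw [kernelVec, hy, RCLike.inner_apply, RingHomCompTriple.comp_apply, mul_comm]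
  simp

theorem norm_kernelVec_le (m : ℝ →ᵇ ℂ) (x : R3) :
    ‖kernelVec D m x‖ ≤ Real.sqrt (kernelConst D) / (4 * Real.pi) * ‖m‖ := by
  have h1 : ‖kernelVec D m x‖ ^ 2 = ∫ y in D, ‖kernel m (x - y)‖ ^ 2 := by
    have h2 : (inner ℂ (kernelVec D m x) (kernelVec D m x) : ℂ) =
        ((∫ y in D, ‖kernel m (x - y)‖ ^ 2 : ℝ) : ℂ) := by
      rw [L2.inner_def, ← integral_complex_ofReal]
      refine integral_congr_ae ?_
      filter_upwards [(memLp_kernel (D := D) m x).coeFn_toLp] with y hy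
      rw [kernelVec, hy, inner_self_eq_norm_sq_to_K, RCLike.norm_conj]
      simp
    rw [inner_self_eq_norm_sq_to_K] at h2
    exact Complex.ofReal_injective (by rw [← h2]; simp)
  have h3 : ‖kernelVec D m x‖ ^ 2 ≤ (Real.sqrt (kernelConst D) / (4 * Real.pi) * ‖m‖) ^ 2 := by
    rw [h1]
    calc _ ≤ ∫ y in D, (‖m‖ / (4 * Real.pi)) ^ 2 * (‖x - y‖⁻¹) ^ 2 := by
          refine integral_mono_of_nonneg (ae_of_all _ fun y => by positivity)
            ((integrableOn_inv_norm_sub_sq x).const_mul _) (ae_of_all _ fun y => ?_)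
          exact norm_kernel_sq_le m _
      _ ≤ (‖m‖ / (4 * Real.pi)) ^ 2 * kernelConst D := by
          rw [integral_const_mul]
          gcongr
          exact setIntegral_inv_norm_sub_sq_le x
      _ = _ := by
          rw [mul_pow, div_pow, div_pow, Real.sq_sqrt kernelConst_nonneg]; ring
  exact le_of_sq_le_sq h3 (by positivity)

/-- Cauchy–Schwarz with a kernel norm uniform in x. The bound is linear in ‖m‖ as well, so the
operator depends boundedly and linearly on the profile m. -/
theorem norm_radialPotential_le (m : ℝ →ᵇ ℂ) (f : L2 D) (x : R3) :
    ‖radialPotential D m f x‖ ≤ Real.sqrt (kernelConst D) / (4 * Real.pi) * ‖m‖ * ‖f‖ := by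
  rw [← inner_kernelVec]
  exact (norm_inner_le_norm _ _).trans (by gcongr; exact norm_kernelVec_le m x)

theorem integrable_kernel_mul (m : ℝ →ᵇ ℂ) (f : L2 D) (x : R3) :
    Integrable (fun y => kernel m (x - y) * f y) (volume.restrict D) := by
  refine (L2.integrable_inner (𝕜 := ℂ) (kernelVec D m x) f).congr ?_
  filter_upwards [(memLp_kernel (D := D) m x).coeFn_toLp] with y hy
  rw [kernelVec, hy, RCLike.inner_apply, mul_comm]
  simp

theorem stronglyMeasurable_radialPotential (m : ℝ →ᵇ ℂ) (f : L2 D) :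
    StronglyMeasurable (radialPotential D m f) := by
  refine StronglyMeasurable.integral_prod_right (f := fun x y => kernel m (x - y) * f y) ?_
  exact ((measurable_kernel m).comp (measurable_fst.sub measurable_snd)).stronglyMeasurable.mul
    ((Lp.stronglyMeasurable f).comp_measurable measurable_snd)

theorem radialPotential_congr {m : ℝ →ᵇ ℂ} {f g : R3 → ℂ} (h : f =ᵐ[volume.restrict D] g) (x : R3) :
    radialPotential D m f x = radialPotential D m g x :=
  integral_congr_ae (h.mono fun y hy => by simp only [hy])

theorem memLp_radialPotential (B : Set R3) (m : ℝ →ᵇ ℂ) (f : L2 D) :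
    MemLp (radialPotential D m f) ∞ (volume.restrict B) :=
  memLp_top_of_bound (stronglyMeasurable_radialPotential m f).aestronglyMeasurable _
    (ae_of_all _ fun x => norm_radialPotential_le m f x)

/-- The radial potentials as bounded operators from `L²(D)` to `L^∞(B)`. -/
noncomputable def radialOp (D B : Set R3) [IsFiniteMeasure (volume.restrict D)] :
    (ℝ →ᵇ ℂ) →L[ℂ] L2 D →L[ℂ] Lp ℂ ∞ (volume.restrict B) :=
  LinearMap.mkContinuous₂
    (LinearMap.mk₂ ℂ (fun m f => (memLp_radialPotential B m f).toLp _)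
      (by
        intro m n f
        rw [← MemLp.toLp_add]
        refine MemLp.toLp_congr _ _ (ae_of_all _ fun x => ?_)
        rw [Pi.add_apply, radialPotential, radialPotential, radialPotential,
          ← integral_add (integrable_kernel_mul m f x) (integrable_kernel_mul n f x)]
        refine integral_congr_ae (ae_of_all _ fun y => ?_)
        simp only [kernel, BoundedContinuousFunction.coe_add, Pi.add_apply]
        ring)
      (by
        intro c m f
        rw [← MemLp.toLp_const_smul]
        refine MemLp.toLp_congr _ _ (ae_of_all _ fun x => ?_)
        rw [Pi.smul_apply, radialPotential, radialPotential, smul_eq_mul, ← integral_const_mul]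
        refine integral_congr_ae (ae_of_all _ fun y => ?_)
        simp only [kernel, BoundedContinuousFunction.coe_smul, smul_eq_mul]
        ring)
      (by
        intro m f g
        rw [← MemLp.toLp_add]
        refine MemLp.toLp_congr _ _ (ae_of_all _ fun x => ?_)
        rw [Pi.add_apply, ← inner_kernelVec, ← inner_kernelVec, ← inner_kernelVec, inner_add_right])
      (by
        intro c m f
        rw [← MemLp.toLp_const_smul]
        refine MemLp.toLp_congr _ _ (ae_of_all _ fun x => ?_)
        rw [Pi.smul_apply, ← inner_kernelVec, ← inner_kernelVec, inner_smul_right, smul_eq_mul]))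
    (Real.sqrt (kernelConst D) / (4 * Real.pi))
    (by
      intro m f
      rw [LinearMap.mk₂_apply, Lp.norm_toLp, eLpNorm_exponent_top]
      refine ENNReal.toReal_le_of_le_ofReal (by positivity)
        (eLpNormEssSup_le_of_ae_bound (ae_of_all _ fun x => norm_radialPotential_le m f x)))

theorem coeFn_radialOp (B : Set R3) (m : ℝ →ᵇ ℂ) (f : L2 D) :
    radialOp D B m f =ᵐ[volume.restrict B] radialPotential D m f :=
  (memLp_radialPotential B m f).coeFn_toLp

end Potential

/-! ### Multiplication and conjugation on L^∞ -/

section Embedding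

variable {α : Type*} [MeasurableSpace α] (μ : Measure α) [IsFiniteMeasure μ]

/-- The embedding of `L^∞` into `L²`. -/
noncomputable def topToTwo : Lp ℂ ∞ μ →L[ℂ] Lp ℂ 2 μ :=
  ((ContinuousLinearMap.mul ℂ ℂ).holderL μ ∞ 2 2).flip ((memLp_const (1 : ℂ)).toLp _)

theorem coeFn_topToTwo (z : Lp ℂ ∞ μ) : topToTwo μ z =ᵐ[μ] z := by
  have h1 := (ContinuousLinearMap.mul ℂ ℂ).coeFn_holder (r := 2) z
    ((memLp_const (μ := μ) (p := 2) (1 : ℂ)).toLp _)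
  have h2 := (memLp_const (μ := μ) (p := 2) (1 : ℂ)).coeFn_toLp
  filter_upwards [h1, h2] with x hx hx2
  rw [show topToTwo μ z = (ContinuousLinearMap.mul ℂ ℂ).holder 2 z
    ((memLp_const (μ := μ) (p := 2) (1 : ℂ)).toLp _) from rfl, hx, hx2]
  simp

/-- Multiplication on `L^∞`. -/
noncomputable def topMul : Lp ℂ ∞ μ →L[ℂ] Lp ℂ ∞ μ →L[ℂ] Lp ℂ ∞ μ :=
  (ContinuousLinearMap.mul ℂ ℂ).holderL μ ∞ ∞ ∞

theorem coeFn_topMul (z w : Lp ℂ ∞ μ) : topMul μ z w =ᵐ[μ] fun x => z x * w x :=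
  (ContinuousLinearMap.mul ℂ ℂ).coeFn_holder z w

/-- Multiplication on `L^∞` followed by the embedding into `L²`. -/
noncomputable def topMulTwo : Lp ℂ ∞ μ →L[ℂ] Lp ℂ ∞ μ →L[ℂ] Lp ℂ 2 μ :=
  (ContinuousLinearMap.compL ℂ _ _ _ (topToTwo μ)) ∘L topMul μ

theorem coeFn_topMulTwo (z w : Lp ℂ ∞ μ) : topMulTwo μ z w =ᵐ[μ] fun x => z x * w x :=
  (coeFn_topToTwo μ _).trans (coeFn_topMul μ z w)

/-- Complex conjugation on `L^∞`. -/
noncomputable def topConj : Lp ℂ ∞ μ →ₗ⋆[ℂ] Lp ℂ ∞ μ where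
  toFun z := star z
  map_add' z w := by
    refine Lp.ext ?_
    filter_upwards [Lp.coeFn_star (z + w), Lp.coeFn_star z, Lp.coeFn_star w, Lp.coeFn_add z w,
      Lp.coeFn_add (star z) (star w)] with x h1 h2 h3 h4 h5
    simp only [h1, h5, Pi.add_apply, Pi.star_apply, h2, h3, h4, star_add]
  map_smul' c z := by
    refine Lp.ext ?_
    filter_upwards [Lp.coeFn_star (c • z), Lp.coeFn_star z, Lp.coeFn_smul c z,
      Lp.coeFn_smul (conj c) (star z)] with x h1 h2 h3 h4
    simp only [h1, h4, Pi.smul_apply, Pi.star_apply, h2, h3, star_smul, RCLike.star_def]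

theorem coeFn_topConj (z : Lp ℂ ∞ μ) : topConj μ z =ᵐ[μ] fun x => conj (z x) :=
  Lp.coeFn_star z

theorem norm_topConj (z : Lp ℂ ∞ μ) : ‖topConj μ z‖ = ‖z‖ := by
  rw [Lp.norm_def, Lp.norm_def]
  congr 1
  refine eLpNorm_congr_norm_ae ?_
  filter_upwards [coeFn_topConj μ z] with x hx
  rw [hx, RCLike.norm_conj]

end Embedding

end

/-! ### Compactness, symmetry and the Fredholm alternative -/

section

section Hilbert

variable {H : Type*} [NormedAddCommGroup H] [InnerProductSpace ℂ H] [CompleteSpace H]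

/-- Sequential Banach–Alaoglu for the dual of a separable space, transported by the Riesz
isomorphism; the conjugations come from its antilinearity. -/
theorem exists_weakly_convergent_subseq [TopologicalSpace.SeparableSpace H] {f : ℕ → H}
    (hf : ∀ n, ‖f n‖ ≤ 1) : ∃ (g : H) (θ : ℕ → ℕ), ‖g‖ ≤ 1 ∧ StrictMono θ ∧
      ∀ v, Tendsto (fun n => inner ℂ v (f (θ n))) atTop (𝓝 (inner ℂ v g)) := by
  have hc := WeakDual.isSeqCompact_closedBall ℂ H 0 1
  have hmem : ∀ n, StrongDual.toWeakDual (InnerProductSpace.toDual ℂ H (f n)) ∈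
      (WeakDual.toStrongDual ⁻¹' Metric.closedBall (0 : StrongDual ℂ H) 1) := by
    intro n
    simpa using hf n
  obtain ⟨l, hl, θ, hθ, hlim⟩ := hc hmem
  refine ⟨(InnerProductSpace.toDual ℂ H).symm (WeakDual.toStrongDual l), θ, ?_, hθ, fun v => ?_⟩
  · simpa using hl
  · have h1 := (WeakDual.eval_continuous v).tendsto l |>.comp hlim
    have h2 := (Complex.continuous_conj.tendsto _).comp h1
    have e1 : ∀ n, inner ℂ v (f (θ n)) =
        conj ((StrongDual.toWeakDual (InnerProductSpace.toDual ℂ H (f (θ n)))) v) := by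
      intro n
      rw [← inner_conj_symm]; rfl
    have e2 : inner ℂ v ((InnerProductSpace.toDual ℂ H).symm (WeakDual.toStrongDual l)) =
        conj (l v) := by
      rw [← inner_conj_symm, InnerProductSpace.toDual_symm_apply]; rfl
    rw [e2]
    simp only [e1]
    exact h2

/-- A bounded operator mapping weakly convergent sequences to convergent ones is compact. -/
theorem isCompactOperator_of_weak [TopologicalSpace.SeparableSpace H]
    {G : Type*} [NormedAddCommGroup G] [NormedSpace ℂ G] (T : H →L[ℂ] G)
    (hT : ∀ (f : ℕ → H) (g : H), (∀ n, ‖f n‖ ≤ 1) → ‖g‖ ≤ 1 →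
      (∀ v, Tendsto (fun n => inner ℂ v (f n)) atTop (𝓝 (inner ℂ v g))) →
      Tendsto (fun n => T (f n)) atTop (𝓝 (T g))) : IsCompactOperator T := by
  have : IsCompactOperator (T : H →ₗ[ℂ] G) := by
    rw [isCompactOperator_iff_image_closedBall_subset_compact (T : H →ₗ[ℂ] G) zero_lt_one]
    refine ⟨T '' Metric.closedBall 0 1, IsSeqCompact.isCompact ?_, subset_rfl⟩
    intro y hy
    choose f hf hfy using hy
    obtain ⟨g, θ, hg, hθ, hlim⟩ := exists_weakly_convergent_subseq (f := f)
      (fun n => by simpa using hf n)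
    refine ⟨T g, ⟨g, by simpa using hg, rfl⟩, θ, hθ, ?_⟩
    have h1 := hT (fun n => f (θ n)) g (fun n => by simpa using hf (θ n)) hg hlim
    refine h1.congr fun n => ?_
    exact hfy (θ n)
  exact this

/-- K minus the projection onto φ is compact, so λ ≠ 0 is an eigenvalue of it or in its resolvent
set. An eigenvector f would have ⟨φ, f⟩ = 0 by `hin`, hence be an eigenvector of K, hence a multiple
of φ orthogonal to φ. -/
theorem exists_shifted_equiv {K : H →L[ℂ] H} (hK : IsCompactOperator K) {lam : ℂ} (hlam : lam ≠ 0)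
    {φ : H} (hφ : ‖φ‖ = 1) (hin : ∀ f, inner ℂ φ (K f) = lam * inner ℂ φ f)
    (hs : ∀ f, K f = lam • f → ∃ c : ℂ, f = c • φ) :
    ∃ S : H ≃L[ℂ] H, ∀ f, S f = lam • f - K f + inner ℂ φ f • φ := by
  have hφφ : inner ℂ φ φ = (1 : ℂ) := by rw [inner_self_eq_norm_sq_to_K, hφ]; simp
  set P : H →L[ℂ] H := (innerSL ℂ φ).smulRight φ with hP
  have hPc : IsCompactOperator P := by
    have h1 : IsCompactOperator (((1 : ℂ →L[ℂ] ℂ).smulRight φ) ∘L (innerSL ℂ φ)) :=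
      (isCompactOperator_of_locallyCompactSpace_dom (innerSL ℂ φ)).clm_comp
        ((1 : ℂ →L[ℂ] ℂ).smulRight φ)
    have h2 : P = ((1 : ℂ →L[ℂ] ℂ).smulRight φ) ∘L (innerSL ℂ φ) := by
      ext f
      simp [hP]
    rw [h2]
    exact h1
  rcases (hK.sub hPc).hasEigenvalue_or_mem_resolventSet (T := K - P) hlam with h | h
  · exfalso
    obtain ⟨f, hf, hf0⟩ := h.exists_hasEigenvector
    rw [Module.End.mem_eigenspace_iff] at hf
    have h1 : K f - inner ℂ φ f • φ = lam • f := by simpa [hP] using hf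
    have h2 := congrArg (inner ℂ φ) h1
    rw [inner_sub_right, hin, inner_smul_right, inner_smul_right, hφφ] at h2
    have h3 : inner ℂ φ f = 0 := by linear_combination -h2
    rw [h3, zero_smul, sub_zero] at h1
    obtain ⟨c, rfl⟩ := hs f h1
    rw [inner_smul_right, hφφ, mul_one] at h3
    exact hf0 (by rw [h3, zero_smul])
  · rw [spectrum.mem_resolventSet_iff] at h
    refine ⟨ContinuousLinearEquiv.unitsEquiv ℂ H h.unit, fun f => ?_⟩
    rw [ContinuousLinearEquiv.unitsEquiv_apply, IsUnit.unit_spec]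
    simp [hP, Algebra.algebraMap_eq_smul_one]
    abel

end Hilbert

variable {D B : Set R3} [IsFiniteMeasure (volume.restrict D)]

/-- The potential operator on `L²(D)`. -/
noncomputable def radialOpTwo (D B : Set R3) [IsFiniteMeasure (volume.restrict D)]
    [IsFiniteMeasure (volume.restrict B)] (m : ℝ →ᵇ ℂ) : L2 D →L[ℂ] L2 B :=
  topToTwo (volume.restrict B) ∘L radialOp D B m

theorem coeFn_radialOpTwo [IsFiniteMeasure (volume.restrict B)] (m : ℝ →ᵇ ℂ) (f : L2 D) :
    radialOpTwo D B m f =ᵐ[volume.restrict B] radialPotential D m f :=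
  (coeFn_topToTwo _ _).trans (coeFn_radialOp B m f)

theorem L2.norm_sq_eq (f : L2 D) : ‖f‖ ^ 2 = ∫ x in D, ‖f x‖ ^ 2 := by
  have h2 : (inner ℂ f f : ℂ) = ((∫ x in D, ‖f x‖ ^ 2 : ℝ) : ℂ) := by
    rw [L2.inner_def, ← integral_complex_ofReal]
    refine integral_congr_ae (ae_of_all _ fun y => ?_)
    simp only [inner_self_eq_norm_sq_to_K]
    simp
  rw [inner_self_eq_norm_sq_to_K] at h2
  exact Complex.ofReal_injective (by rw [← h2]; simp)

theorem isCompactOperator_radialOpTwo (m : ℝ →ᵇ ℂ) : IsCompactOperator (radialOpTwo D D m) := by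
  have : Fact ((2 : ℝ≥0∞) ≠ ∞) := ⟨by simp⟩
  refine isCompactOperator_of_weak _ fun f g hf hg hlim => ?_
  rw [tendsto_iff_norm_sub_tendsto_zero]
  have key : Tendsto (fun n => ‖radialOpTwo D D m (f n) - radialOpTwo D D m g‖ ^ 2) atTop
      (𝓝 0) := by
    have e1 : ∀ n, ‖radialOpTwo D D m (f n) - radialOpTwo D D m g‖ ^ 2 =
        ∫ x in D, ‖radialPotential D m (f n - g : L2 D) x‖ ^ 2 := by
      intro n
      rw [← map_sub, L2.norm_sq_eq]
      refine integral_congr_ae ?_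
      filter_upwards [coeFn_radialOpTwo (B := D) m (f n - g)] with x hx
      rw [hx]
    simp only [e1]
    have h0 : (0 : ℝ) = ∫ x in D, (0 : ℝ) := by simp
    rw [h0]
    refine tendsto_integral_of_dominated_convergence
      (fun _ => (Real.sqrt (kernelConst D) / (4 * Real.pi) * ‖m‖ * 2) ^ 2) (fun n => ?_)
      (integrable_const _) (fun n => ae_of_all _ fun x => ?_) (ae_of_all _ fun x => ?_)
    · exact ((stronglyMeasurable_radialPotential m _).norm.pow 2).aestronglyMeasurable
    · rw [Real.norm_of_nonneg (by positivity)]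
      have h2 : ‖f n - g‖ ≤ 2 := (norm_sub_le _ _).trans (by linarith [hf n])
      gcongr
      exact (norm_radialPotential_le m _ x).trans (by gcongr)
    -- The value of the potential at a point is a continuous functional, so weak convergence gives
    -- pointwise convergence; the uniform bound provides domination.
    · have h1 : Tendsto (fun n => inner ℂ (kernelVec D m x) (f n - g)) atTop (𝓝 0) := by
        have := (hlim (kernelVec D m x)).sub_const (inner ℂ (kernelVec D m x) g)
        simpa only [inner_sub_right, sub_self] using this
      simp only [inner_kernelVec] at h1
      simpa using (h1.norm.pow 2)
  have h3 := (Real.continuous_sqrt.tendsto _).comp key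
  simpa [Function.comp_def, Real.sqrt_sq (norm_nonneg _)] using h3

/-- The inner integral of |kernel||g| is bounded uniformly in x by st ≤ s² + t², so integrability of
f suffices for the outer one. -/
theorem integrable_prod_kernel_of_integrable (m : ℝ →ᵇ ℂ) {f g : R3 → ℂ} (hf : StronglyMeasurable f)
    (hg : StronglyMeasurable g) (hf1 : Integrable (fun x => ‖f x‖) (volume.restrict D))
    (hg2 : Integrable (fun y => ‖g y‖ ^ 2) (volume.restrict D))
    (hi : ∀ x, Integrable (fun y => kernel m (x - y) * g y) (volume.restrict D)) :
    Integrable (fun p : R3 × R3 => conj (f p.1) * (kernel m (p.1 - p.2) * g p.2))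
      ((volume.restrict D).prod (volume.restrict D)) := by
  have hmeas : StronglyMeasurable
      (fun p : R3 × R3 => conj (f p.1) * (kernel m (p.1 - p.2) * g p.2)) := by
    refine StronglyMeasurable.mul ?_ (StronglyMeasurable.mul ?_ ?_)
    · exact Complex.continuous_conj.comp_stronglyMeasurable
        (hf.comp_measurable measurable_fst)
    · exact ((measurable_kernel m).comp (measurable_fst.sub measurable_snd)).stronglyMeasurable
    · exact hg.comp_measurable measurable_snd
  rw [integrable_prod_iff hmeas.aestronglyMeasurable]
  refine ⟨ae_of_all _ fun x => (hi x).const_mul (conj (f x)), ?_⟩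
  refine (hf1.mul_const ((‖m‖ / (4 * Real.pi)) ^ 2 * kernelConst D + ∫ y in D, ‖g y‖ ^ 2)).mono'
    hmeas.norm.integral_prod_right'.aestronglyMeasurable (ae_of_all _ fun x => ?_)
  rw [Real.norm_of_nonneg (integral_nonneg fun y => norm_nonneg _)]
  simp only [norm_mul, RCLike.norm_conj]
  rw [integral_const_mul]
  gcongr
  have hk : Integrable (fun y => (‖m‖ / (4 * Real.pi)) ^ 2 * (‖x - y‖⁻¹) ^ 2)
      (volume.restrict D) := (integrableOn_inv_norm_sub_sq x).const_mul _
  calc ∫ y in D, ‖kernel m (x - y)‖ * ‖g y‖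
      ≤ ∫ y in D, ((‖m‖ / (4 * Real.pi)) ^ 2 * (‖x - y‖⁻¹) ^ 2 + ‖g y‖ ^ 2) := by
        refine integral_mono_of_nonneg (ae_of_all _ fun y => by positivity) (hk.add hg2)
          (ae_of_all _ fun y => ?_)
        have h1 := norm_kernel_sq_le m (x - y)
        simp only
        nlinarith [sq_nonneg (‖kernel m (x - y)‖ - ‖g y‖), sq_nonneg ‖kernel m (x - y)‖,
          sq_nonneg ‖g y‖]
    _ = (∫ y in D, (‖m‖ / (4 * Real.pi)) ^ 2 * (‖x - y‖⁻¹) ^ 2) + ∫ y in D, ‖g y‖ ^ 2 :=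
        integral_add hk hg2
    _ ≤ _ := by
        rw [integral_const_mul]
        gcongr
        exact setIntegral_inv_norm_sub_sq_le x

theorem integrable_prod_kernel (m : ℝ →ᵇ ℂ) (f g : L2 D) :
    Integrable (fun p : R3 × R3 => conj (f p.1) * (kernel m (p.1 - p.2) * g p.2))
      ((volume.restrict D).prod (volume.restrict D)) :=
  integrable_prod_kernel_of_integrable m (Lp.stronglyMeasurable f) (Lp.stronglyMeasurable g)
    ((Lp.memLp f).integrable one_le_two).norm
    ((memLp_two_iff_integrable_sq_norm (Lp.aestronglyMeasurable g)).1 (Lp.memLp g))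
    (integrable_kernel_mul m g)

/-- The kernel is real and even in x - y, so the two iterated integrals agree by Fubini. -/
theorem inner_radialOpTwo_symm (m : ℝ →ᵇ ℂ) (hm : ∀ r, conj (m r) = m r) (f g : L2 D) :
    inner ℂ f (radialOpTwo D D m g) = inner ℂ (radialOpTwo D D m f) g := by
  rw [L2.inner_def, L2.inner_def]
  have e1 : ∫ x in D, inner ℂ (f x) (radialOpTwo D D m g x) =
      ∫ x in D, ∫ y in D, conj (f x) * (kernel m (x - y) * g y) := by
    refine integral_congr_ae ?_
    filter_upwards [coeFn_radialOpTwo (B := D) m g] with x hx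
    rw [hx, RCLike.inner_apply, radialPotential, integral_const_mul, mul_comm]
  have e2 : ∫ y in D, inner ℂ (radialOpTwo D D m f y) (g y) =
      ∫ y in D, ∫ x in D, conj (f x) * (kernel m (x - y) * g y) := by
    refine integral_congr_ae ?_
    filter_upwards [coeFn_radialOpTwo (B := D) m f] with y hy
    rw [hy, RCLike.inner_apply, radialPotential, ← integral_conj, ← integral_const_mul]
    refine integral_congr_ae (ae_of_all _ fun x => ?_)
    have : conj (kernel m (y - x)) = kernel m (x - y) := by
      rw [kernel, kernel, map_div₀, hm, norm_sub_rev]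
      simp [Complex.conj_ofNat]
    simp only [map_mul, this]
    ring
  rw [e1, e2]
  exact integral_integral_swap (integrable_prod_kernel m f g)

end

/-! ### Holomorphic dependence of the kernel on the frequency -/

/-- The function `r ↦ i r`, truncated outside `[0, L]`. -/
noncomputable def truncLength (L : ℝ) : ℝ →ᵇ ℂ :=
  BoundedContinuousFunction.ofNormedAddCommGroup
    (fun r => Complex.I * ((max 0 (min r L) : ℝ) : ℂ)) (by fun_prop) |L| (by
      intro r
      rw [norm_mul, Complex.norm_I, one_mul, Complex.norm_real,
        Real.norm_of_nonneg (le_max_left _ _)]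
      exact max_le (abs_nonneg _) ((min_le_right _ _).trans (le_abs_self _)))

theorem truncLength_apply (L r : ℝ) :
    truncLength L r = Complex.I * ((max 0 (min r L) : ℝ) : ℂ) := rfl

theorem truncLength_of_mem {L r : ℝ} (h0 : 0 ≤ r) (h1 : r ≤ L) :
    truncLength L r = Complex.I * r := by
  rw [truncLength_apply, min_eq_left h1, max_eq_right h0]

/-- The function `r ↦ exp(i ω r)`, truncated outside `[0, L]`. -/
noncomputable def truncExp (L : ℝ) (ω : ℂ) : ℝ →ᵇ ℂ := NormedSpace.exp (ω • truncLength L)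

/-- The derivative is taken in the sup norm, as that of an exponential in a Banach algebra. Composed
with the bounded linear map from profiles to operators it gives holomorphy in operator norm. -/
theorem hasDerivAt_truncExp (L : ℝ) (ω : ℂ) :
    HasDerivAt (truncExp L) (truncExp L ω * truncLength L) ω :=
  hasDerivAt_exp_smul_const (truncLength L) ω

/-- Evaluation at a point as a ring homomorphism. -/
noncomputable def evalHom (r : ℝ) : (ℝ →ᵇ ℂ) →+* ℂ where
  toFun m := m r
  map_one' := rfl
  map_mul' _ _ := rfl
  map_zero' := rfl
  map_add' _ _ := rfl

theorem truncExp_apply (L : ℝ) (ω : ℂ) (r : ℝ) :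
    truncExp L ω r = Complex.exp (ω * truncLength L r) := by
  have h := NormedSpace.map_exp_of_mem_ball (𝕂 := ℂ) (evalHom r)
    (BoundedContinuousFunction.evalCLM ℂ r).continuous (ω • truncLength L)
    ((NormedSpace.expSeries_radius_eq_top ℂ (ℝ →ᵇ ℂ)).symm ▸ edist_lt_top _ _)
  rw [Complex.exp_eq_exp_ℂ]
  exact h

theorem truncExp_zero (L : ℝ) : truncExp L 0 = 1 := by
  ext r
  rw [truncExp_apply]
  simp

theorem kernel_truncExp {L : ℝ} (ω : ℂ) {z : R3} (hz : ‖z‖ ≤ L) :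
    kernel (truncExp L ω) z = green ω z := by
  rw [kernel, green, truncExp_apply, truncLength_of_mem (norm_nonneg _) hz]
  congr 2
  ring

theorem kernel_one (z : R3) : kernel 1 z = 1 / (4 * Real.pi * ‖z‖) := by
  simp [kernel]

theorem radialPotential_one (D : Set R3) (f : R3 → ℂ) :
    radialPotential D 1 f = newtonianPotential D f := by
  funext x
  simp only [radialPotential, newtonianPotential, kernel_one]

/-- The frequency derivative of the Green's function at ω = 0 is constant in space; at z = 0 the
quotient takes the default value 0, hence the exclusion. -/
theorem kernel_truncLength {L : ℝ} {z : R3} (hz : ‖z‖ ≤ L) (h0 : z ≠ 0) :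
    kernel (truncLength L) z = Complex.I / (4 * Real.pi) := by
  rw [kernel, truncLength_of_mem (norm_nonneg _) hz]
  have : (‖z‖ : ℂ) ≠ 0 := by simpa using h0
  field_simp

theorem radialPotential_truncExp {D : Set R3} {L : ℝ} (ω : ℂ) {x : R3} (hD : MeasurableSet D)
    (hL : ∀ y ∈ D, ‖x - y‖ ≤ L) (f : R3 → ℂ) :
    radialPotential D (truncExp L ω) f x = volumePotential D ω f x :=
  setIntegral_congr_fun hD fun y hy => by simp only [kernel_truncExp ω (hL y hy)]

theorem radialPotential_truncLength {D : Set R3} {L : ℝ} {x : R3} (hD : MeasurableSet D)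
    (hL : ∀ y ∈ D, ‖x - y‖ ≤ L) (f : R3 → ℂ) :
    radialPotential D (truncLength L) f x = Complex.I / (4 * Real.pi) * ∫ y in D, f y := by
  rw [radialPotential, ← integral_const_mul]
  refine integral_congr_ae ?_
  have h1 : ∀ᵐ y ∂(volume.restrict D), y ≠ x := by
    rw [ae_iff]
    simp only [ne_eq, not_not, Set.ofPred_eq_eq_singleton]
    exact measure_singleton x
  filter_upwards [h1, ae_restrict_mem hD] with y hy hyD
  rw [kernel_truncLength (hL y hyD) (sub_ne_zero.2 hy.symm)]

/-! ### Partial derivatives and integration by parts -/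

section Calculus

variable {F G W : Type*} [NormedAddCommGroup F] [NormedSpace ℝ F] [NormedAddCommGroup G]
  [NormedSpace ℝ G] [NormedAddCommGroup W] [NormedSpace ℝ W]

/-- The `i`-th partial derivative. -/
noncomputable def pd (i : Fin 3) (v : R3 → F) (x : R3) : F :=
  fderiv ℝ v x (EuclideanSpace.single i 1)

/-- The Laplacian. -/
noncomputable def lap (v : R3 → F) (x : R3) : F := ∑ i, pd i (pd i v) x

/-- Smooth functions on `ℝ³`. -/
abbrev Smooth (v : R3 → F) : Prop := ContDiff ℝ (⊤ : ℕ∞) v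

theorem Smooth.pd {v : R3 → F} (h : Smooth v) (i : Fin 3) : Smooth (pd i v) :=
  (h.fderiv_right (m := (⊤ : ℕ∞)) (by simp)).clm_apply contDiff_const

theorem Smooth.lap {v : R3 → F} (h : Smooth v) : Smooth (lap v) := by
  unfold NonlinearResonance.lap
  exact ContDiff.sum fun i _ => (h.pd i).pd i

theorem Smooth.diffAt {v : R3 → F} (h : Smooth v) (x : R3) : DifferentiableAt ℝ v x :=
  (h.differentiable (by simp)) x

theorem hasCompactSupport_pd {v : R3 → F} (h : HasCompactSupport v) (i : Fin 3) :
    HasCompactSupport (pd i v) :=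
  h.fderiv_apply ℝ _

theorem tsupport_pd_subset (v : R3 → F) (i : Fin 3) : tsupport (pd i v) ⊆ tsupport v :=
  tsupport_fderiv_apply_subset ℝ _

theorem pd_add {v w : R3 → F} (hv : Smooth v) (hw : Smooth w) (i : Fin 3) :
    pd i (fun x => v x + w x) = fun x => pd i v x + pd i w x := by
  funext x
  simp only [pd]
  rw [fderiv_fun_add (hv.diffAt x) (hw.diffAt x)]
  rfl

theorem pd_smul {χ : R3 → ℝ} {v : R3 → F} (hχ : Smooth χ) (hv : Smooth v) (i : Fin 3) :
    pd i (fun x => χ x • v x) = fun x => χ x • pd i v x + pd i χ x • v x := by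
  funext x
  simp only [pd]
  rw [fderiv_fun_smul (hχ.diffAt x) (hv.diffAt x)]
  simp

theorem pd_const_smul {𝕜 : Type*} [NormedField 𝕜] [NormedAlgebra ℝ 𝕜] [NormedSpace 𝕜 F]
    [IsScalarTower ℝ 𝕜 F] [SMulCommClass ℝ 𝕜 F] (c : 𝕜) (v : R3 → F) (hv : Smooth v) (i : Fin 3) :
    pd i (fun x => c • v x) = fun x => c • pd i v x := by
  funext x
  simp only [pd]
  rw [fderiv_fun_const_smul (hv.diffAt x)]
  rfl

theorem pd_comm {v : R3 → F} (hv : Smooth v) (i j : Fin 3) : pd i (pd j v) = pd j (pd i v) := by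
  funext x
  have hs : IsSymmSndFDerivAt ℝ v x := hv.contDiffAt.isSymmSndFDerivAt (by
    simp only [minSmoothness_of_isRCLikeNormedField]; exact WithTop.coe_le_coe.2 le_top)
  have hd : DifferentiableAt ℝ (fderiv ℝ v) x :=
    ((hv.fderiv_right (m := (⊤ : ℕ∞)) (by simp)).differentiable (by simp)) x
  have e : ∀ k l, pd k (pd l v) x =
      fderiv ℝ (fderiv ℝ v) x (EuclideanSpace.single k 1) (EuclideanSpace.single l 1) := by
    intro k l
    change fderiv ℝ (fun y => fderiv ℝ v y (EuclideanSpace.single l 1)) x _ = _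
    rw [fderiv_clm_apply hd (differentiableAt_const _)]
    simp
  rw [e, e, hs]

theorem pd_eq_of_eventuallyEq {v w : R3 → F} {x : R3} (h : v =ᶠ[𝓝 x] w) (i : Fin 3) :
    pd i v =ᶠ[𝓝 x] pd i w :=
  (h.fderiv (𝕜 := ℝ)).mono fun y hy => by simp only [pd, hy]

theorem integrable_bilin (b : F →L[ℝ] G →L[ℝ] W) {p : R3 → F} {q : R3 → G} (hp : Continuous p)
    (hq : Continuous q) (hc : HasCompactSupport p ∨ HasCompactSupport q) :
    Integrable fun x => b (p x) (q x) := by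
  refine Continuous.integrable_of_hasCompactSupport (by fun_prop) ?_
  rcases hc with hc | hc
  · exact hc.mono fun x hx h0 => hx (by simp [h0])
  · exact hc.mono fun x hx h0 => hx (by simp [h0])

theorem integral_bilin_pd (b : F →L[ℝ] G →L[ℝ] W) {p : R3 → F} {q : R3 → G} (hp : Smooth p)
    (hq : Smooth q) (hc : HasCompactSupport p ∨ HasCompactSupport q) (i : Fin 3) :
    ∫ x, b (p x) (pd i q x) = - ∫ x, b (pd i p x) (q x) := by
  refine integral_bilinear_fderiv_right_eq_neg_left_of_integrable (μ := volume)
    (integrable_bilin b (hp.pd i).continuous hq.continuous ?_)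
    (integrable_bilin b hp.continuous (hq.pd i).continuous ?_)
    (integrable_bilin b hp.continuous hq.continuous hc)
    (fun x _ => hp.diffAt x) (fun x _ => hq.diffAt x)
  · exact hc.imp (fun h => hasCompactSupport_pd h i) id
  · exact hc.imp id (fun h => hasCompactSupport_pd h i)

end Calculus

theorem integral_inner_pd {p q : R3 → ℂ} (hp : Smooth p) (hq : Smooth q)
    (hc : HasCompactSupport p ∨ HasCompactSupport q) (i : Fin 3) :
    ∫ x, (inner ℝ (p x) (pd i q x) : ℝ) = - ∫ x, (inner ℝ (pd i p x) (q x) : ℝ) :=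
  integral_bilin_pd (innerSL ℝ) hp hq hc i

theorem integrable_inner_cont {p q : R3 → ℂ} (hp : Continuous p) (hq : Continuous q)
    (hc : HasCompactSupport p ∨ HasCompactSupport q) :
    Integrable fun x => (inner ℝ (p x) (q x) : ℝ) :=
  integrable_bilin (innerSL ℝ) hp hq hc

theorem integrable_normSq {p : R3 → ℂ} (hp : Continuous p) (hc : HasCompactSupport p) :
    Integrable fun x => ‖p x‖ ^ 2 := by
  simpa only [real_inner_self_eq_norm_sq] using integrable_inner_cont hp hp (Or.inl hc)

/-! ### Interior elliptic estimates -/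

/-- Localized energy identity. -/
theorem sum_integral_normSq_pd_smul {χ : R3 → ℝ} {v : R3 → ℂ} (hχ : Smooth χ) (hv : Smooth v)
    (hc : HasCompactSupport χ) :
    ∑ i, ∫ x, ‖pd i (fun x => χ x • v x) x‖ ^ 2 =
      (∫ x, (∑ i, pd i χ x ^ 2) * ‖v x‖ ^ 2) - ∫ x, χ x ^ 2 * (inner ℝ (v x) (lap v x) : ℝ) := by
  have hχ2 : Smooth fun x => χ x ^ 2 := hχ.pow 2
  have hc2 : HasCompactSupport fun x => χ x ^ 2 • v x :=
    hc.mono fun x hx h0 => hx (by simp [h0])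
  have hs2 : Smooth fun x => χ x ^ 2 • v x := hχ2.smul hv
  have hI1 : ∀ i, Integrable fun x => pd i χ x ^ 2 * ‖v x‖ ^ 2 := fun i =>
    (((hχ.pd i).continuous.pow 2).mul (hv.continuous.norm.pow 2)).integrable_of_hasCompactSupport
      ((hasCompactSupport_pd hc i).mono fun x hx h0 => hx (by simp [h0]))
  have hI2 : ∀ i, Integrable fun x => χ x ^ 2 * (inner ℝ (v x) (pd i (pd i v) x) : ℝ) := fun i => by
    have := integrable_inner_cont hs2.continuous ((hv.pd i).pd i).continuous (Or.inl hc2)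
    simpa only [real_inner_smul_left] using this
  have key : ∀ i, ∫ x, ‖pd i (fun x => χ x • v x) x‖ ^ 2 =
      (∫ x, pd i χ x ^ 2 * ‖v x‖ ^ 2) - ∫ x, χ x ^ 2 * (inner ℝ (v x) (pd i (pd i v) x) : ℝ) := by
    intro i
    have h1 := integral_inner_pd hs2 (hv.pd i) (Or.inl hc2) i
    -- Completing the square moves the cutoff to one side: |∂(χv)|² differs from ⟨∂(χ²v), ∂v⟩ only
    -- by (∂χ)²|v|², with no derivative of v left in the error.
    have e1 : ∀ x, ‖pd i (fun x => χ x • v x) x‖ ^ 2 =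
        pd i χ x ^ 2 * ‖v x‖ ^ 2 + (inner ℝ (pd i (fun x => χ x ^ 2 • v x) x) (pd i v x) : ℝ) := by
      intro x
      have h3 : pd i (fun x => χ x ^ 2) x = 2 * χ x * pd i χ x := by
        simp only [pd]
        rw [fderiv_fun_pow _ (hχ.diffAt x)]
        simp
      rw [pd_smul hχ hv, pd_smul hχ2 hv]
      simp only [h3, norm_add_sq_real,
        real_inner_smul_left, real_inner_smul_right, inner_add_left,
        norm_smul, mul_pow, Real.norm_eq_abs, sq_abs, real_inner_self_eq_norm_sq,
        real_inner_comm (pd i v x) (v x)]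
      ring
    simp only [e1]
    rw [integral_add (hI1 i) (integrable_inner_cont (hs2.pd i).continuous (hv.pd i).continuous
      (Or.inl (hasCompactSupport_pd hc2 i)))]
    simp only [real_inner_smul_left] at h1
    linarith
  simp only [key, Finset.sum_sub_distrib]
  rw [← integral_finsetSum _ fun i _ => hI1 i, ← integral_finsetSum _ fun i _ => hI2 i]
  simp only [Finset.sum_mul, lap, inner_sum, Finset.mul_sum]

/-- Two integrations by parts exchange the mixed derivative for pure ones; compact support leaves no
boundary terms. -/
theorem integral_normSq_lap {w : R3 → ℂ} (hw : Smooth w) (hc : HasCompactSupport w) :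
    ∑ i, ∑ j, ∫ x, ‖pd j (pd i w) x‖ ^ 2 = ∫ x, ‖lap w x‖ ^ 2 := by
  have hci := fun i => hasCompactSupport_pd hc i
  have hcij := fun i j => hasCompactSupport_pd (hci i) j
  have key : ∀ i j, ∫ x, ‖pd j (pd i w) x‖ ^ 2 =
      ∫ x, (inner ℝ (pd i (pd i w) x) (pd j (pd j w) x) : ℝ) := by
    intro i j
    have h1 := integral_inner_pd (hw.pd i) ((hw.pd i).pd j) (Or.inl (hci i)) j
    have h2 := integral_inner_pd (hw.pd i) ((hw.pd j).pd j) (Or.inl (hci i)) i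
    have h3 : pd j (pd j (pd i w)) = pd i (pd j (pd j w)) := by
      rw [pd_comm hw j i, pd_comm (hw.pd j) j i]
    rw [h3] at h1
    simp only [real_inner_self_eq_norm_sq] at h1
    linarith
  simp only [key]
  have hI : ∀ i j, Integrable fun x => (inner ℝ (pd i (pd i w) x) (pd j (pd j w) x) : ℝ) :=
    fun i j =>
    integrable_inner_cont ((hw.pd i).pd i).continuous ((hw.pd j).pd j).continuous
      (Or.inl (hcij i i))
  simp only [← real_inner_self_eq_norm_sq, lap, sum_inner, inner_sum]
  rw [Finset.sum_comm, integral_finsetSum _ fun j _ => integrable_finsetSum _ fun i _ => hI i j]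
  exact Finset.sum_congr rfl fun j _ => (integral_finsetSum _ fun i _ => hI i j).symm

theorem lap_smul {χ : R3 → ℝ} {v : R3 → ℂ} (hχ : Smooth χ) (hv : Smooth v) (x : R3) :
    lap (fun x => χ x • v x) x =
      χ x • lap v x + (2 * ∑ i, pd i χ x • pd i v x) + lap χ x • v x := by
  simp only [lap]
  have : ∀ i, pd i (pd i fun x => χ x • v x) x =
      χ x • pd i (pd i v) x + 2 * (pd i χ x • pd i v x) + pd i (pd i χ) x • v x := by
    intro i
    rw [pd_smul hχ hv, pd_add (v := fun x => χ x • pd i v x) (w := fun x => pd i χ x • v x)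
      (hχ.smul (hv.pd i)) ((hχ.pd i).smul hv), pd_smul hχ (hv.pd i),
      pd_smul (hχ.pd i) hv]
    ring
  simp only [this, Finset.sum_add_distrib, Finset.smul_sum, Finset.sum_smul, Finset.mul_sum]

theorem exists_cutoff {r : ℝ} (hr : 0 < r) : ∃ χ : R3 → ℝ, Smooth χ ∧ HasCompactSupport χ ∧
    (∀ x ∈ Metric.ball (0 : R3) r, χ x = 1) ∧ tsupport χ ⊆ Metric.closedBall 0 (r + 1) ∧
    ∀ x, ‖χ x‖ ≤ 1 := by
  let χ : ContDiffBump (0 : R3) := ⟨r, r + 1, hr, by linarith⟩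
  refine ⟨χ, χ.contDiff, χ.hasCompactSupport, fun x hx => χ.one_of_mem_closedBall
    (Metric.ball_subset_closedBall hx), χ.tsupport_eq.subset, fun x => ?_⟩
  rw [Real.norm_of_nonneg χ.nonneg]
  exact χ.le_one

theorem Continuous.integrableOn_ball3 {p : R3 → ℝ} (hp : Continuous p) (r : ℝ) :
    IntegrableOn p (Metric.ball 0 r) :=
  (hp.continuousOn.integrableOn_compact (isCompact_closedBall 0 r)).mono_set
    Metric.ball_subset_closedBall

theorem setIntegral_normSq_mono {p : R3 → ℂ} (hp : Continuous p) {r s : ℝ} (h : r ≤ s) :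
    ∫ x in Metric.ball 0 r, ‖p x‖ ^ 2 ≤ ∫ x in Metric.ball 0 s, ‖p x‖ ^ 2 :=
  setIntegral_mono_set (Continuous.integrableOn_ball3 (hp.norm.pow 2) s)
    (ae_of_all _ fun _ => by positivity) (Metric.ball_subset_ball h).eventuallyLE

theorem pd_eq_zero_of_notMem {F : Type*} [NormedAddCommGroup F] [NormedSpace ℝ F] {χ : R3 → F}
    {x : R3} (hx : x ∉ tsupport χ) (i : Fin 3) : pd i χ x = 0 :=
  image_eq_zero_of_notMem_tsupport fun h => hx (tsupport_pd_subset χ i h)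

theorem lap_eq_zero_of_notMem {F : Type*} [NormedAddCommGroup F] [NormedSpace ℝ F] {χ : R3 → F}
    {x : R3} (hx : x ∉ tsupport χ) : lap χ x = 0 :=
  Finset.sum_eq_zero fun i _ => pd_eq_zero_of_notMem (fun h => hx (tsupport_pd_subset χ i h)) i

/-- Caccioppoli's inequality: the localized energy identity with a cutoff equal to 1 on the smaller
ball. -/
theorem gradient_estimate {r : ℝ} (hr : 0 < r) : ∃ C : ℝ, 0 ≤ C ∧ ∀ v : R3 → ℂ, Smooth v →
    ∑ i, ∫ x in Metric.ball 0 r, ‖pd i v x‖ ^ 2 ≤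
      C * ((∫ x in Metric.ball 0 (r + 2), ‖v x‖ ^ 2) +
        ∫ x in Metric.ball 0 (r + 2), ‖lap v x‖ ^ 2) := by
  obtain ⟨χ, hχ, hc, h1, hsupp, hle⟩ := exists_cutoff hr
  have hb : ∃ C, ∀ x, ‖∑ i, pd i χ x ^ 2‖ ≤ C := by
    refine HasCompactSupport.exists_bound_of_continuous ?_ ?_
    · exact hc.mono' fun x hx => by
        by_contra h
        exact hx (Finset.sum_eq_zero fun i _ => by simp [pd_eq_zero_of_notMem h i])
    · exact continuous_finsetSum _ fun i _ => (hχ.pd i).continuous.pow 2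
  obtain ⟨C, hC⟩ := hb
  have hC0 : 0 ≤ C := (norm_nonneg _).trans (hC 0)
  have hout : ∀ x ∉ Metric.ball (0 : R3) (r + 2), x ∉ tsupport χ := fun x hx h =>
    hx (Metric.closedBall_subset_ball (by linarith) (hsupp h))
  refine ⟨C + 1, by linarith, fun v hv => ?_⟩
  have hcv : HasCompactSupport fun x => χ x • v x := hc.smul_right
  have hsv : Smooth fun x => χ x • v x := hχ.smul hv
  calc ∑ i, ∫ x in Metric.ball 0 r, ‖pd i v x‖ ^ 2
      ≤ ∑ i, ∫ x, ‖pd i (fun x => χ x • v x) x‖ ^ 2 := by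
        refine Finset.sum_le_sum fun i _ => ?_
        have e : ∫ x in Metric.ball 0 r, ‖pd i v x‖ ^ 2 =
            ∫ x in Metric.ball 0 r, ‖pd i (fun x => χ x • v x) x‖ ^ 2 := by
          refine setIntegral_congr_fun measurableSet_ball fun x hx => ?_
          have : (fun x => χ x • v x) =ᶠ[𝓝 x] v := by
            filter_upwards [Metric.isOpen_ball.mem_nhds hx] with y hy
            rw [h1 y hy, one_smul]
          simp only [(pd_eq_of_eventuallyEq this i).eq_of_nhds]
        rw [e]
        exact setIntegral_le_integral (integrable_normSq (hsv.pd i).continuous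
          (hasCompactSupport_pd hcv i)) (ae_of_all _ fun x => by positivity)
    _ = (∫ x, (∑ i, pd i χ x ^ 2) * ‖v x‖ ^ 2) - ∫ x, χ x ^ 2 * inner ℝ (v x) (lap v x) :=
        sum_integral_normSq_pd_smul hχ hv hc
    _ = (∫ x in Metric.ball 0 (r + 2), (∑ i, pd i χ x ^ 2) * ‖v x‖ ^ 2) -
        ∫ x in Metric.ball 0 (r + 2), χ x ^ 2 * inner ℝ (v x) (lap v x) := by
        rw [setIntegral_eq_integral_of_forall_compl_eq_zero,
          setIntegral_eq_integral_of_forall_compl_eq_zero]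
        · intro x hx
          rw [image_eq_zero_of_notMem_tsupport (hout x hx)]
          ring
        · intro x hx
          simp [pd_eq_zero_of_notMem (hout x hx)]
    _ = ∫ x in Metric.ball 0 (r + 2), ((∑ i, pd i χ x ^ 2) * ‖v x‖ ^ 2 -
        χ x ^ 2 * inner ℝ (v x) (lap v x)) := by
        refine (integral_sub ?_ ?_).symm
        · exact Continuous.integrableOn_ball3 ((continuous_finsetSum _ fun i _ =>
            (hχ.pd i).continuous.pow 2).mul (hv.continuous.norm.pow 2)) _
        · exact Continuous.integrableOn_ball3 ((hχ.continuous.pow 2).mul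
            (hv.continuous.inner hv.lap.continuous)) _
    _ ≤ ∫ x in Metric.ball 0 (r + 2), ((C + 1) * ‖v x‖ ^ 2 + (C + 1) * ‖lap v x‖ ^ 2) := by
        refine setIntegral_mono_on ?_ ?_ measurableSet_ball fun x _ => ?_
        · exact Continuous.integrableOn_ball3 (((continuous_finsetSum _ fun i _ =>
            (hχ.pd i).continuous.pow 2).mul (hv.continuous.norm.pow 2)).sub
            ((hχ.continuous.pow 2).mul (hv.continuous.inner hv.lap.continuous))) _
        · exact Continuous.integrableOn_ball3 ((continuous_const.mul
            (hv.continuous.norm.pow 2)).add (continuous_const.mul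
            (hv.lap.continuous.norm.pow 2))) _
        · have a1 : (∑ i, pd i χ x ^ 2) * ‖v x‖ ^ 2 ≤ C * ‖v x‖ ^ 2 := by
            gcongr
            exact (le_abs_self _).trans (hC x)
          have a2 : χ x ^ 2 ≤ 1 := by
            have := hle x
            rw [Real.norm_eq_abs] at this
            exact (sq_le_one_iff_abs_le_one _).2 this
          have a3 := abs_real_inner_le_norm (v x) (lap v x)
          have a4 : -(χ x ^ 2 * inner ℝ (v x) (lap v x)) ≤ ‖v x‖ * ‖lap v x‖ := by
            calc _ ≤ |χ x ^ 2 * inner ℝ (v x) (lap v x)| := neg_le_abs _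
              _ = χ x ^ 2 * |inner ℝ (v x) (lap v x)| := by
                rw [abs_mul, abs_of_nonneg (sq_nonneg (χ x))]
              _ ≤ 1 * (‖v x‖ * ‖lap v x‖) := by gcongr
              _ = _ := one_mul _
          nlinarith [sq_nonneg (‖v x‖ - ‖lap v x‖), sq_nonneg ‖v x‖, sq_nonneg ‖lap v x‖,
            mul_nonneg hC0 (sq_nonneg ‖lap v x‖)]
    _ = _ := by
        rw [integral_add, integral_const_mul, integral_const_mul, mul_add]
        · exact Continuous.integrableOn_ball3 (continuous_const.mul (hv.continuous.norm.pow 2)) _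
        · exact Continuous.integrableOn_ball3
            (continuous_const.mul (hv.lap.continuous.norm.pow 2)) _

theorem hessian_estimate {r : ℝ} (hr : 0 < r) : ∃ C : ℝ, 0 ≤ C ∧ ∀ v : R3 → ℂ, Smooth v →
    ∑ i, ∑ j, ∫ x in Metric.ball 0 r, ‖pd j (pd i v) x‖ ^ 2 ≤
      C * ((∫ x in Metric.ball 0 (r + 2), ‖v x‖ ^ 2) +
        (∫ x in Metric.ball 0 (r + 2), ‖lap v x‖ ^ 2) +
        ∑ i, ∫ x in Metric.ball 0 (r + 2), ‖pd i v x‖ ^ 2) := by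
  obtain ⟨χ, hχ, hc, h1, hsupp, hle⟩ := exists_cutoff hr
  obtain ⟨C, hC⟩ : ∃ C, ∀ i x, ‖pd i χ x‖ ≤ C := by
    have : ∀ i, ∃ C, ∀ x, ‖pd i χ x‖ ≤ C := fun i =>
      (hasCompactSupport_pd hc i).exists_bound_of_continuous (hχ.pd i).continuous
    choose C hC using this
    exact ⟨∑ i, ‖C i‖, fun i x => (hC i x).trans ((le_abs_self _).trans
      (Finset.single_le_sum (f := fun i => ‖C i‖) (fun _ _ => norm_nonneg _) (Finset.mem_univ i)))⟩
  obtain ⟨C', hC'⟩ : ∃ C, ∀ x, ‖lap χ x‖ ≤ C :=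
    (hc.mono' fun x hx => by
      by_contra h
      exact hx (lap_eq_zero_of_notMem h)).exists_bound_of_continuous hχ.lap.continuous
  have hC0 : 0 ≤ C := (norm_nonneg _).trans (hC 0 0)
  have hC0' : 0 ≤ C' := (norm_nonneg _).trans (hC' 0)
  have hout : ∀ x ∉ Metric.ball (0 : R3) (r + 2), x ∉ tsupport χ := fun x hx h =>
    hx (Metric.closedBall_subset_ball (by linarith) (hsupp h))
  -- The 3 comes from squaring a sum of three terms in the Leibniz rule for Δ(χv), and 36 = 3 · 2² ·
  -- 3, where the last factor bounds the square of the sum of three partial derivatives.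
  set M : ℝ := 3 + 36 * C ^ 2 + 3 * C' ^ 2 with hM
  have hM0 : 0 ≤ M := by positivity
  refine ⟨M, hM0, fun v hv => ?_⟩
  have hcv : HasCompactSupport fun x => χ x • v x := hc.smul_right
  have hsv : Smooth fun x => χ x • v x := hχ.smul hv
  have hcont : Continuous fun x => M * (‖v x‖ ^ 2 + ‖lap v x‖ ^ 2 + ∑ i, ‖pd i v x‖ ^ 2) :=
    continuous_const.mul (((hv.continuous.norm.pow 2).add (hv.lap.continuous.norm.pow 2)).add
      (continuous_finsetSum _ fun i _ => (hv.pd i).continuous.norm.pow 2))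
  calc ∑ i, ∑ j, ∫ x in Metric.ball 0 r, ‖pd j (pd i v) x‖ ^ 2
      ≤ ∑ i, ∑ j, ∫ x, ‖pd j (pd i (fun x => χ x • v x)) x‖ ^ 2 := by
        refine Finset.sum_le_sum fun i _ => Finset.sum_le_sum fun j _ => ?_
        have e : ∫ x in Metric.ball 0 r, ‖pd j (pd i v) x‖ ^ 2 =
            ∫ x in Metric.ball 0 r, ‖pd j (pd i (fun x => χ x • v x)) x‖ ^ 2 := by
          refine setIntegral_congr_fun measurableSet_ball fun x hx => ?_
          have : (fun x => χ x • v x) =ᶠ[𝓝 x] v := by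
            filter_upwards [Metric.isOpen_ball.mem_nhds hx] with y hy
            rw [h1 y hy, one_smul]
          simp only [(pd_eq_of_eventuallyEq (pd_eq_of_eventuallyEq this i) j).eq_of_nhds]
        rw [e]
        exact setIntegral_le_integral (integrable_normSq ((hsv.pd i).pd j).continuous
          (hasCompactSupport_pd (hasCompactSupport_pd hcv i) j))
          (ae_of_all _ fun x => by positivity)
    _ = ∫ x, ‖lap (fun x => χ x • v x) x‖ ^ 2 := integral_normSq_lap hsv hcv
    _ = ∫ x in Metric.ball 0 (r + 2), ‖lap (fun x => χ x • v x) x‖ ^ 2 := by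
        rw [setIntegral_eq_integral_of_forall_compl_eq_zero]
        intro x hx
        rw [lap_smul hχ hv, image_eq_zero_of_notMem_tsupport (hout x hx),
          lap_eq_zero_of_notMem (hout x hx)]
        simp [pd_eq_zero_of_notMem (hout x hx)]
    _ ≤ ∫ x in Metric.ball 0 (r + 2),
        M * (‖v x‖ ^ 2 + ‖lap v x‖ ^ 2 + ∑ i, ‖pd i v x‖ ^ 2) := by
        refine setIntegral_mono_on (Continuous.integrableOn_ball3
          (hsv.lap.continuous.norm.pow 2) _) (Continuous.integrableOn_ball3 hcont _)
          measurableSet_ball fun x _ => ?_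
        rw [lap_smul hχ hv]
        have a1 : ‖χ x • lap v x‖ ≤ ‖lap v x‖ := by
          rw [norm_smul]
          exact mul_le_of_le_one_left (norm_nonneg _) (hle x)
        have a2 : ‖2 * ∑ i, pd i χ x • pd i v x‖ ≤ 2 * C * ∑ i, ‖pd i v x‖ := by
          rw [norm_mul, Complex.norm_ofNat, mul_assoc, Finset.mul_sum]
          gcongr
          refine (norm_sum_le _ _).trans (Finset.sum_le_sum fun i _ => ?_)
          rw [norm_smul]
          gcongr
          exact hC i x
        have a3 : ‖lap χ x • v x‖ ≤ C' * ‖v x‖ := by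
          rw [norm_smul]
          gcongr
          exact hC' x
        have a4 : (∑ i, ‖pd i v x‖) ^ 2 ≤ 3 * ∑ i, ‖pd i v x‖ ^ 2 := by
          have := sq_sum_le_card_mul_sum_sq (s := Finset.univ) (f := fun i : Fin 3 => ‖pd i v x‖)
          simpa using this
        have a5 := (norm_add₃_le (a := χ x • lap v x) (b := 2 * ∑ i, pd i χ x • pd i v x)
          (c := lap χ x • v x)).trans (add_le_add (add_le_add a1 a2) a3)
        set P := ‖lap v x‖
        set S := ∑ i, ‖pd i v x‖
        set S2 := ∑ i, ‖pd i v x‖ ^ 2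
        set q := ‖v x‖
        have b1 : 0 ≤ S2 := Finset.sum_nonneg fun i _ => by positivity
        calc _ ≤ (P + 2 * C * S + C' * q) ^ 2 := pow_le_pow_left₀ (norm_nonneg _) a5 2
          _ ≤ 3 * (P ^ 2 + (2 * C * S) ^ 2 + (C' * q) ^ 2) := by
            nlinarith [sq_nonneg (P - 2 * C * S), sq_nonneg (P - C' * q),
              sq_nonneg (2 * C * S - C' * q)]
          _ = 3 * P ^ 2 + 12 * C ^ 2 * S ^ 2 + 3 * C' ^ 2 * q ^ 2 := by ring
          _ ≤ 3 * P ^ 2 + 12 * C ^ 2 * (3 * S2) + 3 * C' ^ 2 * q ^ 2 := by gcongr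
          _ ≤ M * P ^ 2 + M * S2 + M * q ^ 2 := by
            have c1 : 3 ≤ M := by rw [hM]; nlinarith [sq_nonneg C, sq_nonneg C']
            have c2 : 36 * C ^ 2 ≤ M := by rw [hM]; nlinarith [sq_nonneg C, sq_nonneg C']
            have c3 : 3 * C' ^ 2 ≤ M := by rw [hM]; nlinarith [sq_nonneg C, sq_nonneg C']
            have d2 : 12 * C ^ 2 * (3 * S2) = 36 * C ^ 2 * S2 := by ring
            rw [d2]
            gcongr
          _ = _ := by ring
    _ = _ := by
        have i1 : IntegrableOn (fun x => ‖v x‖ ^ 2) (Metric.ball 0 (r + 2)) :=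
          Continuous.integrableOn_ball3 (hv.continuous.norm.pow 2) (r + 2)
        have i2 : IntegrableOn (fun x => ‖lap v x‖ ^ 2) (Metric.ball 0 (r + 2)) :=
          Continuous.integrableOn_ball3 (hv.lap.continuous.norm.pow 2) (r + 2)
        have i3 : ∀ i, IntegrableOn (fun x => ‖pd i v x‖ ^ 2) (Metric.ball 0 (r + 2)) :=
          fun i => Continuous.integrableOn_ball3 ((hv.pd i).continuous.norm.pow 2) (r + 2)
        have i12 : IntegrableOn (fun x => ‖v x‖ ^ 2 + ‖lap v x‖ ^ 2) (Metric.ball 0 (r + 2)) :=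
          i1.add i2
        rw [integral_const_mul, integral_add i12 (integrable_finsetSum _ fun i _ => i3 i),
          integral_add i1 i2, integral_finsetSum _ fun i _ => i3 i]

theorem interior_estimate {r : ℝ} (hr : 0 < r) : ∃ C : ℝ, 0 ≤ C ∧ ∀ v : R3 → ℂ, Smooth v →
    (∫ x in Metric.ball 0 r, ‖v x‖ ^ 2) + (∑ i, ∫ x in Metric.ball 0 r, ‖pd i v x‖ ^ 2) +
      ∑ i, ∑ j, ∫ x in Metric.ball 0 r, ‖pd j (pd i v) x‖ ^ 2 ≤
      C * ((∫ x in Metric.ball 0 (r + 4), ‖v x‖ ^ 2) +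
        ∫ x in Metric.ball 0 (r + 4), ‖lap v x‖ ^ 2) := by
  obtain ⟨C₁, h₁, H₁⟩ := gradient_estimate (r := r + 2) (by linarith)
  obtain ⟨C₂, h₂, H₂⟩ := hessian_estimate hr
  refine ⟨1 + C₁ + C₂ * (1 + C₁), by positivity, fun v hv => ?_⟩
  have g1 := H₁ v hv
  have g2 := H₂ v hv
  have e : r + 2 + 2 = r + 4 := by ring
  rw [e] at g1
  have m1 := setIntegral_normSq_mono hv.continuous (show r ≤ r + 4 by linarith)
  have m2 := setIntegral_normSq_mono hv.continuous (show r + 2 ≤ r + 4 by linarith)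
  have m3 := setIntegral_normSq_mono hv.lap.continuous (show r + 2 ≤ r + 4 by linarith)
  have m4 : ∑ i, ∫ x in Metric.ball 0 r, ‖pd i v x‖ ^ 2 ≤
      ∑ i, ∫ x in Metric.ball 0 (r + 2), ‖pd i v x‖ ^ 2 := Finset.sum_le_sum fun i _ =>
    setIntegral_normSq_mono (hv.pd i).continuous (by linarith)
  have n1 : 0 ≤ ∫ x in Metric.ball 0 (r + 4), ‖lap v x‖ ^ 2 :=
    integral_nonneg fun x => by positivity
  set E := ∫ x in Metric.ball 0 (r + 4), ‖v x‖ ^ 2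
  set P := ∫ x in Metric.ball 0 (r + 4), ‖lap v x‖ ^ 2
  set S := ∑ i, ∫ x in Metric.ball 0 (r + 2), ‖pd i v x‖ ^ 2
  have g3 := g2.trans (mul_le_mul_of_nonneg_left (add_le_add (add_le_add m2 m3) g1) h₂)
  calc _ ≤ E + C₁ * (E + P) + C₂ * (E + P + C₁ * (E + P)) :=
        add_le_add (add_le_add m1 (m4.trans g1)) g3
    _ ≤ _ := by nlinarith

/-- The bound makes f factor through the range of e. The resulting map extends to the closure of the
range by density and to all of P by precomposition with the orthogonal projection. -/
theorem exists_extension_of_norm_le {E P V : Type*} [AddCommGroup E] [Module ℂ E]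
    [NormedAddCommGroup P] [InnerProductSpace ℂ P] [CompleteSpace P]
    [NormedAddCommGroup V] [NormedSpace ℂ V] [CompleteSpace V] (e : E →ₗ[ℂ] P) (f : E →ₗ[ℂ] V)
    (h : ∃ C, ∀ x, ‖f x‖ ≤ C * ‖e x‖) : ∃ T : P →L[ℂ] V, ∀ x, T (e x) = f x := by
  obtain ⟨C, hC⟩ := h
  set W := (LinearMap.range e).topologicalClosure with hW
  have hmem : ∀ x, e x ∈ W := fun x =>
    Submodule.le_topologicalClosure _ (LinearMap.mem_range_self e x)
  have : CompleteSpace W := (Submodule.isClosed_topologicalClosure _).completeSpace_coe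
  let e' : E →ₗ[ℂ] W := e.codRestrict W hmem
  have hd : DenseRange e' := by
    intro w
    rw [closure_subtype]
    have h1 : (Subtype.val '' Set.range e' : Set P) = LinearMap.range e := by
      ext y
      constructor
      · rintro ⟨_, ⟨x, rfl⟩, rfl⟩
        exact ⟨x, rfl⟩
      · rintro ⟨x, rfl⟩
        exact ⟨e' x, ⟨x, rfl⟩, rfl⟩
    rw [h1, ← Submodule.topologicalClosure_coe]
    exact w.2
  refine ⟨(f.extendOfNorm e') ∘L W.orthogonalProjectionOnto, fun x => ?_⟩
  have h2 : W.orthogonalProjectionOnto (e x) = e' x :=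
    Submodule.orthogonalProjectionOnto_mem_subspace_eq_self (e' x)
  rw [ContinuousLinearMap.comp_apply, h2]
  exact LinearMap.extendOfNorm_eq hd ⟨C, hC⟩ x

/-! ### Smooth functions in L²(D) and H²(D); completeness and regularity -/

instance isFiniteMeasure_restrict_ball3 (r : ℝ) :
    IsFiniteMeasure (volume.restrict (Metric.ball (0 : R3) r)) :=
  ⟨by rw [Measure.restrict_apply_univ]; exact measure_ball_lt_top⟩

theorem memLp_of_continuous {D : Set R3} (hD : MeasurableSet D) {r : ℝ} (hr : D ⊆ Metric.ball 0 r)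
    [IsFiniteMeasure (volume.restrict D)] {v : R3 → ℂ} (hv : Continuous v) :
    MemLp v 2 (volume.restrict D) := by
  obtain ⟨C, hC⟩ := (isCompact_closedBall (0 : R3) r).exists_bound_of_continuousOn hv.continuousOn
  refine MemLp.of_bound hv.aestronglyMeasurable C ?_
  filter_upwards [ae_restrict_mem hD] with x hx
  exact hC x (Metric.ball_subset_closedBall (hr hx))

/-- The complex vector space of smooth functions. -/
def smoothFunctions : Submodule ℂ (R3 → ℂ) where
  carrier := {v | Smooth v}
  zero_mem' := by
    change Smooth fun _ : R3 => (0 : ℂ)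
    exact contDiff_const
  add_mem' {v w} hv hw := by
    change Smooth v at hv
    change Smooth w at hw
    exact hv.add hw
  smul_mem' c v hv := by
    change Smooth v at hv
    exact hv.const_smul c

theorem smooth_coe (v : smoothFunctions) : Smooth (v : R3 → ℂ) := v.2

theorem pd_add' {v w : R3 → ℂ} (hv : Smooth v) (hw : Smooth w) (i : Fin 3) :
    pd i (v + w) = pd i v + pd i w := pd_add hv hw i

theorem pd_smul' (c : ℂ) {v : R3 → ℂ} (hv : Smooth v) (i : Fin 3) :
    pd i (c • v) = c • pd i v := pd_const_smul c v hv i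

theorem lap_add' {v w : R3 → ℂ} (hv : Smooth v) (hw : Smooth w) :
    lap (v + w) = lap v + lap w := by
  funext x
  simp only [lap, pd_add' hv hw, pd_add' (hv.pd _) (hw.pd _), Pi.add_apply, Finset.sum_add_distrib]

theorem lap_smul' (c : ℂ) {v : R3 → ℂ} (hv : Smooth v) : lap (c • v) = c • lap v := by
  funext x
  simp only [lap, pd_smul' c hv, pd_smul' c (hv.pd _), Pi.smul_apply, Finset.smul_sum]

/-- Partial derivatives on the space of smooth functions. -/
noncomputable def pdMap (i : Fin 3) : smoothFunctions →ₗ[ℂ] smoothFunctions where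
  toFun v := ⟨pd i v, (smooth_coe v).pd i⟩
  map_add' v w := Subtype.ext (pd_add' (smooth_coe v) (smooth_coe w) i)
  map_smul' c v := Subtype.ext (pd_smul' c (smooth_coe v) i)

/-- The Laplacian on the space of smooth functions. -/
noncomputable def lapMap : smoothFunctions →ₗ[ℂ] smoothFunctions where
  toFun v := ⟨lap v, (smooth_coe v).lap⟩
  map_add' v w := Subtype.ext (lap_add' (smooth_coe v) (smooth_coe w))
  map_smul' c v := Subtype.ext (lap_smul' c (smooth_coe v))

section Domain

variable {D : Set R3} [IsFiniteMeasure (volume.restrict D)]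

/-- The class of a smooth function in `L²(D)`. -/
noncomputable def smoothToL2 (hD : MeasurableSet D) {r : ℝ} (hr : D ⊆ Metric.ball 0 r) :
    smoothFunctions →ₗ[ℂ] L2 D where
  toFun v := (memLp_of_continuous hD hr (smooth_coe v).continuous).toLp (v : R3 → ℂ)
  map_add' _ _ := rfl
  map_smul' _ _ := rfl

theorem coeFn_smoothToL2 (hD : MeasurableSet D) {r : ℝ} (hr : D ⊆ Metric.ball 0 r)
    (v : smoothFunctions) : smoothToL2 hD hr v =ᵐ[volume.restrict D] (v : R3 → ℂ) :=
  (memLp_of_continuous hD hr (smooth_coe v).continuous).coeFn_toLp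

theorem norm_sq_smoothToL2 (hD : MeasurableSet D) {r : ℝ} (hr : D ⊆ Metric.ball 0 r)
    (v : smoothFunctions) : ‖smoothToL2 hD hr v‖ ^ 2 = ∫ x in D, ‖(v : R3 → ℂ) x‖ ^ 2 := by
  rw [L2.norm_sq_eq]
  refine integral_congr_ae ?_
  filter_upwards [coeFn_smoothToL2 hD hr v] with x hx
  rw [hx]

theorem norm_sq_smoothToL2_le (hD : MeasurableSet D) {r : ℝ} (hr : D ⊆ Metric.ball 0 r)
    (v : smoothFunctions) :
    ‖smoothToL2 hD hr v‖ ^ 2 ≤ ∫ x in Metric.ball 0 r, ‖(v : R3 → ℂ) x‖ ^ 2 := by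
  rw [norm_sq_smoothToL2]
  exact setIntegral_mono_set (Continuous.integrableOn_ball3
    ((smooth_coe v).continuous.norm.pow 2) r) (ae_of_all _ fun _ => by positivity) hr.eventuallyLE

theorem isWeakPartial_smooth (hD : MeasurableSet D) {r : ℝ} (hr : D ⊆ Metric.ball 0 r)
    (v : smoothFunctions) (i : Fin 3) :
    IsWeakPartial D i (smoothToL2 hD hr v) (smoothToL2 hD hr (pdMap i v)) := by
  intro ψ hψ hc hs
  have h := integral_bilin_pd (ContinuousLinearMap.lsmul ℝ ℝ : ℝ →L[ℝ] ℂ →L[ℝ] ℂ) hψ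
    (smooth_coe v) (Or.inl hc) i
  have hz : ∀ x ∉ D, x ∉ tsupport ψ := fun x hx h => hx (hs h)
  have e1 : ∫ x in D, (fderiv ℝ ψ x (EuclideanSpace.single i 1)) • smoothToL2 hD hr v x =
      ∫ x, pd i ψ x • (v : R3 → ℂ) x := by
    refine Eq.trans ?_ (setIntegral_eq_integral_of_forall_compl_eq_zero (s := D) ?_)
    · refine integral_congr_ae ?_
      filter_upwards [coeFn_smoothToL2 hD hr v] with x hx
      rw [hx]
      rfl
    · intro x hx
      rw [pd_eq_zero_of_notMem (hz x hx), zero_smul]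
  have e2 : ∫ x in D, ψ x • smoothToL2 hD hr (pdMap i v) x =
      ∫ x, ψ x • pd i (v : R3 → ℂ) x := by
    refine Eq.trans ?_ (setIntegral_eq_integral_of_forall_compl_eq_zero (s := D) ?_)
    · refine integral_congr_ae ?_
      filter_upwards [coeFn_smoothToL2 hD hr (pdMap i v)] with x hx
      rw [hx]
      rfl
    · intro x hx
      rw [image_eq_zero_of_notMem_tsupport (hz x hx), zero_smul]
  rw [e1, e2]
  simp only [ContinuousLinearMap.lsmul_apply] at h
  rw [h, neg_neg]

/-- The second-order jet of a smooth function. -/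
noncomputable def smoothJet (hD : MeasurableSet D) {r : ℝ} (hr : D ⊆ Metric.ball 0 r) :
    smoothFunctions →ₗ[ℂ] H2 D where
  toFun v := ⟨WithLp.toLp 2 (Sum.elim (fun _ => smoothToL2 hD hr v)
      (Sum.elim (fun i => smoothToL2 hD hr (pdMap i v))
        fun p => smoothToL2 hD hr (pdMap p.2 (pdMap p.1 v)))),
    fun i => isWeakPartial_smooth hD hr v i, fun i j => isWeakPartial_smooth hD hr (pdMap i v) j⟩
  map_add' v w := by
    refine Subtype.ext (PiLp.ext fun k => ?_)
    rcases k with _ | i | p <;> simp [map_add]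
  map_smul' c v := by
    refine Subtype.ext (PiLp.ext fun k => ?_)
    rcases k with _ | i | p <;> simp [map_smul]

/-- The embedding of `H²(D)` into `L²(D)`. -/
noncomputable def toL2Map (D : Set R3) : H2 D →L[ℂ] L2 D :=
  (PiLp.proj (𝕜 := ℂ) 2 (fun _ : JetIndex => L2 D) (Sum.inl ())) ∘L (H2 D).subtypeL

/-- The Laplacian from `H²(D)` to `L²(D)`. -/
noncomputable def lapL2Map (D : Set R3) : H2 D →L[ℂ] L2 D :=
  ∑ i : Fin 3, (PiLp.proj (𝕜 := ℂ) 2 (fun _ : JetIndex => L2 D) (Sum.inr (Sum.inr (i, i)))) ∘L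
    (H2 D).subtypeL

theorem toL2Map_smoothJet (hD : MeasurableSet D) {r : ℝ} (hr : D ⊆ Metric.ball 0 r)
    (v : smoothFunctions) : toL2Map D (smoothJet hD hr v) = smoothToL2 hD hr v := rfl

theorem lapL2Map_smoothJet (hD : MeasurableSet D) {r : ℝ} (hr : D ⊆ Metric.ball 0 r)
    (v : smoothFunctions) : lapL2Map D (smoothJet hD hr v) = smoothToL2 hD hr (lapMap v) := by
  have h1 : lapMap v = ∑ i, pdMap i (pdMap i v) := by
    refine Subtype.ext (funext fun x => ?_)
    rw [Submodule.coe_sum, Finset.sum_apply]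
    rfl
  rw [h1, map_sum, lapL2Map, _root_.sum_apply]
  rfl

theorem norm_sq_smoothJet_le (hD : MeasurableSet D) {r : ℝ} (hr : D ⊆ Metric.ball 0 r)
    (v : smoothFunctions) : ‖smoothJet hD hr v‖ ^ 2 ≤
      (∫ x in Metric.ball 0 r, ‖(v : R3 → ℂ) x‖ ^ 2) +
      (∑ i, ∫ x in Metric.ball 0 r, ‖pd i (v : R3 → ℂ) x‖ ^ 2) +
      ∑ i, ∑ j, ∫ x in Metric.ball 0 r, ‖pd j (pd i (v : R3 → ℂ)) x‖ ^ 2 := by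
  rw [Submodule.coe_norm, PiLp.norm_sq_eq_of_L2, Fintype.sum_sum_type, Fintype.sum_sum_type,
    Fintype.sum_prod_type, ← add_assoc]
  refine add_le_add (add_le_add ?_ (Finset.sum_le_sum fun i _ => ?_))
    (Finset.sum_le_sum fun i _ => Finset.sum_le_sum fun j _ => ?_)
  · rw [Finset.univ_unique, Finset.sum_singleton]
    exact norm_sq_smoothToL2_le hD hr v
  · exact norm_sq_smoothToL2_le hD hr (pdMap i v)
  · exact norm_sq_smoothToL2_le hD hr (pdMap j (pdMap i v))

/-- A real-valued test function as a vector in `L²(D)`. -/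
noncomputable def testVec (hD : MeasurableSet D) {r : ℝ} (hr : D ⊆ Metric.ball 0 r) {ψ : R3 → ℝ}
    (hψ : Smooth ψ) : L2 D :=
  smoothToL2 hD hr ⟨fun x => (ψ x : ℂ), Complex.ofRealCLM.contDiff.comp hψ⟩

theorem inner_testVec (hD : MeasurableSet D) {r : ℝ} (hr : D ⊆ Metric.ball 0 r) {ψ : R3 → ℝ}
    (hψ : Smooth ψ) (f : L2 D) : inner ℂ (testVec hD hr hψ) f = ∫ x in D, ψ x • f x := by
  rw [L2.inner_def]
  refine integral_congr_ae ?_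
  filter_upwards [coeFn_smoothToL2 hD hr
    ⟨fun x => (ψ x : ℂ), Complex.ofRealCLM.contDiff.comp hψ⟩] with x hx
  rw [testVec, hx, RCLike.inner_apply]
  simp [mul_comm]

/-- Each test function imposes an equation between two continuous functionals of the pair.
Completeness of H²(D) follows. -/
theorem isClosed_isWeakPartial (hD : MeasurableSet D) {r : ℝ} (hr : D ⊆ Metric.ball 0 r)
    (i : Fin 3) : IsClosed {p : L2 D × L2 D | IsWeakPartial D i p.1 p.2} := by
  have : {p : L2 D × L2 D | IsWeakPartial D i p.1 p.2} =
      ⋂ (ψ : R3 → ℝ) (hψ : Smooth ψ) (_ : HasCompactSupport ψ) (_ : tsupport ψ ⊆ D),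
        {p | inner ℂ (testVec hD hr (hψ.pd i)) p.1 = - inner ℂ (testVec hD hr hψ) p.2} := by
    ext p
    simp only [Set.mem_ofPred_eq, Set.mem_iInter, inner_testVec]
    rfl
  rw [this]
  refine isClosed_iInter fun ψ => isClosed_iInter fun hψ => isClosed_iInter fun _ =>
    isClosed_iInter fun _ => isClosed_eq ?_ ?_
  · exact continuous_const.inner continuous_fst
  · exact (continuous_const.inner continuous_snd).neg

theorem completeSpace_H2 (hD : MeasurableSet D) {r : ℝ} (hr : D ⊆ Metric.ball 0 r) :
    CompleteSpace (H2 D) := by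
  have hc : IsClosed (H2 D : Set (PiLp 2 fun _ : JetIndex => L2 D)) := by
    have : (H2 D : Set (PiLp 2 fun _ : JetIndex => L2 D)) =
        (⋂ i : Fin 3, {U | IsWeakPartial D i (U (Sum.inl ())) (U (Sum.inr (Sum.inl i)))}) ∩
        ⋂ (i : Fin 3) (j : Fin 3), {U | IsWeakPartial D j (U (Sum.inr (Sum.inl i)))
          (U (Sum.inr (Sum.inr (i, j))))} := by
      ext U
      simp only [Set.mem_inter_iff, Set.mem_iInter]
      rfl
    rw [this]
    have hp : ∀ k, Continuous fun U : PiLp 2 fun _ : JetIndex => L2 D => U k := fun k =>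
      (PiLp.proj (𝕜 := ℂ) 2 (fun _ : JetIndex => L2 D) k).continuous
    refine (isClosed_iInter fun i => ?_).inter
      (isClosed_iInter fun i => isClosed_iInter fun j => ?_)
    · exact (isClosed_isWeakPartial hD hr i).preimage ((hp _).prodMk (hp _))
    · exact (isClosed_isWeakPartial hD hr j).preimage ((hp _).prodMk (hp _))
  exact hc.completeSpace_coe

theorem eq_zero_of_integral_smul (hD : IsOpen D) {g : L2 D}
    (h : ∀ ψ : R3 → ℝ, Smooth ψ → HasCompactSupport ψ → tsupport ψ ⊆ D →
      ∫ x in D, ψ x • g x = 0) : g = 0 := by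
  have h1 : LocallyIntegrableOn (g : R3 → ℂ) D (volume.restrict D) :=
    (((Lp.memLp g).integrable one_le_two).locallyIntegrable).locallyIntegrableOn D
  have h2 := hD.ae_eq_zero_of_integral_contDiff_smul_eq_zero h1 h
  refine Lp.ext ?_
  filter_upwards [h2, ae_restrict_mem hD.measurableSet, Lp.coeFn_zero ℂ 2 (volume.restrict D)]
    with x hx hxD h0
  rw [hx hxD, h0]
  rfl

theorem isWeakPartial_zero_left (hD : IsOpen D) {i : Fin 3} {g : L2 D}
    (h : IsWeakPartial D i 0 g) : g = 0 := by
  refine eq_zero_of_integral_smul hD fun ψ hψ hc hs => ?_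
  have h1 := h ψ hψ hc hs
  rw [eq_comm, neg_eq_iff_eq_neg] at h1
  rw [h1, neg_eq_zero]
  refine integral_eq_zero_of_ae ?_
  filter_upwards [Lp.coeFn_zero ℂ 2 (volume.restrict D)] with x hx
  rw [hx]
  simp

/-- Weak derivatives are unique by the fundamental lemma of the calculus of variations, so a jet is
determined by its function. -/
theorem injective_toL2Map (hD : IsOpen D) : Function.Injective (toL2Map D) := by
  rw [injective_iff_map_eq_zero]
  rintro ⟨U, hU1, hU2⟩ h
  have h0 : U (Sum.inl ()) = 0 := h
  have h1 : ∀ i, U (Sum.inr (Sum.inl i)) = 0 := fun i =>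
    isWeakPartial_zero_left hD (by have := hU1 i; rwa [h0] at this)
  have h2 : ∀ i j, U (Sum.inr (Sum.inr (i, j))) = 0 := fun i j =>
    isWeakPartial_zero_left hD (by have := hU2 i j; rwa [h1 i] at this)
  refine Subtype.ext (PiLp.ext fun k => ?_)
  rcases k with _ | i | ⟨i, j⟩
  · exact h0
  · exact h1 i
  · exact h2 i j

/-- A closed subspace of `L²(D)` containing all real test functions is everything. -/
theorem dense_test_functions (hD : IsOpen D) {r : ℝ} (hr : D ⊆ Metric.ball 0 r)
    {T : Submodule ℂ (L2 D)} (hT : IsClosed (T : Set (L2 D)))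
    (h : ∀ (ψ : R3 → ℝ) (hψ : Smooth ψ), HasCompactSupport ψ → tsupport ψ ⊆ D →
      testVec hD.measurableSet hr hψ ∈ T) : T = ⊤ := by
  have h1 : T.topologicalClosure = ⊤ := by
    rw [Submodule.topologicalClosure_eq_top_iff, Submodule.eq_bot_iff]
    intro g hg
    refine eq_zero_of_integral_smul hD fun ψ hψ hc hs => ?_
    rw [← inner_testVec hD.measurableSet hr hψ]
    exact (Submodule.mem_orthogonal _ _).1 hg _ (h ψ hψ hc hs)
  rwa [hT.submodule_topologicalClosure_eq] at h1

/-- Interior regularity: functions in the ball are mapped to `H²(D)` by means of the function and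
its Laplacian. -/
theorem exists_interior_regularity (hD : IsOpen D) {r : ℝ} (hr0 : 0 < r)
    (hr : D ⊆ Metric.ball 0 r) :
    ∃ T : WithLp 2 (L2 (Metric.ball 0 (r + 4)) × L2 (Metric.ball 0 (r + 4))) →L[ℂ] H2 D,
      ∀ v : smoothFunctions,
        T (WithLp.toLp 2 (smoothToL2 measurableSet_ball subset_rfl v,
          smoothToL2 measurableSet_ball subset_rfl (lapMap v))) =
        smoothJet hD.measurableSet hr v := by
  have := completeSpace_H2 hD.measurableSet hr
  let E₀ : smoothFunctions →ₗ[ℂ] L2 (Metric.ball 0 (r + 4)) :=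
    smoothToL2 measurableSet_ball subset_rfl
  -- On the larger ball only v and Δv are recorded; the interior estimate says that this pair
  -- controls the full jet on D.
  let e : smoothFunctions →ₗ[ℂ]
      WithLp 2 (L2 (Metric.ball 0 (r + 4)) × L2 (Metric.ball 0 (r + 4))) :=
    (WithLp.linearEquiv 2 ℂ _).symm.toLinearMap ∘ₗ (E₀.prod (E₀ ∘ₗ lapMap))
  obtain ⟨C, hC0, hC⟩ := interior_estimate hr0
  refine exists_extension_of_norm_le e (smoothJet hD.measurableSet hr) ⟨Real.sqrt C, fun v => ?_⟩
  refine le_of_sq_le_sq ?_ (by positivity)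
  have h1 : ‖e v‖ ^ 2 = ‖E₀ v‖ ^ 2 + ‖E₀ (lapMap v)‖ ^ 2 := WithLp.prod_norm_sq_eq_of_L2 _
  rw [mul_pow, Real.sq_sqrt hC0, h1, norm_sq_smoothToL2, norm_sq_smoothToL2]
  exact (norm_sq_smoothJet_le hD.measurableSet hr v).trans (hC v (smooth_coe v))

end Domain

/-! ### The fundamental solution of the Helmholtz equation -/

/-- The regularized distance `√(|z|² + ε²)`. -/
noncomputable def regDist (ε : ℝ) (z : R3) : ℝ := Real.sqrt (‖z‖ ^ 2 + ε ^ 2)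

theorem regDist_pos {ε : ℝ} (hε : 0 < ε) (z : R3) : 0 < regDist ε z :=
  Real.sqrt_pos.2 (by positivity)

theorem regDist_sq (ε : ℝ) (z : R3) : regDist ε z ^ 2 = ‖z‖ ^ 2 + ε ^ 2 :=
  Real.sq_sqrt (by positivity)

theorem smooth_regDist {ε : ℝ} (hε : 0 < ε) : Smooth (regDist ε) :=
  ((contDiff_norm_sq ℝ).add contDiff_const).sqrt fun z => by positivity

theorem hasFDerivAt_regDist {ε : ℝ} (hε : 0 < ε) (z : R3) :
    HasFDerivAt (regDist ε) ((regDist ε z)⁻¹ • innerSL ℝ z) z := by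
  have h1 : HasFDerivAt (fun z : R3 => ‖z‖ ^ 2 + ε ^ 2) (2 • innerSL ℝ z) z :=
    (hasStrictFDerivAt_norm_sq z).hasFDerivAt.add_const _
  have h2 := h1.sqrt (by positivity)
  refine h2.congr_fderiv ?_
  ext y
  have := (regDist_pos hε z).ne'
  simp only [regDist] at this ⊢
  simp
  field_simp

theorem pd_comp_regDist {ε : ℝ} (hε : 0 < ε) {h : ℝ → ℂ} {h' : ℂ} (z : R3)
    (hh : HasDerivAt h h' (regDist ε z)) (i : Fin 3) :
    pd i (fun z => h (regDist ε z)) z = z i • ((regDist ε z : ℂ)⁻¹ * h') := by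
  have h1 := hh.hasFDerivAt.comp z (hasFDerivAt_regDist hε z)
  rw [pd]
  have h2 := h1.fderiv
  simp only [Function.comp_def] at h2
  rw [h2]
  simp [EuclideanSpace.inner_single_right]
  ring

/-- The profile `e^{iωs} / (4πs)` of the Green's function. -/
noncomputable def profile (ω : ℂ) (s : ℝ) : ℂ :=
  Complex.exp (Complex.I * ω * s) * (s : ℂ)⁻¹ * (4 * Real.pi : ℂ)⁻¹

/-- The function `s ↦ g'(s) / s` for the profile `g`. -/
noncomputable def profileSlope (ω : ℂ) (s : ℝ) : ℂ :=
  Complex.exp (Complex.I * ω * s) * (Complex.I * ω * (s : ℂ)⁻¹ ^ 2 - (s : ℂ)⁻¹ ^ 3) *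
    (4 * Real.pi : ℂ)⁻¹

theorem hasDerivAt_exp_profile (ω : ℂ) (s : ℝ) :
    HasDerivAt (fun s : ℝ => Complex.exp (Complex.I * ω * s))
      (Complex.exp (Complex.I * ω * s) * (Complex.I * ω)) s := by
  have h1 : HasDerivAt (fun s : ℝ => Complex.I * ω * (s : ℂ)) (Complex.I * ω) s := by
    simpa using (Complex.ofRealCLM.hasDerivAt (x := s)).const_mul (Complex.I * ω)
  exact h1.cexp

theorem hasDerivAt_inv_ofReal {s : ℝ} (hs : s ≠ 0) :
    HasDerivAt (fun s : ℝ => (s : ℂ)⁻¹) (-((s : ℂ)⁻¹ ^ 2)) s := by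
  have h1 : HasDerivAt (fun s : ℝ => (s : ℂ)) 1 s := (hasDerivAt_id s).ofReal_comp
  have h2 := h1.fun_inv (by exact_mod_cast hs)
  refine h2.congr_deriv ?_
  field_simp

theorem hasDerivAt_profile (ω : ℂ) {s : ℝ} (hs : s ≠ 0) :
    HasDerivAt (profile ω) (s * profileSlope ω s) s := by
  have h1 := ((hasDerivAt_exp_profile ω s).fun_mul (hasDerivAt_inv_ofReal hs)).mul_const
    (4 * Real.pi : ℂ)⁻¹
  refine h1.congr_deriv ?_
  have : (s : ℂ) ≠ 0 := by exact_mod_cast hs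
  rw [profileSlope]
  field_simp
  ring

theorem hasDerivAt_profileSlope (ω : ℂ) {s : ℝ} (hs : s ≠ 0) :
    HasDerivAt (profileSlope ω) (Complex.exp (Complex.I * ω * s) *
      (-ω ^ 2 * (s : ℂ)⁻¹ ^ 2 - 3 * Complex.I * ω * (s : ℂ)⁻¹ ^ 3 + 3 * (s : ℂ)⁻¹ ^ 4) *
      (4 * Real.pi : ℂ)⁻¹) s := by
  have h2 := hasDerivAt_inv_ofReal hs
  have h1 := ((hasDerivAt_exp_profile ω s).fun_mul
    (((h2.fun_pow 2).const_mul (Complex.I * ω)).fun_sub (h2.fun_pow 3))).mul_const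
    (4 * Real.pi : ℂ)⁻¹
  refine h1.congr_deriv ?_
  have hI := Complex.I_sq
  simp only [Nat.add_one_sub_one, pow_one, Nat.cast_ofNat]
  linear_combination (Complex.exp (Complex.I * ω * s) * ω ^ 2 * (s : ℂ)⁻¹ ^ 2 *
    (4 * Real.pi : ℂ)⁻¹) * hI

/-- The regularized Green's function. -/
noncomputable def regGreen (ε : ℝ) (ω : ℂ) (z : R3) : ℂ := profile ω (regDist ε z)

theorem smooth_exp_regDist {ε : ℝ} (hε : 0 < ε) (ω : ℂ) :
    Smooth fun z => Complex.exp (Complex.I * ω * regDist ε z) :=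
  (contDiff_const.mul (Complex.ofRealCLM.contDiff.comp (smooth_regDist hε))).cexp

theorem smooth_inv_regDist {ε : ℝ} (hε : 0 < ε) : Smooth fun z => (regDist ε z : ℂ)⁻¹ :=
  ContDiff.inv (Complex.ofRealCLM.contDiff.comp (smooth_regDist hε)) fun z => by
    simpa using (regDist_pos hε z).ne'

theorem smooth_regGreen {ε : ℝ} (hε : 0 < ε) (ω : ℂ) : Smooth (regGreen ε ω) :=
  ((smooth_exp_regDist hε ω).mul (smooth_inv_regDist hε)).mul contDiff_const

theorem smooth_slope_regDist {ε : ℝ} (hε : 0 < ε) (ω : ℂ) :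
    Smooth fun z => profileSlope ω (regDist ε z) :=
  ((smooth_exp_regDist hε ω).mul ((contDiff_const.mul ((smooth_inv_regDist hε).pow 2)).sub
    ((smooth_inv_regDist hε).pow 3))).mul contDiff_const

theorem smooth_coord (i : Fin 3) : Smooth fun z : R3 => z i :=
  (EuclideanSpace.proj (𝕜 := ℝ) i).contDiff

theorem pd_coord (i : Fin 3) (z : R3) : pd i (fun z : R3 => z i) z = 1 := by
  have h : HasFDerivAt (fun z : R3 => z i) (EuclideanSpace.proj (𝕜 := ℝ) i : R3 →L[ℝ] ℝ) z :=
    (EuclideanSpace.proj (𝕜 := ℝ) i : R3 →L[ℝ] ℝ).hasFDerivAt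
  rw [pd, h.fderiv]
  simp

/-- For ε = 0 the radial computation gives zero away from the origin. Here |z|² = s² - ε² with s the
regularized distance, so exactly the terms carrying ε² remain. -/
theorem lap_regGreen {ε : ℝ} (hε : 0 < ε) (ω : ℂ) (z : R3) :
    lap (regGreen ε ω) z + ω ^ 2 * regGreen ε ω z =
      ε ^ 2 * Complex.exp (Complex.I * ω * regDist ε z) *
        (-3 * (regDist ε z : ℂ)⁻¹ ^ 5 + 3 * Complex.I * ω * (regDist ε z : ℂ)⁻¹ ^ 4 +
          ω ^ 2 * (regDist ε z : ℂ)⁻¹ ^ 3) * (4 * Real.pi : ℂ)⁻¹ := by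
  have hs : ∀ z, regDist ε z ≠ 0 := fun z => (regDist_pos hε z).ne'
  have hsC : (regDist ε z : ℂ) ≠ 0 := by exact_mod_cast hs z
  have h1 : ∀ i, pd i (regGreen ε ω) = fun z => z i • profileSlope ω (regDist ε z) := by
    intro i
    funext y
    have hsC : (regDist ε y : ℂ) ≠ 0 := by exact_mod_cast hs y
    have := pd_comp_regDist hε y (hasDerivAt_profile ω (hs y)) i
    rw [inv_mul_cancel_left₀ hsC] at this
    exact this
  have h2 : ∀ i, pd i (pd i (regGreen ε ω)) z = z i ^ 2 • ((regDist ε z : ℂ)⁻¹ *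
      (Complex.exp (Complex.I * ω * regDist ε z) *
      (-ω ^ 2 * (regDist ε z : ℂ)⁻¹ ^ 2 - 3 * Complex.I * ω * (regDist ε z : ℂ)⁻¹ ^ 3 +
        3 * (regDist ε z : ℂ)⁻¹ ^ 4) * (4 * Real.pi : ℂ)⁻¹)) + profileSlope ω (regDist ε z) := by
    intro i
    rw [h1, pd_smul (smooth_coord i) (smooth_slope_regDist hε ω)]
    simp only [pd_coord, one_smul]
    rw [pd_comp_regDist hε z (hasDerivAt_profileSlope ω (hs z)) i, smul_smul, ← pow_two]
  have h3 : ∑ i, z i ^ 2 = regDist ε z ^ 2 - ε ^ 2 := by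
    rw [regDist_sq, EuclideanSpace.real_norm_sq_eq]; ring
  simp only [lap, h2, Finset.sum_add_distrib, ← Finset.sum_smul, h3]
  simp only [Finset.sum_const, Finset.card_univ, Fintype.card_fin, regGreen, profile, profileSlope,
    Complex.real_smul]
  push_cast
  simp only [nsmul_eq_mul, Nat.cast_ofNat]
  field_simp
  ring

theorem integral_mul_lap {p q : R3 → ℂ} (hp : Smooth p) (hq : Smooth q) (hc : HasCompactSupport q) :
    ∫ x, p x * lap q x = ∫ x, lap p x * q x := by
  have key : ∀ i, ∫ x, p x * pd i (pd i q) x = ∫ x, pd i (pd i p) x * q x := by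
    intro i
    have h1 := integral_bilin_pd (ContinuousLinearMap.mul ℝ ℂ) hp (hq.pd i)
      (Or.inr (hasCompactSupport_pd hc i)) i
    have h2 := integral_bilin_pd (ContinuousLinearMap.mul ℝ ℂ) (hp.pd i) hq (Or.inr hc) i
    simp only [ContinuousLinearMap.mul_apply'] at h1 h2
    rw [h1, h2, neg_neg]
  have i1 : ∀ i, Integrable fun x => p x * pd i (pd i q) x := fun i =>
    integrable_bilin (ContinuousLinearMap.mul ℝ ℂ) hp.continuous ((hq.pd i).pd i).continuous
      (Or.inr (hasCompactSupport_pd (hasCompactSupport_pd hc i) i))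
  have i2 : ∀ i, Integrable fun x => pd i (pd i p) x * q x := fun i =>
    integrable_bilin (ContinuousLinearMap.mul ℝ ℂ) ((hp.pd i).pd i).continuous hq.continuous
      (Or.inr hc)
  simp only [lap, Finset.mul_sum, Finset.sum_mul]
  rw [integral_finsetSum _ fun i _ => i1 i, integral_finsetSum _ fun i _ => i2 i]
  exact Finset.sum_congr rfl fun i _ => key i

theorem hasDerivAt_sqrt_one_add_sq (r : ℝ) :
    HasDerivAt (fun r : ℝ => Real.sqrt (1 + r ^ 2)) (r / Real.sqrt (1 + r ^ 2)) r := by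
  have h1 : HasDerivAt (fun r : ℝ => 1 + r ^ 2) (2 * r) r := by
    simpa using ((hasDerivAt_id r).pow 2).const_add 1
  refine (h1.sqrt (by positivity)).congr_deriv ?_
  field_simp

theorem integral_Ioi_sq_mul :
    ∫ r in Set.Ioi (0 : ℝ), r ^ 2 * (Real.sqrt (1 + r ^ 2))⁻¹ ^ 5 = 1 / 3 := by
  have hpos : ∀ r : ℝ, 0 < Real.sqrt (1 + r ^ 2) := fun r => Real.sqrt_pos.2 (by positivity)
  -- The primitive tends to 1/3 at infinity.
  have hd : ∀ r : ℝ, HasDerivAt (fun r : ℝ => (r / Real.sqrt (1 + r ^ 2)) ^ 3 / 3)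
      (r ^ 2 * (Real.sqrt (1 + r ^ 2))⁻¹ ^ 5) r := by
    intro r
    have h1 := (((hasDerivAt_id r).fun_div (hasDerivAt_sqrt_one_add_sq r) (hpos r).ne').fun_pow
      3).div_const 3
    refine h1.congr_deriv ?_
    have h2 := Real.sq_sqrt (show 0 ≤ 1 + r ^ 2 by positivity)
    have := (hpos r).ne'
    simp only [id, Nat.add_one_sub_one, Nat.cast_ofNat, div_pow]
    set s := Real.sqrt (1 + r ^ 2)
    field_simp
    have h4 : s ^ 2 - r ^ 2 = 1 := by linarith
    simp only [h4, mul_one]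
  have ht : Tendsto (fun r : ℝ => (r / Real.sqrt (1 + r ^ 2)) ^ 3 / 3) atTop (𝓝 (1 ^ 3 / 3)) := by
    refine Tendsto.div_const (Tendsto.pow ?_ 3) 3
    have h1 : Tendsto (fun r : ℝ => (Real.sqrt ((r⁻¹) ^ 2 + 1))⁻¹) atTop
        (𝓝 (Real.sqrt (0 ^ 2 + 1))⁻¹) := by
      refine Tendsto.inv₀ ?_ (by simp)
      exact (Real.continuous_sqrt.tendsto _).comp ((tendsto_inv_atTop_zero.pow 2).add_const 1)
    have h2 : (Real.sqrt ((0 : ℝ) ^ 2 + 1))⁻¹ = 1 := by simp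
    rw [h2] at h1
    refine h1.congr' ?_
    filter_upwards [eventually_gt_atTop 0] with r hr
    have : 1 + r ^ 2 = r ^ 2 * (r⁻¹ ^ 2 + 1) := by field_simp
    rw [this, Real.sqrt_mul (by positivity), Real.sqrt_sq hr.le]
    have : Real.sqrt (r⁻¹ ^ 2 + 1) ≠ 0 := (Real.sqrt_pos.2 (by positivity)).ne'
    field_simp
  have := integral_Ioi_of_hasDerivAt_of_nonneg (hd 0).continuousAt.continuousWithinAt
    (fun r _ => hd r) (fun r _ => by have := (hpos r).le; positivity) ht
  rw [this]
  norm_num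

theorem integral_regDist_one : ∫ y : R3, (regDist 1 y)⁻¹ ^ 5 = 4 * Real.pi / 3 := by
  have h := integral_fun_norm_addHaar (volume : Measure R3)
    (fun r : ℝ => (Real.sqrt (1 + r ^ 2))⁻¹ ^ 5)
  have e : (fun y : R3 => (regDist 1 y)⁻¹ ^ 5) =
      fun y : R3 => (Real.sqrt (1 + ‖y‖ ^ 2))⁻¹ ^ 5 := by
    funext y
    rw [regDist, one_pow, add_comm]
  rw [e, h, finrank_euclideanSpace, Fintype.card_fin]
  simp only [Nat.add_one_sub_one, smul_eq_mul]
  rw [integral_Ioi_sq_mul, Measure.real, EuclideanSpace.volume_ball_fin_three]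
  rw [ENNReal.ofReal_one, one_pow, one_mul, ENNReal.toReal_ofReal (by positivity)]
  simp only [nsmul_eq_mul, Nat.cast_ofNat]
  ring

theorem integrable_regDist_one : Integrable fun y : R3 => (regDist 1 y)⁻¹ ^ 5 := by
  have h := integrable_rpow_neg_one_add_norm_sq (E := R3) (μ := volume) (r := 5)
    (by rw [finrank_euclideanSpace, Fintype.card_fin]; norm_num)
  refine h.congr (ae_of_all _ fun y => ?_)
  have h1 : (0 : ℝ) ≤ 1 + ‖y‖ ^ 2 := by positivity
  simp only [regDist]
  rw [one_pow, add_comm (‖y‖ ^ 2), Real.sqrt_eq_rpow, ← Real.rpow_neg_one, ← Real.rpow_mul h1,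
    ← Real.rpow_natCast _ 5, ← Real.rpow_mul h1]
  norm_num

theorem norm_exp_le (ω : ℂ) {s t : ℝ} (h0 : 0 ≤ s) (h : s ≤ t) :
    ‖Complex.exp (Complex.I * ω * s)‖ ≤ Real.exp (‖ω‖ * t) := by
  refine (Complex.norm_exp_le_exp_norm _).trans (Real.exp_le_exp.2 ?_)
  rw [norm_mul, norm_mul, Complex.norm_I, one_mul, Complex.norm_real, Real.norm_of_nonneg h0]
  gcongr

theorem regDist_smul {ε : ℝ} (hε : 0 < ε) (y : R3) : regDist ε (ε • y) = ε * regDist 1 y := by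
  rw [regDist, regDist, norm_smul, Real.norm_of_nonneg hε.le, mul_pow, one_pow,
    show ε ^ 2 * ‖y‖ ^ 2 + ε ^ 2 = ε ^ 2 * (‖y‖ ^ 2 + 1) by ring, Real.sqrt_mul (by positivity),
    Real.sqrt_sq hε.le]

theorem norm_le_regDist (ε : ℝ) (z : R3) : ‖z‖ ≤ regDist ε z :=
  Real.le_sqrt_of_sq_le (by nlinarith [sq_nonneg ε])

theorem regDist_le {ε : ℝ} (hε : 0 ≤ ε) (z : R3) : regDist ε z ≤ ‖z‖ + ε :=
  Real.sqrt_le_iff.2 ⟨by positivity, by nlinarith [mul_nonneg hε (norm_nonneg z)]⟩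

theorem continuous_regDist (z : R3) : Continuous fun ε => regDist ε z := by
  unfold regDist
  fun_prop

theorem regDist_zero (z : R3) : regDist 0 z = ‖z‖ := by
  simp [regDist]

theorem green_eq_profile (ω : ℂ) (z : R3) : green ω z = profile ω ‖z‖ := by
  rw [green, profile, div_eq_mul_inv, mul_inv]
  ring

theorem continuousAt_profile (ω : ℂ) {s : ℝ} (hs : s ≠ 0) : ContinuousAt (profile ω) s :=
  (hasDerivAt_profile ω hs).continuousAt

theorem norm_profile_le (ω : ℂ) {s t : ℝ} (h0 : 0 ≤ s) (h : s ≤ t) :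
    ‖profile ω s‖ ≤ Real.exp (‖ω‖ * t) * s⁻¹ := by
  have hpi : (1 : ℝ) ≤ 4 * Real.pi := by linarith [Real.pi_gt_three]
  rw [profile, norm_mul, norm_mul, norm_inv, norm_inv, norm_mul, Complex.norm_real,
    Complex.norm_real, Complex.norm_ofNat, Real.norm_of_nonneg h0,
    Real.norm_of_nonneg Real.pi_pos.le]
  calc _ ≤ Real.exp (‖ω‖ * t) * s⁻¹ * 1 := by
        gcongr
        · exact norm_exp_le ω h0 h
        · exact inv_le_one_of_one_le₀ hpi
    _ = _ := mul_one _

theorem integrableOn_inv_norm (r : ℝ) :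
    IntegrableOn (fun z : R3 => ‖z‖⁻¹) (Metric.ball 0 r) := by
  refine ((integrableOn_inv_norm_sq r).add (integrable_const (1 : ℝ))).mono'
    (by fun_prop) (ae_of_all _ fun z => ?_)
  rw [Real.norm_of_nonneg (by positivity), Pi.add_apply]
  nlinarith [sq_nonneg (‖z‖⁻¹ - 1)]

theorem measurable_green (ω : ℂ) : Measurable (green ω) := by
  unfold green
  fun_prop

theorem locallyIntegrable_green (ω : ℂ) : LocallyIntegrable (green ω) := by
  rw [locallyIntegrable_iff]
  intro k hk
  obtain ⟨r, hr⟩ := hk.isBounded.subset_ball 0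
  refine IntegrableOn.mono_set ?_ hr
  refine ((integrableOn_inv_norm r).const_mul (Real.exp (‖ω‖ * r))).mono'
    (measurable_green ω).aestronglyMeasurable ?_
  filter_upwards [ae_restrict_mem measurableSet_ball] with z hz
  rw [green_eq_profile]
  exact norm_profile_le ω (norm_nonneg _) (by simpa using (mem_ball_zero_iff.1 hz).le)

theorem tendsto_integral_regGreen (ω : ℂ) {q : R3 → ℂ} (hq : Continuous q)
    (hc : HasCompactSupport q) :
    Tendsto (fun ε => ∫ z, regGreen ε ω z * q z) (𝓝[>] 0) (𝓝 (∫ z, green ω z * q z)) := by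
  obtain ⟨r, hr⟩ := hc.isCompact.isBounded.subset_ball 0
  obtain ⟨C, hC⟩ := hc.exists_bound_of_continuous hq
  have hC0 : 0 ≤ C := (norm_nonneg _).trans (hC 0)
  have hε1 : ∀ᶠ ε : ℝ in 𝓝[>] 0, ε ∈ Set.Ioo (0 : ℝ) 1 := Ioo_mem_nhdsGT one_pos
  refine tendsto_integral_filter_of_dominated_convergence
    ((Metric.ball 0 r).indicator fun z : R3 => Real.exp (‖ω‖ * (r + 1)) * C * ‖z‖⁻¹) ?_ ?_ ?_ ?_
  · filter_upwards [hε1] with ε hε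
    exact ((smooth_regGreen hε.1 ω).continuous.mul hq).aestronglyMeasurable
  · filter_upwards [hε1] with ε hε
    have : ∀ᵐ z : R3, z ≠ 0 := by
      rw [ae_iff]
      simp
    filter_upwards [this] with z hz0
    by_cases hz : z ∈ Metric.ball (0 : R3) r
    · rw [Set.indicator_of_mem hz, norm_mul]
      have hz' : ‖z‖ < r := by simpa using hz
      have h1 := norm_profile_le ω (regDist_pos hε.1 z).le
        ((regDist_le hε.1.le z).trans (add_le_add hz'.le hε.2.le))
      have hz0' : 0 < ‖z‖ := norm_pos_iff.2 hz0
      calc _ ≤ Real.exp (‖ω‖ * (r + 1)) * (regDist ε z)⁻¹ * C := by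
            gcongr
            · have := regDist_pos hε.1 z; positivity
            · exact h1
            · exact hC z
        _ ≤ Real.exp (‖ω‖ * (r + 1)) * ‖z‖⁻¹ * C := by
            gcongr
            exact norm_le_regDist ε z
        _ = _ := by ring
    · rw [Set.indicator_of_notMem hz, image_eq_zero_of_notMem_tsupport fun h => hz (hr h)]
      simp
  · exact (integrable_indicator_iff measurableSet_ball).2 ((integrableOn_inv_norm r).const_mul _)
  · have : ∀ᵐ z : R3, z ≠ 0 := by
      rw [ae_iff]
      simp
    filter_upwards [this] with z hz0
    rw [green_eq_profile, ← regDist_zero z]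
    refine Tendsto.mul_const _ ?_
    have h1 : Tendsto (fun ε => regDist ε z) (𝓝[>] 0) (𝓝 (regDist 0 z)) :=
      ((continuous_regDist z).tendsto 0).mono_left nhdsWithin_le_nhds
    exact (continuousAt_profile ω (by simpa [regDist_zero] using hz0)).tendsto.comp h1

/-- The substitution z = εy exhibits an approximate identity: the leading density -3s^{-5}/(4π) no
longer depends on ε, and the other terms carry powers of ε. -/
theorem integral_lap_regGreen {ε : ℝ} (hε : 0 < ε) (ω : ℂ) (ψ : R3 → ℂ) :
    ∫ z, (lap (regGreen ε ω) z + ω ^ 2 * regGreen ε ω z) * ψ z =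
      ∫ y : R3, Complex.exp (Complex.I * ω * (ε * regDist 1 y : ℝ)) *
        (-3 * (regDist 1 y : ℂ)⁻¹ ^ 5 + 3 * Complex.I * ω * ε * (regDist 1 y : ℂ)⁻¹ ^ 4 +
          ω ^ 2 * ε ^ 2 * (regDist 1 y : ℂ)⁻¹ ^ 3) * (4 * Real.pi : ℂ)⁻¹ * ψ (ε • y) := by
  have h := Measure.integral_comp_smul (volume : Measure R3)
    (fun z => (lap (regGreen ε ω) z + ω ^ 2 * regGreen ε ω z) * ψ z) ε
  rw [finrank_euclideanSpace, Fintype.card_fin, abs_of_pos (by positivity)] at h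
  have h2 : ∫ z, (lap (regGreen ε ω) z + ω ^ 2 * regGreen ε ω z) * ψ z =
      (ε ^ 3) • ∫ y : R3, (lap (regGreen ε ω) (ε • y) + ω ^ 2 * regGreen ε ω (ε • y)) *
        ψ (ε • y) := by
    rw [h, smul_smul, mul_inv_cancel₀ (by positivity), one_smul]
  rw [h2, ← integral_smul]
  refine integral_congr_ae (ae_of_all _ fun y => ?_)
  simp only
  rw [lap_regGreen hε, regDist_smul hε, Complex.real_smul]
  have h3 : (ε : ℂ) ≠ 0 := by exact_mod_cast hε.ne'
  have h4 : (regDist 1 y : ℂ) ≠ 0 := by exact_mod_cast (regDist_pos one_pos y).ne'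
  push_cast
  field_simp

theorem one_le_regDist_one (y : R3) : 1 ≤ regDist 1 y :=
  Real.le_sqrt_of_sq_le (by nlinarith [sq_nonneg ‖y‖])

theorem tendsto_integral_lap_regGreen (ω : ℂ) {ψ : R3 → ℂ} (hψ : Continuous ψ)
    (hc : HasCompactSupport ψ) :
    Tendsto (fun ε => ∫ z, (lap (regGreen ε ω) z + ω ^ 2 * regGreen ε ω z) * ψ z) (𝓝[>] 0)
      (𝓝 (-ψ 0)) := by
  obtain ⟨r, hr⟩ := hc.isCompact.isBounded.subset_ball 0
  obtain ⟨C, hC⟩ := hc.exists_bound_of_continuous hψ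
  have hC0 : 0 ≤ C := (norm_nonneg _).trans (hC 0)
  have hε1 : ∀ᶠ ε : ℝ in 𝓝[>] 0, ε ∈ Set.Ioo (0 : ℝ) 1 := Ioo_mem_nhdsGT one_pos
  set M : ℝ := Real.exp (‖ω‖ * (r + 1)) * (3 + 3 * ‖ω‖ * (r + 1) +
    ‖ω‖ ^ 2 * (r + 1) ^ 2) * C with hM
  have hlim : Tendsto (fun ε : ℝ => ∫ y : R3, Complex.exp (Complex.I * ω * (ε * regDist 1 y : ℝ)) *
        (-3 * (regDist 1 y : ℂ)⁻¹ ^ 5 + 3 * Complex.I * ω * ε * (regDist 1 y : ℂ)⁻¹ ^ 4 +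
          ω ^ 2 * ε ^ 2 * (regDist 1 y : ℂ)⁻¹ ^ 3) * (4 * Real.pi : ℂ)⁻¹ * ψ (ε • y)) (𝓝[>] 0)
      (𝓝 (∫ y : R3, -3 * (regDist 1 y : ℂ)⁻¹ ^ 5 * (4 * Real.pi : ℂ)⁻¹ * ψ 0)) := by
    have hcs : Continuous fun y : R3 => (regDist 1 y : ℂ) :=
      Complex.continuous_ofReal.comp (smooth_regDist one_pos).continuous
    have hci : Continuous fun y : R3 => (regDist 1 y : ℂ)⁻¹ :=
      (smooth_inv_regDist one_pos).continuous
    refine tendsto_integral_filter_of_dominated_convergence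
      (fun y : R3 => M * (regDist 1 y)⁻¹ ^ 5) ?_ ?_ (integrable_regDist_one.const_mul _) ?_
    · filter_upwards [hε1] with ε hε
      refine Continuous.aestronglyMeasurable ?_
      push_cast
      fun_prop
    · filter_upwards [hε1] with ε hε
      refine ae_of_all _ fun y => ?_
      by_cases hy : ε • y ∈ Metric.ball (0 : R3) r
      · have hy' : ε * ‖y‖ < r := by
          simpa [norm_smul, abs_of_pos hε.1] using hy
        have hs1 := one_le_regDist_one y
        have hs : ε * regDist 1 y ≤ r + 1 := by
          have := regDist_le zero_le_one y
          nlinarith [hε.1, hε.2]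
        have hr0 : 0 ≤ r + 1 := le_trans (by have := hε.1; positivity) hs
        set s := regDist 1 y with hs_def
        have hs0 : 0 < s := by linarith
        have hpi : (1 : ℝ) ≤ 4 * Real.pi := by linarith [Real.pi_gt_three]
        have a1 := norm_exp_le ω (s := ε * s) (by have := hε.1; positivity) hs
        have a2 : ‖-3 * (s : ℂ)⁻¹ ^ 5 + 3 * Complex.I * ω * ε * (s : ℂ)⁻¹ ^ 4 +
            ω ^ 2 * ε ^ 2 * (s : ℂ)⁻¹ ^ 3‖ ≤
            (3 + 3 * ‖ω‖ * (r + 1) + ‖ω‖ ^ 2 * (r + 1) ^ 2) * s⁻¹ ^ 5 := by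
          refine norm_add₃_le.trans ?_
          simp only [norm_mul, norm_neg, norm_pow, norm_inv, Complex.norm_real, Complex.norm_ofNat,
            Complex.norm_I, Real.norm_of_nonneg hs0.le, Real.norm_of_nonneg hε.1.le, mul_one]
          -- On the support of the test function ε s ≤ r + 1, so the slowly decaying terms are also
          -- dominated by the integrable s^{-5}.
          have e1 : 3 * ‖ω‖ * ε * s⁻¹ ^ 4 = 3 * ‖ω‖ * (ε * s) * s⁻¹ ^ 5 := by field_simp
          have e2 : ‖ω‖ ^ 2 * ε ^ 2 * s⁻¹ ^ 3 = ‖ω‖ ^ 2 * (ε * s) ^ 2 * s⁻¹ ^ 5 := by field_simp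
          rw [e1, e2, add_mul, add_mul]
          have hεs : 0 ≤ ε * s := by have := hε.1; positivity
          gcongr
        have a3 : ‖((4 * Real.pi : ℂ))⁻¹‖ ≤ 1 := by
          rw [norm_inv, norm_mul, Complex.norm_real, Complex.norm_ofNat,
            Real.norm_of_nonneg Real.pi_pos.le]
          exact inv_le_one_of_one_le₀ hpi
        rw [norm_mul, norm_mul, norm_mul]
        calc _ ≤ Real.exp (‖ω‖ * (r + 1)) *
              ((3 + 3 * ‖ω‖ * (r + 1) + ‖ω‖ ^ 2 * (r + 1) ^ 2) * s⁻¹ ^ 5) * 1 * C := by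
              gcongr
              exact hC _
          _ = _ := by rw [hM]; ring
      · rw [image_eq_zero_of_notMem_tsupport fun h => hy (hr h), mul_zero, norm_zero]
        have h1 := (regDist_pos one_pos y).le
        -- The radius may be negative when the support is empty; then M ≥ 0 is seen by completing
        -- the square in ‖ω‖(r + 1).
        by_cases hr0 : 0 ≤ r + 1
        · positivity
        · have : ‖ω‖ * (r + 1) * 3 + ‖ω‖ ^ 2 * (r + 1) ^ 2 + 3 ≥ 0 := by
            nlinarith [sq_nonneg (‖ω‖ * (r + 1) + 3 / 2)]
          have h2 : 0 ≤ M := by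
            rw [hM]
            refine mul_nonneg (mul_nonneg (Real.exp_pos _).le ?_) hC0
            linarith
          positivity
    · refine ae_of_all _ fun y => ?_
      have : Continuous fun ε : ℝ => Complex.exp (Complex.I * ω * (ε * regDist 1 y : ℝ)) *
        (-3 * (regDist 1 y : ℂ)⁻¹ ^ 5 + 3 * Complex.I * ω * ε * (regDist 1 y : ℂ)⁻¹ ^ 4 +
          ω ^ 2 * ε ^ 2 * (regDist 1 y : ℂ)⁻¹ ^ 3) * (4 * Real.pi : ℂ)⁻¹ * ψ (ε • y) := by
        fun_prop
      have h1 := (this.tendsto 0).mono_left (nhdsWithin_le_nhds (s := Set.Ioi 0))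
      simpa using h1
  have hval : ∫ y : R3, -3 * (regDist 1 y : ℂ)⁻¹ ^ 5 * (4 * Real.pi : ℂ)⁻¹ * ψ 0 = -ψ 0 := by
    have h1 : ∫ y : R3, (regDist 1 y : ℂ)⁻¹ ^ 5 = ((4 * Real.pi / 3 : ℝ) : ℂ) := by
      rw [← integral_regDist_one, ← integral_complex_ofReal]
      push_cast
      rfl
    rw [integral_mul_const, integral_mul_const, integral_const_mul, h1]
    have : (Real.pi : ℂ) ≠ 0 := by exact_mod_cast Real.pi_ne_zero
    push_cast
    field_simp
  rw [hval] at hlim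
  refine hlim.congr' ?_
  filter_upwards [hε1] with ε hε
  exact (integral_lap_regGreen hε.1 ω ψ).symm

/-- `G^ω` is a fundamental solution of `-(Δ + ω²)`. -/
theorem integral_green_helmholtz (ω : ℂ) {ψ : R3 → ℂ} (hψ : Smooth ψ) (hc : HasCompactSupport ψ) :
    ∫ z, green ω z * (lap ψ z + ω ^ 2 * ψ z) = -ψ 0 := by
  have hcl : HasCompactSupport (lap ψ) := hc.mono' fun x hx => by
    by_contra h
    exact hx (lap_eq_zero_of_notMem h)
  have hq : HasCompactSupport fun z => lap ψ z + ω ^ 2 * ψ z := hcl.add hc.mul_left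
  have hqc : Continuous fun z => lap ψ z + ω ^ 2 * ψ z :=
    hψ.lap.continuous.add (continuous_const.mul hψ.continuous)
  refine tendsto_nhds_unique (tendsto_integral_regGreen ω hqc hq) ?_
  refine (tendsto_integral_lap_regGreen ω hψ.continuous hc).congr' ?_
  filter_upwards [self_mem_nhdsWithin] with ε hε
  have hG := smooth_regGreen (ε := ε) hε ω
  have h1 := integral_mul_lap hG hψ hc
  have i1 : Integrable fun z => regGreen ε ω z * lap ψ z :=
    integrable_bilin (ContinuousLinearMap.mul ℝ ℂ) hG.continuous hψ.lap.continuous (Or.inr hcl)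
  have i2 : Integrable fun z => lap (regGreen ε ω) z * ψ z :=
    integrable_bilin (ContinuousLinearMap.mul ℝ ℂ) hG.lap.continuous hψ.continuous (Or.inr hc)
  have i3 : Integrable fun z => ω ^ 2 * (regGreen ε ω z * ψ z) :=
    (integrable_bilin (ContinuousLinearMap.mul ℝ ℂ) hG.continuous hψ.continuous
      (Or.inr hc)).const_mul _
  have e1 : ∀ z, (lap (regGreen ε ω) z + ω ^ 2 * regGreen ε ω z) * ψ z =
      lap (regGreen ε ω) z * ψ z + ω ^ 2 * (regGreen ε ω z * ψ z) := fun z => by ring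
  have e2 : ∀ z, regGreen ε ω z * (lap ψ z + ω ^ 2 * ψ z) =
      regGreen ε ω z * lap ψ z + ω ^ 2 * (regGreen ε ω z * ψ z) := fun z => by ring
  simp only [e1, e2]
  rw [integral_add i2 i3, integral_add i1 i3, h1]

/-! ### Volume potentials with values in H²(D) -/

section

/-- The convolution of the Green's function with a function on `ℝ³`. -/
noncomputable def greenConv (ω : ℂ) (ψ : R3 → ℂ) : R3 → ℂ :=
  convolution (green ω) ψ (ContinuousLinearMap.mul ℝ ℂ) volume

theorem greenConv_apply (ω : ℂ) (ψ : R3 → ℂ) (x : R3) :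
    greenConv ω ψ x = ∫ t, green ω t * ψ (x - t) := rfl

theorem greenConv_eq (ω : ℂ) (ψ : R3 → ℂ) (x : R3) :
    greenConv ω ψ x = ∫ y, green ω (x - y) * ψ y := by
  rw [greenConv, convolution_eq_swap]
  rfl

theorem volumePotential_eq_greenConv {D : Set R3} (ω : ℂ) {ψ : R3 → ℂ} (h : ∀ x ∉ D, ψ x = 0)
    (x : R3) : volumePotential D ω ψ x = greenConv ω ψ x := by
  rw [greenConv_eq, volumePotential]
  refine setIntegral_eq_integral_of_forall_compl_eq_zero fun y hy => ?_
  rw [h y hy, mul_zero]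

theorem smooth_greenConv (ω : ℂ) {ψ : R3 → ℂ} (hψ : Smooth ψ) (hc : HasCompactSupport ψ) :
    Smooth (greenConv ω ψ) :=
  hc.contDiff_convolution_right _ (locallyIntegrable_green ω) hψ

theorem pd_greenConv (ω : ℂ) {ψ : R3 → ℂ} (hψ : Smooth ψ) (hc : HasCompactSupport ψ) (i : Fin 3) :
    pd i (greenConv ω ψ) = greenConv ω (pd i ψ) := by
  funext x
  have h1 : ContDiff ℝ 1 ψ := hψ.of_le (by exact_mod_cast le_top)
  have h := hc.hasFDerivAt_convolution_right (ContinuousLinearMap.mul ℝ ℂ)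
    (locallyIntegrable_green ω) h1 x
  rw [pd, greenConv, h.fderiv, convolution_precompR_apply _ (locallyIntegrable_green ω)
    (hc.fderiv ℝ) (h1.continuous_fderiv one_ne_zero)]
  rfl

theorem green_neg (ω : ℂ) (z : R3) : green ω (-z) = green ω z := by
  rw [green, green, norm_neg]

theorem integrable_green_mul (ω : ℂ) {q : R3 → ℂ} (hq : Continuous q) (hc : HasCompactSupport q) :
    Integrable fun z => green ω z * q z := by
  simpa only [smul_eq_mul, mul_comm] using
    (locallyIntegrable_green ω).integrable_smul_left_of_hasCompactSupport hq hc

theorem hasCompactSupport_lap {ψ : R3 → ℂ} (hc : HasCompactSupport ψ) : HasCompactSupport (lap ψ) :=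
  hc.mono' fun x hx => by
    by_contra h
    exact hx (lap_eq_zero_of_notMem h)

theorem lap_comp_add (ψ : R3 → ℂ) (x : R3) :
    lap (fun t => ψ (x + t)) = fun t => lap ψ (x + t) := by
  have h : ∀ (η : R3 → ℂ) i, pd i (fun t => η (x + t)) = fun t => pd i η (x + t) := by
    intro η i
    funext t
    rw [pd, fderiv_comp_add_left]
    rfl
  funext t
  simp only [lap, h]

/-- Derivatives fall on ψ, and the fundamental solution property is applied to the translate ψ(x +
·), using that the Green's function is even. -/
theorem lap_greenConv (ω : ℂ) {ψ : R3 → ℂ} (hψ : Smooth ψ) (hc : HasCompactSupport ψ) (x : R3) :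
    lap (greenConv ω ψ) x = -ψ x - ω ^ 2 * greenConv ω ψ x := by
  have hs : Smooth fun t => ψ (x + t) := hψ.comp (contDiff_const.add contDiff_id)
  have hcs : HasCompactSupport fun t => ψ (x + t) := hc.comp_homeomorph (Homeomorph.addLeft x)
  have hl : HasCompactSupport (lap fun t => ψ (x + t)) := hasCompactSupport_lap hcs
  have hr : ∀ η : R3 → ℂ, greenConv ω η x = ∫ t, green ω t * η (x + t) := by
    intro η
    rw [greenConv_apply, ← integral_neg_eq_self]
    simp only [green_neg, sub_neg_eq_add]
  have h1 := integral_green_helmholtz ω hs hcs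
  have e : ∀ t, green ω t * (lap (fun t => ψ (x + t)) t + ω ^ 2 * ψ (x + t)) =
      green ω t * lap (fun t => ψ (x + t)) t + ω ^ 2 * (green ω t * ψ (x + t)) := fun t => by ring
  simp only [e] at h1
  rw [integral_add (integrable_green_mul ω hs.lap.continuous hl)
    ((integrable_green_mul ω hs.continuous hcs).const_mul _), integral_const_mul, ← hr ψ,
    add_zero] at h1
  have h2 : lap (greenConv ω ψ) x = ∫ t, green ω t * lap (fun t => ψ (x + t)) t := by
    have h3 : ∀ i, pd i (pd i (greenConv ω ψ)) x = ∫ t, green ω t * pd i (pd i ψ) (x + t) := by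
      intro i
      rw [pd_greenConv ω hψ hc, pd_greenConv ω (hψ.pd i) (hasCompactSupport_pd hc i), hr]
    have hi : ∀ i, Integrable fun t => green ω t * pd i (pd i ψ) (x + t) := fun i =>
      integrable_green_mul ω (((hψ.pd i).pd i).continuous.comp (continuous_const.add continuous_id))
        ((hasCompactSupport_pd (hasCompactSupport_pd hc i) i).comp_homeomorph
          (Homeomorph.addLeft x))
    rw [lap_comp_add]
    simp only [lap, h3, Finset.mul_sum]
    rw [integral_finsetSum _ fun i _ => hi i]
  rw [h2]
  linear_combination h1

section Extension

variable {D B : Set R3}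

theorem memLp_indicator (hD : MeasurableSet D) (hDB : D ⊆ B) (f : L2 D) :
    MemLp (D.indicator f) 2 (volume.restrict B) := by
  rw [memLp_indicator_iff_restrict hD, Measure.restrict_restrict_of_subset hDB]
  exact Lp.memLp f

/-- Extension by zero. -/
noncomputable def zeroExt (hD : MeasurableSet D) (hDB : D ⊆ B) : L2 D →L[ℂ] L2 B :=
  LinearMap.mkContinuous
    { toFun := fun f => (memLp_indicator hD hDB f).toLp _
      map_add' := by
        intro f g
        rw [← MemLp.toLp_add]
        refine MemLp.toLp_congr _ _ ?_
        have h : ∀ᵐ x ∂(volume.restrict D), (f + g : L2 D) x = f x + g x := Lp.coeFn_add f g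
        have h2 := ae_restrict_of_ae (s := B) ((ae_restrict_iff' hD).1 h)
        filter_upwards [h2] with x hx
        by_cases hxD : x ∈ D
        · simp only [Pi.add_apply, Set.indicator_of_mem hxD, hx hxD]
        · simp only [Pi.add_apply, Set.indicator_of_notMem hxD, add_zero]
      map_smul' := by
        intro c f
        rw [RingHom.id_apply, ← MemLp.toLp_const_smul]
        refine MemLp.toLp_congr _ _ ?_
        have h : ∀ᵐ x ∂(volume.restrict D), (c • f : L2 D) x = c • f x := Lp.coeFn_smul c f
        have h2 := ae_restrict_of_ae (s := B) ((ae_restrict_iff' hD).1 h)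
        filter_upwards [h2] with x hx
        by_cases hxD : x ∈ D
        · simp only [Pi.smul_apply, Set.indicator_of_mem hxD, hx hxD]
        · simp only [Pi.smul_apply, Set.indicator_of_notMem hxD, smul_zero] }
    1 (by
      intro f
      rw [one_mul]
      simp only [LinearMap.coe_mk, AddHom.coe_mk]
      rw [Lp.norm_toLp, eLpNorm_indicator_eq_eLpNorm_restrict hD,
        Measure.restrict_restrict_of_subset hDB, Lp.norm_def])

theorem coeFn_zeroExt (hD : MeasurableSet D) (hDB : D ⊆ B) (f : L2 D) :
    zeroExt hD hDB f =ᵐ[volume.restrict B] D.indicator f :=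
  (memLp_indicator hD hDB f).coeFn_toLp

end Extension

variable {D : Set R3} [IsFiniteMeasure (volume.restrict D)]

/-- The volume potentials as operators from `L²(D)` to `H²(D)`, holomorphic in the frequency. -/
theorem exists_potential (hD : IsOpen D) {r : ℝ} (hr0 : 0 < r) (hr : D ⊆ Metric.ball 0 r) :
    ∃ pot : ℂ → L2 D →L[ℂ] H2 D, Differentiable ℂ pot ∧
      (∀ ω f, toL2Map D (pot ω f) = radialOpTwo D D (truncExp (2 * r + 4) ω) f) ∧
      ∀ ω f, lapL2Map D (pot ω f) = -f - ω ^ 2 • toL2Map D (pot ω f) := by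
  set B := Metric.ball (0 : R3) (r + 4) with hB
  obtain ⟨T, hT⟩ : ∃ T : WithLp 2 (L2 B × L2 B) →L[ℂ] H2 D, ∀ v : smoothFunctions,
      T (WithLp.toLp 2 (smoothToL2 measurableSet_ball subset_rfl v,
        smoothToL2 measurableSet_ball subset_rfl (lapMap v))) = smoothJet hD.measurableSet hr v :=
    exists_interior_regularity hD hr0 hr
  have hDB : D ⊆ B := hr.trans (Metric.ball_subset_ball (by linarith))
  set K : ℂ → L2 D →L[ℂ] L2 B := fun ω => radialOpTwo D B (truncExp (2 * r + 4) ω) with hK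
  let J : (L2 B × L2 B) →L[ℂ] WithLp 2 (L2 B × L2 B) :=
    ((WithLp.prodContinuousLinearEquiv 2 ℂ (L2 B) (L2 B)).symm : _ →L[ℂ] _)
  let J₁ : L2 B →L[ℂ] WithLp 2 (L2 B × L2 B) := J ∘L ContinuousLinearMap.inl ℂ (L2 B) (L2 B)
  let J₂ : L2 B →L[ℂ] WithLp 2 (L2 B × L2 B) := J ∘L ContinuousLinearMap.inr ℂ (L2 B) (L2 B)
  -- The potential and its expected Laplacian -f - ω²K^ω f on the larger ball are fed into the fixed
  -- regularity operator T; the dependence on ω is then visibly holomorphic.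
  let pot : ℂ → L2 D →L[ℂ] H2 D := fun ω =>
    T ∘L (J₁ ∘L K ω + J₂ ∘L (-zeroExt hD.measurableSet hDB - ω ^ 2 • K ω))
  have hKd : Differentiable ℂ K := by
    have h1 : Differentiable ℂ (truncExp (2 * r + 4)) := fun ω =>
      (hasDerivAt_truncExp _ ω).differentiableAt
    exact (differentiable_const _).clm_comp ((radialOp D B).differentiable.comp h1)
  have hpd : Differentiable ℂ pot := by
    refine (differentiable_const _).clm_comp (((differentiable_const _).clm_comp hKd).add
      ((differentiable_const _).clm_comp ((differentiable_const _).sub ?_)))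
    exact (differentiable_id.pow 2).smul hKd
  -- For test functions the potential is a genuine smooth function, so T acts on a pair (v, Δv) and
  -- returns its jet. The two claimed identities are closed linear conditions on f and extend by
  -- density.
  have key : ∀ (ω : ℂ) (ψ : R3 → ℝ) (hψ : Smooth ψ), HasCompactSupport ψ → tsupport ψ ⊆ D →
      ∃ v : smoothFunctions, (∀ x ∈ B, radialPotential D (truncExp (2 * r + 4) ω)
          (testVec hD.measurableSet hr hψ) x = (v : R3 → ℂ) x) ∧
        (∀ x, lap (v : R3 → ℂ) x = -(ψ x : ℂ) - ω ^ 2 * (v : R3 → ℂ) x) ∧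
        pot ω (testVec hD.measurableSet hr hψ) = smoothJet hD.measurableSet hr v := by
    intro ω ψ hψ hc hs
    have hψC : Smooth fun x => (ψ x : ℂ) := Complex.ofRealCLM.contDiff.comp hψ
    have hcC : HasCompactSupport fun x => (ψ x : ℂ) := hc.comp_left (g := Complex.ofReal) rfl
    have hz : ∀ x ∉ D, (ψ x : ℂ) = 0 := fun x hx => by
      rw [image_eq_zero_of_notMem_tsupport fun h => hx (hs h), Complex.ofReal_zero]
    have hae : testVec hD.measurableSet hr hψ =ᵐ[volume.restrict D] fun x => (ψ x : ℂ) :=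
      coeFn_smoothToL2 hD.measurableSet hr ⟨fun x => (ψ x : ℂ), hψC⟩
    let v : smoothFunctions := ⟨greenConv ω fun x => (ψ x : ℂ), smooth_greenConv ω hψC hcC⟩
    have hv1 : ∀ x ∈ B, radialPotential D (truncExp (2 * r + 4) ω)
        (testVec hD.measurableSet hr hψ) x = (v : R3 → ℂ) x := by
      intro x hx
      rw [radialPotential_congr (g := fun x => (ψ x : ℂ)) hae,
        radialPotential_truncExp ω hD.measurableSet, volumePotential_eq_greenConv ω hz]
      intro y hy
      have h1 := mem_ball_zero_iff.1 hx
      have h2 := mem_ball_zero_iff.1 (hr hy)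
      linarith [norm_sub_le x y]
    have hv2 : ∀ x, lap (v : R3 → ℂ) x = -(ψ x : ℂ) - ω ^ 2 * (v : R3 → ℂ) x := fun x =>
      lap_greenConv ω hψC hcC x
    refine ⟨v, hv1, hv2, ?_⟩
    have e1 : K ω (testVec hD.measurableSet hr hψ) =
        smoothToL2 measurableSet_ball subset_rfl v := by
      refine Lp.ext ?_
      filter_upwards [coeFn_radialOpTwo (B := B) (truncExp (2 * r + 4) ω)
        (testVec hD.measurableSet hr hψ), coeFn_smoothToL2 measurableSet_ball subset_rfl v,
        ae_restrict_mem (measurableSet_ball : MeasurableSet B)] with x h1 h2 h3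
      rw [h1, h2, hv1 x h3]
    have e2 : (-zeroExt hD.measurableSet hDB - ω ^ 2 • K ω) (testVec hD.measurableSet hr hψ) =
        smoothToL2 measurableSet_ball subset_rfl (lapMap v) := by
      have e3 : (-zeroExt hD.measurableSet hDB - ω ^ 2 • K ω) (testVec hD.measurableSet hr hψ) =
          -zeroExt hD.measurableSet hDB (testVec hD.measurableSet hr hψ) -
          ω ^ 2 • smoothToL2 measurableSet_ball subset_rfl v := by
        rw [← e1]
        rfl
      rw [e3]
      refine Lp.ext ?_
      have h0 : ∀ᵐ x ∂(volume.restrict B), x ∈ D →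
          testVec hD.measurableSet hr hψ x = (ψ x : ℂ) :=
        ae_restrict_of_ae (s := B) ((ae_restrict_iff' hD.measurableSet).1 hae)
      filter_upwards [h0, coeFn_zeroExt hD.measurableSet hDB (testVec hD.measurableSet hr hψ),
        coeFn_smoothToL2 (D := B) measurableSet_ball subset_rfl v,
        coeFn_smoothToL2 (D := B) measurableSet_ball subset_rfl (lapMap v),
        Lp.coeFn_sub (-zeroExt hD.measurableSet hDB (testVec hD.measurableSet hr hψ))
          (ω ^ 2 • smoothToL2 (D := B) measurableSet_ball subset_rfl v),
        Lp.coeFn_neg (zeroExt hD.measurableSet hDB (testVec hD.measurableSet hr hψ)),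
        Lp.coeFn_smul (ω ^ 2) (smoothToL2 (D := B) measurableSet_ball subset_rfl v)]
        with x h1 h2 h3 h4 h5 h6 h7
      rw [h5, Pi.sub_apply, h6, Pi.neg_apply, h7, Pi.smul_apply, h2, h3, h4, smul_eq_mul]
      have h8 : ((lapMap v : smoothFunctions) : R3 → ℂ) x = lap (v : R3 → ℂ) x := rfl
      rw [h8, hv2]
      by_cases hxD : x ∈ D
      · rw [Set.indicator_of_mem hxD, h1 hxD]
      · rw [Set.indicator_of_notMem hxD, hz x hxD]
    have e4 : pot ω (testVec hD.measurableSet hr hψ) =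
        T (J₁ (K ω (testVec hD.measurableSet hr hψ)) +
          J₂ ((-zeroExt hD.measurableSet hDB - ω ^ 2 • K ω) (testVec hD.measurableSet hr hψ))) :=
      rfl
    rw [e4, e1, e2, ← hT v]
    congr 1
    have e5 : ∀ a b : L2 B, J₁ a + J₂ b = WithLp.toLp 2 (a, b) := by
      intro a b
      change WithLp.toLp 2 ((a, 0) + (0, b)) = _
      rw [Prod.mk_add_mk, add_zero, zero_add]
    exact e5 _ _
  refine ⟨pot, hpd, fun ω f => ?_, fun ω f => ?_⟩
  · have h1 : LinearMap.ker (toL2Map D ∘L pot ω - radialOpTwo D D (truncExp (2 * r + 4) ω) :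
        L2 D →L[ℂ] L2 D).toLinearMap = ⊤ := by
      refine dense_test_functions hD hr (ContinuousLinearMap.isClosed_ker _) fun ψ hψ hc hs => ?_
      obtain ⟨v, hv1, -, hv3⟩ := key ω ψ hψ hc hs
      rw [LinearMap.mem_ker]
      change toL2Map D (pot ω (testVec hD.measurableSet hr hψ)) -
        radialOpTwo D D (truncExp (2 * r + 4) ω) (testVec hD.measurableSet hr hψ) = 0
      rw [hv3, toL2Map_smoothJet, sub_eq_zero]
      refine Lp.ext ?_
      filter_upwards [coeFn_radialOpTwo (B := D) (truncExp (2 * r + 4) ω)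
        (testVec hD.measurableSet hr hψ), coeFn_smoothToL2 hD.measurableSet hr v,
        ae_restrict_mem hD.measurableSet] with x h1 h2 h3
      rw [h1, h2, hv1 x (hDB h3)]
    have h2 : f ∈ LinearMap.ker (toL2Map D ∘L pot ω - radialOpTwo D D (truncExp (2 * r + 4) ω) :
        L2 D →L[ℂ] L2 D).toLinearMap := h1 ▸ Submodule.mem_top
    exact sub_eq_zero.1 (LinearMap.mem_ker.1 h2)
  · have h1 : LinearMap.ker (lapL2Map D ∘L pot ω + ContinuousLinearMap.id ℂ (L2 D) +
        ω ^ 2 • (toL2Map D ∘L pot ω) : L2 D →L[ℂ] L2 D).toLinearMap = ⊤ := by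
      refine dense_test_functions hD hr (ContinuousLinearMap.isClosed_ker _) fun ψ hψ hc hs => ?_
      obtain ⟨v, -, hv2, hv3⟩ := key ω ψ hψ hc hs
      rw [LinearMap.mem_ker]
      change lapL2Map D (pot ω (testVec hD.measurableSet hr hψ)) +
        testVec hD.measurableSet hr hψ +
        ω ^ 2 • toL2Map D (pot ω (testVec hD.measurableSet hr hψ)) = 0
      rw [hv3, toL2Map_smoothJet, lapL2Map_smoothJet, testVec, ← map_smul, ← map_add, ← map_add]
      convert map_zero (smoothToL2 hD.measurableSet hr) using 2
      refine Subtype.ext (funext fun x => ?_)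
      change lap (v : R3 → ℂ) x + (ψ x : ℂ) + ω ^ 2 * (v : R3 → ℂ) x = 0
      rw [hv2]
      ring
    have h2 : f ∈ LinearMap.ker (lapL2Map D ∘L pot ω + ContinuousLinearMap.id ℂ (L2 D) +
        ω ^ 2 • (toL2Map D ∘L pot ω) : L2 D →L[ℂ] L2 D).toLinearMap := h1 ▸ Submodule.mem_top
    have h3 : lapL2Map D (pot ω f) + f + ω ^ 2 • toL2Map D (pot ω f) = 0 := LinearMap.mem_ker.1 h2
    rw [← sub_eq_zero, ← h3]
    abel

end

/-! ### Positivity of the Newtonian potential -/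

section

theorem norm_green_zero_le (z : R3) : ‖green 0 z‖ ≤ ‖z‖⁻¹ := by
  have h := norm_profile_le 0 (norm_nonneg z) le_rfl
  rwa [norm_zero, zero_mul, Real.exp_zero, one_mul, ← green_eq_profile] at h

theorem norm_greenConv_zero_le {ψ : R3 → ℂ} (hψ : Continuous ψ) (hc : HasCompactSupport ψ)
    {r : ℝ} (hr : tsupport ψ ⊆ Metric.ball 0 r) {R : ℝ} (hR0 : 0 < R) (hR : 2 * r ≤ R) {x : R3}
    (hx : R ≤ ‖x‖) : ‖greenConv 0 ψ x‖ ≤ 2 * R⁻¹ * ∫ y, ‖ψ y‖ := by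
  rw [greenConv_eq, ← integral_const_mul]
  refine norm_integral_le_of_norm_le
    ((hψ.integrable_of_hasCompactSupport hc).norm.const_mul _) (ae_of_all _ fun y => ?_)
  rw [norm_mul]
  by_cases hy : y ∈ tsupport ψ
  · have h1 := mem_ball_zero_iff.1 (hr hy)
    have h2 : R / 2 ≤ ‖x - y‖ := by linarith [norm_sub_norm_le x y]
    gcongr
    refine (norm_green_zero_le _).trans ?_
    calc ‖x - y‖⁻¹ ≤ (R / 2)⁻¹ := by gcongr
      _ = 2 * R⁻¹ := by rw [inv_div, div_eq_mul_inv]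
  · rw [image_eq_zero_of_notMem_tsupport hy]
    simp

theorem pd_comp_smul (χ : R3 → ℝ) (c : ℝ) (i : Fin 3) (x : R3) :
    pd i (fun x => χ (c • x)) x = c * pd i χ (c • x) := by
  rw [pd, fderiv_comp_smul]
  rfl

/-- Positivity of the Newtonian energy. -/
theorem newton_energy_nonneg {ψ : R3 → ℂ} (hψ : Smooth ψ) (hc : HasCompactSupport ψ) :
    0 ≤ ∫ x, inner ℝ (greenConv 0 ψ x) (ψ x) := by
  obtain ⟨r, hr⟩ := hc.isCompact.isBounded.subset_ball 0
  obtain ⟨χ, hχ, hcχ, h1, -, -⟩ := exists_cutoff (r := 1) one_pos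
  set v := greenConv 0 ψ with hv
  have hvs : Smooth v := smooth_greenConv 0 hψ hc
  set g : R3 → ℝ := fun x => ∑ i, pd i χ x ^ 2 with hg
  have hgc : Continuous g := continuous_finsetSum _ fun i _ => (hχ.pd i).continuous.pow 2
  have hg0 : ∀ x, 0 ≤ g x := fun x => Finset.sum_nonneg fun i _ => sq_nonneg _
  have hgs : HasCompactSupport g := hcχ.mono' fun x hx => by
    by_contra h
    exact hx (Finset.sum_eq_zero fun i _ => by simp [pd_eq_zero_of_notMem h i])
  have hgi : Integrable g := hgc.integrable_of_hasCompactSupport hgs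
  have hg1 : ∀ x ∈ Metric.ball (0 : R3) 1, g x = 0 := by
    intro x hx
    refine Finset.sum_eq_zero fun i _ => ?_
    have h2 : χ =ᶠ[𝓝 x] fun _ => (1 : ℝ) := by
      filter_upwards [Metric.isOpen_ball.mem_nhds hx] with y hy
      exact h1 y hy
    rw [(pd_eq_of_eventuallyEq h2 i).eq_of_nhds]
    simp [pd]
  set A := ∫ y, ‖ψ y‖ with hA
  set Q := ∫ x, inner ℝ (v x) (ψ x) with hQ
  -- The energy identity for v with a cutoff at scale R: the gradient term is nonnegative. The error
  -- is of size R^{-2} · R^{-2} · R³ = R^{-1}, from the squared gradient of the cutoff, the square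
  -- of v = O(1/R), and the volume.
  have key : ∀ᶠ R : ℝ in atTop, -(4 * A ^ 2 * ∫ x, g x) * R⁻¹ ≤ Q := by
    filter_upwards [eventually_gt_atTop 0, eventually_ge_atTop (2 * r)] with R hR0 hR
    have hsR : Smooth fun x : R3 => χ (R⁻¹ • x) := hχ.comp (contDiff_const_smul _)
    have hcR : HasCompactSupport fun x : R3 => χ (R⁻¹ • x) :=
      hcχ.comp_homeomorph (Homeomorph.smulOfNeZero R⁻¹ (inv_ne_zero hR0.ne'))
    have h3 := sum_integral_normSq_pd_smul hsR hvs hcR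
    have h4 : 0 ≤ ∑ i, ∫ x, ‖pd i (fun x => χ (R⁻¹ • x) • v x) x‖ ^ 2 :=
      Finset.sum_nonneg fun i _ => integral_nonneg fun x => by positivity
    have h5 : ∫ x, χ (R⁻¹ • x) ^ 2 * inner ℝ (v x) (lap v x) = -Q := by
      rw [hQ, ← integral_neg]
      refine integral_congr_ae (ae_of_all _ fun x => ?_)
      simp only
      rw [hv, lap_greenConv 0 hψ hc]
      have e : -ψ x - 0 ^ 2 * greenConv 0 ψ x = -ψ x := by ring
      rw [e, inner_neg_right]
      by_cases hx : x ∈ tsupport ψ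
      · have h6 := mem_ball_zero_iff.1 (hr hx)
        rw [h1 (R⁻¹ • x), one_pow, one_mul]
        rw [mem_ball_zero_iff, norm_smul, norm_inv, Real.norm_of_nonneg hR0.le,
          inv_mul_lt_iff₀ hR0]
        linarith
      · rw [image_eq_zero_of_notMem_tsupport hx]
        simp
    have h6 : ∀ x, ∑ i, pd i (fun x => χ (R⁻¹ • x)) x ^ 2 = R⁻¹ ^ 2 * g (R⁻¹ • x) := by
      intro x
      simp only [pd_comp_smul, mul_pow, hg, Finset.mul_sum]
    have h7 : ∫ x, (∑ i, pd i (fun x => χ (R⁻¹ • x)) x ^ 2) * ‖v x‖ ^ 2 ≤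
        4 * A ^ 2 * (∫ x, g x) * R⁻¹ := by
      have h8 : Integrable fun x : R3 => g (R⁻¹ • x) :=
        hgi.comp_smul (inv_ne_zero hR0.ne')
      calc _ ≤ ∫ x, R⁻¹ ^ 2 * (2 * R⁻¹ * A) ^ 2 * g (R⁻¹ • x) := by
            refine integral_mono_of_nonneg (ae_of_all _ fun x => ?_) (h8.const_mul _)
              (ae_of_all _ fun x => ?_)
            · have := hg0 (R⁻¹ • x)
              simp only [h6, Pi.zero_apply]
              positivity
            · simp only [h6]
              by_cases hx : R⁻¹ • x ∈ Metric.ball (0 : R3) 1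
              · simp [hg1 _ hx]
              · have hx' : R ≤ ‖x‖ := by
                  rw [mem_ball_zero_iff, norm_smul, norm_inv, Real.norm_of_nonneg hR0.le,
                    inv_mul_lt_iff₀ hR0, not_lt, mul_one] at hx
                  exact hx
                have h9 := norm_greenConv_zero_le hψ.continuous hc hr hR0 hR hx'
                have := hg0 (R⁻¹ • x)
                calc R⁻¹ ^ 2 * g (R⁻¹ • x) * ‖v x‖ ^ 2
                    ≤ R⁻¹ ^ 2 * g (R⁻¹ • x) * (2 * R⁻¹ * A) ^ 2 := by gcongr
                  _ = _ := by ring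
        _ = _ := by
            rw [integral_const_mul, Measure.integral_comp_inv_smul, finrank_euclideanSpace,
              Fintype.card_fin, abs_of_pos (by positivity), smul_eq_mul]
            field_simp
            ring
    rw [h5] at h3
    linarith
  have hlim : Tendsto (fun R : ℝ => -(4 * A ^ 2 * ∫ x, g x) * R⁻¹) atTop (𝓝 0) := by
    have := (tendsto_inv_atTop_zero (𝕜 := ℝ)).const_mul (-(4 * A ^ 2 * ∫ x, g x))
    rwa [mul_zero] at this
  exact le_of_tendsto hlim key

variable {D : Set R3} [IsFiniteMeasure (volume.restrict D)]

/-- The space of complex test functions, as a subspace of `L²(D)`. -/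
noncomputable def testSpace (hD : MeasurableSet D) {r : ℝ} (hr : D ⊆ Metric.ball 0 r) :
    Submodule ℂ (L2 D) where
  carrier := {f | ∃ v : smoothFunctions, HasCompactSupport (v : R3 → ℂ) ∧
    tsupport (v : R3 → ℂ) ⊆ D ∧ smoothToL2 hD hr v = f}
  zero_mem' := ⟨0, by
    change HasCompactSupport (0 : R3 → ℂ)
    exact HasCompactSupport.zero, by
    change tsupport (0 : R3 → ℂ) ⊆ D
    simp, map_zero _⟩
  add_mem' := by
    rintro _ _ ⟨v, hv, hv2, rfl⟩ ⟨w, hw, hw2, rfl⟩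
    exact ⟨v + w, hv.add hw, (tsupport_add _ _).trans (Set.union_subset hv2 hw2), map_add _ _ _⟩
  smul_mem' := by
    rintro c _ ⟨v, hv, hv2, rfl⟩
    exact ⟨c • v, hv.smul_left (f := fun _ => c),
      (tsupport_smul_subset_right (fun _ => c) _).trans hv2, map_smul _ _ _⟩

/-- Nonnegativity of a quadratic form is a closed condition but not a linear one, so it has to be
checked on a dense set of complex test functions rather than on real generators. -/
theorem dense_testSpace (hD : IsOpen D) {r : ℝ} (hr : D ⊆ Metric.ball 0 r) :
    (testSpace hD.measurableSet hr).topologicalClosure = ⊤ := by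
  refine dense_test_functions hD hr (Submodule.isClosed_topologicalClosure _)
    fun ψ hψ hc hs => Submodule.le_topologicalClosure _ ?_
  refine ⟨⟨fun x => (ψ x : ℂ), Complex.ofRealCLM.contDiff.comp hψ⟩,
    hc.comp_left (g := Complex.ofReal) rfl, ?_, rfl⟩
  refine (closure_mono ?_).trans hs
  intro x hx h
  exact hx (by simp [h])

theorem re_inner_newton_nonneg (hD : IsOpen D) {r : ℝ} (hr : D ⊆ Metric.ball 0 r) (f : L2 D) :
    0 ≤ (inner ℂ f (radialOpTwo D D 1 f) : ℂ).re := by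
  have hcl : IsClosed {f : L2 D | 0 ≤ (inner ℂ f (radialOpTwo D D 1 f) : ℂ).re} :=
    isClosed_le continuous_const (Complex.continuous_re.comp
      (continuous_id.inner (radialOpTwo D D 1).continuous))
  have hsub : (testSpace hD.measurableSet hr : Set (L2 D)) ⊆
      {f : L2 D | 0 ≤ (inner ℂ f (radialOpTwo D D 1 f) : ℂ).re} := by
    rintro _ ⟨v, hc, hs, rfl⟩
    change 0 ≤ (inner ℂ _ _ : ℂ).re
    have hz : ∀ x ∉ D, (v : R3 → ℂ) x = 0 := fun x hx =>
      image_eq_zero_of_notMem_tsupport fun h => hx (hs h)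
    have hae := coeFn_smoothToL2 hD.measurableSet hr v
    have h1 : (inner ℂ (smoothToL2 hD.measurableSet hr v)
        (radialOpTwo D D 1 (smoothToL2 hD.measurableSet hr v)) : ℂ) =
        ∫ x in D, conj ((v : R3 → ℂ) x) * greenConv 0 v x := by
      rw [L2.inner_def]
      refine integral_congr_ae ?_
      filter_upwards [hae, coeFn_radialOpTwo (B := D) 1 (smoothToL2 hD.measurableSet hr v),
        ae_restrict_mem hD.measurableSet] with x h1 h2 h3
      rw [h2, h1, RCLike.inner_apply, mul_comm, radialPotential_congr hae,
        ← truncExp_zero (2 * r), radialPotential_truncExp 0 hD.measurableSet,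
        volumePotential_eq_greenConv 0 hz]
      intro y hy
      have h4 := mem_ball_zero_iff.1 (hr h3)
      have h5 := mem_ball_zero_iff.1 (hr hy)
      linarith [norm_sub_le x y]
    have h2 : ∫ x in D, conj ((v : R3 → ℂ) x) * greenConv 0 v x =
        ∫ x, conj ((v : R3 → ℂ) x) * greenConv 0 v x :=
      setIntegral_eq_integral_of_forall_compl_eq_zero fun x hx => by rw [hz x hx]; simp
    have hi : Integrable fun x => conj ((v : R3 → ℂ) x) * greenConv 0 v x := by
      refine Continuous.integrable_of_hasCompactSupport ?_ ?_
      · exact (Complex.continuous_conj.comp (smooth_coe v).continuous).mul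
          (smooth_greenConv 0 (smooth_coe v) hc).continuous
      · exact hc.mono fun x hx h0 => hx (by simp [h0])
    have h3 := newton_energy_nonneg (smooth_coe v) hc
    rw [h1, h2]
    have h4 := Complex.reCLM.integral_comp_comm hi
    rw [Complex.reCLM_apply] at h4
    rw [← h4]
    refine h3.trans_eq (integral_congr_ae (ae_of_all _ fun x => ?_))
    simp only [Complex.reCLM_apply, Complex.inner, Complex.mul_re, Complex.conj_re,
      Complex.conj_im]
    ring
  have h : f ∈ (testSpace hD.measurableSet hr).topologicalClosure :=
    dense_testSpace hD hr ▸ Submodule.mem_top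
  exact closure_minimal hsub hcl h

end

/-! ### The cavity model of a bounded domain -/

section

variable {D : Set R3} [IsFiniteMeasure (volume.restrict D)]

theorem isNewtonianEigen_iff {lam : ℝ} {f : L2 D} :
    IsNewtonianEigen D lam f ↔ radialOpTwo D D 1 f = (lam : ℂ) • f := by
  have h1 := coeFn_radialOpTwo (B := D) 1 f
  have h2 := Lp.coeFn_smul (lam : ℂ) f
  rw [radialPotential_one] at h1
  constructor
  · intro h
    refine Lp.ext ?_
    filter_upwards [h, h1, h2] with x hx h1 h2
    rw [h1, h2, hx]
    rfl
  · intro h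
    filter_upwards [h1, h2] with x h1 h2
    rw [← h1, h, h2]
    rfl

/-- At ω = 0 the differentiated kernel is the constant i/(4π), so the double integral factors into
∫φ and its conjugate. -/
theorem hasDerivAt_inner_radialOpTwo (hD : MeasurableSet D) {L : ℝ}
    (hL : ∀ x ∈ D, ∀ y ∈ D, ‖x - y‖ ≤ L) (φ : L2 D) :
    HasDerivAt (fun ω => inner ℂ φ (radialOpTwo D D (truncExp L ω) φ))
      (Complex.I / (4 * Real.pi) * ((‖∫ x in D, φ x‖ ^ 2 : ℝ) : ℂ)) 0 := by
  let Λ : (ℝ →ᵇ ℂ) →L[ℂ] ℂ :=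
    innerSL ℂ φ ∘L topToTwo (volume.restrict D) ∘L (radialOp D D).flip φ
  have h1 := Λ.hasFDerivAt.comp_hasDerivAt (0 : ℂ) (hasDerivAt_truncExp L 0)
  rw [truncExp_zero, one_mul] at h1
  refine h1.congr_deriv ?_
  change inner ℂ φ (radialOpTwo D D (truncLength L) φ) = _
  have h2 : inner ℂ φ (radialOpTwo D D (truncLength L) φ) =
      ∫ x in D, (Complex.I / (4 * Real.pi) * ∫ y in D, φ y) * conj (φ x) := by
    rw [L2.inner_def]
    refine integral_congr_ae ?_
    filter_upwards [coeFn_radialOpTwo (B := D) (truncLength L) φ, ae_restrict_mem hD] with x h3 h4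
    rw [h3, radialPotential_truncLength hD (hL x h4), RCLike.inner_apply]
  rw [h2, integral_const_mul, integral_conj, mul_assoc, Complex.mul_conj,
    Complex.normSq_eq_norm_sq]

theorem exists_cavityModel (hD : IsOpen D) {r : ℝ} (hr0 : 0 < r) (hr : D ⊆ Metric.ball 0 r)
    {lam : ℝ} {φ : L2 D} (hφ : IsSimpleNewtonianEigenpair D lam φ) :
    ∃ Q : CavityModel (L2 D) (Lp ℂ ∞ (volume.restrict D)) (H2 D),
      Q.lam = lam ∧ Q.φ = φ ∧ Q.ι = toL2Map D ∧
      (∀ ω f, Q.ι (Q.pot ω f) =ᵐ[volume.restrict D] volumePotential D ω f) ∧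
      (∀ ω f, Q.potX ω f =ᵐ[volume.restrict D] volumePotential D ω f) ∧
      (∀ z, Q.cubic z =ᵐ[volume.restrict D] fun x => (‖z x‖ : ℂ) ^ 2 * z x) ∧
      Q.m = Complex.I / (4 * Real.pi) * ((‖∫ x in D, φ x‖ ^ 2 : ℝ) : ℂ) := by
  obtain ⟨hφ1, hφ2, hφ3⟩ := hφ
  obtain ⟨pot, hpd, hpot, hlap⟩ := exists_potential hD hr0 hr
  set L := 2 * r + 4 with hLdef
  have hL : ∀ x ∈ D, ∀ y ∈ D, ‖x - y‖ ≤ L := fun x hx y hy => by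
    have h1 := mem_ball_zero_iff.1 (hr hx)
    have h2 := mem_ball_zero_iff.1 (hr hy)
    linarith [norm_sub_le x y]
  have hpot0 : ∀ f, toL2Map D (pot 0 f) = radialOpTwo D D 1 f := fun f => by
    rw [hpot, truncExp_zero]
  have heig : radialOpTwo D D 1 φ = (lam : ℂ) • φ := isNewtonianEigen_iff.1 hφ2
  have hinner : ∀ f, inner ℂ φ (radialOpTwo D D 1 f) = (lam : ℂ) * inner ℂ φ f := fun f => by
    rw [inner_radialOpTwo_symm 1 (fun r => by simp), heig, inner_smul_left, Complex.conj_ofReal]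
  have hφφ : inner ℂ φ φ = (1 : ℂ) := by rw [inner_self_eq_norm_sq_to_K, hφ1]; simp
  have hlam0 : 0 ≤ lam := by
    have := re_inner_newton_nonneg hD hr φ
    rwa [hinner, hφφ, mul_one, Complex.ofReal_re] at this
  -- The Newtonian potential is injective because -Δ recovers the source.
  have hlam1 : lam ≠ 0 := by
    rintro rfl
    have h1 : toL2Map D (pot 0 φ) = 0 := by rw [hpot0, heig, Complex.ofReal_zero, zero_smul]
    have h2 : pot 0 φ = 0 := injective_toL2Map hD (by rw [h1, map_zero])
    have h3 := hlap 0 φ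
    rw [h1, h2, map_zero, smul_zero, sub_zero, eq_comm, neg_eq_zero] at h3
    rw [h3, norm_zero] at hφ1
    exact zero_ne_one hφ1
  have hlamC : (lam : ℂ) ≠ 0 := by exact_mod_cast hlam1
  obtain ⟨S, hS⟩ := exists_shifted_equiv (isCompactOperator_radialOpTwo 1) hlamC hφ1 hinner
    fun f hf => hφ3 f (isNewtonianEigen_iff.2 hf)
  have hXd : Differentiable ℂ fun ω => radialOp D D (truncExp L ω) :=
    (radialOp D D).differentiable.comp fun ω => (hasDerivAt_truncExp L ω).differentiableAt
  let Q : CavityModel (L2 D) (Lp ℂ ∞ (volume.restrict D)) (H2 D) :=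
    { pot := pot
      potX := fun ω => radialOp D D (truncExp L ω)
      ι := toL2Map D
      M := topMul _
      N := topMulTwo _
      C := topConj _
      lam := lam
      φ := φ
      S := S
      m := Complex.I / (4 * Real.pi) * ((‖∫ x in D, φ x‖ ^ 2 : ℝ) : ℂ)
      c := ‖lapL2Map D‖ + ‖toL2Map D‖
      pot_diff := hpd
      potX_diff := hXd
      ι_inj := injective_toL2Map hD
      norm_C := norm_topConj _
      norm_le := by
        intro ω f hω
        -- The Helmholtz equation bounds the source by the H² norm of its potential, uniformly for
        -- |ω| ≤ 1.
        have h1 : f = -(lapL2Map D (pot ω f)) - ω ^ 2 • toL2Map D (pot ω f) := by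
          rw [hlap]; abel
        calc ‖f‖ = ‖-(lapL2Map D (pot ω f)) - ω ^ 2 • toL2Map D (pot ω f)‖ := congrArg _ h1
          _ ≤ ‖lapL2Map D (pot ω f)‖ + ‖ω‖ ^ 2 * ‖toL2Map D (pot ω f)‖ := by
              refine (norm_sub_le _ _).trans ?_
              rw [norm_neg, norm_smul, norm_pow]
          _ ≤ ‖lapL2Map D‖ * ‖pot ω f‖ + 1 * (‖toL2Map D‖ * ‖pot ω f‖) := by
              gcongr
              · exact (lapL2Map D).le_opNorm _
              · exact pow_le_one₀ (norm_nonneg _) hω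
              · exact (toL2Map D).le_opNorm _
          _ = _ := by ring
      lam_pos := lt_of_le_of_ne hlam0 hlam1.symm
      norm_φ := hφ1
      eigen := by rw [hpot0, heig]
      inner_pot := fun f => by rw [hpot0, hinner]
      S_apply := fun f => by rw [hS, hpot0]
      deriv_pot := by
        simp only [hpot]
        exact hasDerivAt_inner_radialOpTwo hD.measurableSet hL φ }
  have hvol : ∀ (ω : ℂ) (f : L2 D), ∀ᵐ x ∂(volume.restrict D),
      radialPotential D (truncExp L ω) f x = volumePotential D ω f x := fun ω f => by
    filter_upwards [ae_restrict_mem hD.measurableSet] with x hx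
    exact radialPotential_truncExp ω hD.measurableSet (hL x hx) f
  refine ⟨Q, rfl, rfl, rfl, fun ω f => ?_, fun ω f => ?_, fun z => ?_, rfl⟩
  · change toL2Map D (pot ω f) =ᵐ[_] _
    rw [hpot]
    exact (coeFn_radialOpTwo _ f).trans (hvol ω f)
  · exact (coeFn_radialOp D _ f).trans (hvol ω f)
  · change topMulTwo (volume.restrict D) (topMul _ z (topConj _ z)) z =ᵐ[_] _
    filter_upwards [coeFn_topMulTwo (volume.restrict D) (topMul _ z (topConj _ z)) z,
      coeFn_topMul (volume.restrict D) z (topConj _ z), coeFn_topConj (volume.restrict D) z]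
      with x h1 h2 h3
    rw [h1, h2, h3, Complex.mul_conj']

section Equivalence

variable {Q : CavityModel (L2 D) (Lp ℂ ∞ (volume.restrict D)) (H2 D)}

theorem volumePotential_congr {ω : ℂ} {f g : R3 → ℂ} (h : f =ᵐ[volume.restrict D] g) (x : R3) :
    volumePotential D ω f x = volumePotential D ω g x :=
  integral_congr_ae (h.mono fun y hy => by simp only [hy])

theorem isLinearResonance_iff (hι : Q.ι = toL2Map D)
    (hpot : ∀ ω f, Q.ι (Q.pot ω f) =ᵐ[volume.restrict D] volumePotential D ω f)
    {τ : ℝ} {ω : ℂ} {u : H2 D} : IsLinearResonance D τ ω u ↔ Q.IsLinRes τ ω u := by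
  have hu : Q.ι u = toL2 u := by rw [hι]; rfl
  refine and_congr_right fun _ => ?_
  have h1 := hpot ω (toL2 u)
  have h2 := Lp.coeFn_smul ((τ : ℂ) * ω ^ 2) (Q.ι (Q.pot ω (toL2 u)))
  have h3 : u = ((τ : ℂ) * ω ^ 2) • Q.pot ω (Q.ι u) ↔
      toL2 u = ((τ : ℂ) * ω ^ 2) • Q.ι (Q.pot ω (toL2 u)) := by
    rw [← Q.ι_inj.eq_iff, map_smul, hu]
  rw [h3]
  constructor
  · intro h
    refine Lp.ext ?_
    filter_upwards [h, h1, h2] with x h h1 h2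
    rw [h2, Pi.smul_apply, h1, h, smul_eq_mul]
  · intro h
    have h4 := h2
    rw [← h] at h4
    filter_upwards [h1, h4] with x h1 h4
    rw [h4, Pi.smul_apply, h1, smul_eq_mul]

/-- The source is f = N(u). Being a multiple of a potential, u has an L^∞ representative, and the
abstract cubic term is |u|²u computed from it. This also yields N(u) ∈ L²(D) in the reverse
direction. -/
theorem isNonlinearResonance_iff (hι : Q.ι = toL2Map D)
    (hpot : ∀ ω f, Q.ι (Q.pot ω f) =ᵐ[volume.restrict D] volumePotential D ω f)
    (hpotX : ∀ ω f, Q.potX ω f =ᵐ[volume.restrict D] volumePotential D ω f)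
    (hcubic : ∀ z, Q.cubic z =ᵐ[volume.restrict D] fun x => (‖z x‖ : ℂ) ^ 2 * z x)
    {τ : ℝ} {ω : ℂ} {u : H2 D} : IsNonlinearResonance D τ ω u ↔ Q.IsNonlinRes τ ω u := by
  have hu : Q.ι u = toL2 u := by rw [hι]; rfl
  refine and_congr_right fun _ => ?_
  have h3 : ∀ f, u = ((τ : ℂ) * ω ^ 2) • Q.pot ω f ↔
      toL2 u = ((τ : ℂ) * ω ^ 2) • Q.ι (Q.pot ω f) := fun f => by
    rw [← Q.ι_inj.eq_iff, map_smul, hu]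
  have hsum : ∀ f : L2 D, (toL2 u =ᵐ[volume.restrict D]
      fun x => (τ : ℂ) * ω ^ 2 * volumePotential D ω f x) →
      toL2 u + Q.cubic (((τ : ℂ) * ω ^ 2) • Q.potX ω f) =ᵐ[volume.restrict D]
        fun x => kerr (toL2 u x) := by
    intro f hf
    filter_upwards [hf, hpotX ω f, Lp.coeFn_smul ((τ : ℂ) * ω ^ 2) (Q.potX ω f),
      hcubic (((τ : ℂ) * ω ^ 2) • Q.potX ω f),
      Lp.coeFn_add (toL2 u) (Q.cubic (((τ : ℂ) * ω ^ 2) • Q.potX ω f))] with x h1 h2 h3 h4 h5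
    rw [h5, Pi.add_apply, h4, h3, Pi.smul_apply, h2, smul_eq_mul, ← h1, kerr]
  constructor
  · rintro ⟨hm, h⟩
    have hf := hm.coeFn_toLp
    have h0 : toL2 u =ᵐ[volume.restrict D]
        fun x => (τ : ℂ) * ω ^ 2 * volumePotential D ω (hm.toLp _) x := by
      filter_upwards [h] with x hx
      rw [hx, volumePotential_congr hf]
    refine ⟨hm.toLp _, (h3 _).2 (Lp.ext ?_), ?_⟩
    · filter_upwards [h0, hpot ω (hm.toLp _),
        Lp.coeFn_smul ((τ : ℂ) * ω ^ 2) (Q.ι (Q.pot ω (hm.toLp _)))] with x h1 h2 h4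
      rw [h4, Pi.smul_apply, h2, h1, smul_eq_mul]
    · rw [hu]
      exact Lp.ext (hf.trans (hsum _ h0).symm)
  · rintro ⟨f, h1, h2⟩
    rw [h3] at h1
    have h0 : toL2 u =ᵐ[volume.restrict D]
        fun x => (τ : ℂ) * ω ^ 2 * volumePotential D ω f x := by
      have h4 := Lp.coeFn_smul ((τ : ℂ) * ω ^ 2) (Q.ι (Q.pot ω f))
      rw [← h1] at h4
      filter_upwards [h4, hpot ω f] with x h4 h5
      rw [h4, Pi.smul_apply, h5, smul_eq_mul]
    have hf : f =ᵐ[volume.restrict D] fun x => kerr (toL2 u x) := by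
      have h4 := hsum f h0
      rw [hu] at h2
      rwa [← h2] at h4
    refine ⟨(memLp_congr_ae hf).1 (Lp.memLp f), ?_⟩
    filter_upwards [h0] with x hx
    rw [hx, volumePotential_congr hf]

theorem isLinearResonanceFamily_iff (hι : Q.ι = toL2Map D)
    (hpot : ∀ ω f, Q.ι (Q.pot ω f) =ᵐ[volume.restrict D] volumePotential D ω f)
    {ωs : ℝ → ℂ} {φs : ℝ → H2 D} :
    IsLinearResonanceFamily D Q.lam Q.φ ωs φs ↔ Q.IsLinFamily ωs φs := by
  have hu : ∀ u, toL2 u = Q.ι u := fun u => by rw [hι]; rfl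
  simp only [IsLinearResonanceFamily, CavityModel.IsLinFamily, isLinearResonance_iff hι hpot, hu]

end Equivalence

end

end NonlinearResonance

/-! ### Transfer to the domain D -/

theorem mainTheorem2 (D : Set NonlinearResonance.R3) (hD_open : IsOpen D)
    (hD_bdd : Bornology.IsBounded D) (hD_conn : IsConnected D)
    (lam : ℝ) (φ : NonlinearResonance.L2 D)
    (hφ : NonlinearResonance.IsSimpleNewtonianEigenpair D lam φ) :
    (∃ (ωs : ℝ → ℂ) (φs : ℝ → NonlinearResonance.H2 D),
      NonlinearResonance.IsLinearResonanceFamily D lam φ ωs φs) ∧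
    ∀ (ωs : ℝ → ℂ) (φs : ℝ → NonlinearResonance.H2 D),
      NonlinearResonance.IsLinearResonanceFamily D lam φ ωs φs →
      ∃ δ > (0 : ℝ), ∃ (ω : ℝ × ℝ → ℂ) (u h : ℝ × ℝ → NonlinearResonance.H2 D),
        -- existence of the resonance, with the parametrized resonant state
        (∀ a τ : ℝ, (a, τ) ∈ NonlinearResonance.paramRegion δ →
          NonlinearResonance.IsNonlinearResonance D τ (ω (a, τ)) (u (a, τ)) ∧
          NonlinearResonance.toL2 (u (a, τ)) = (a : ℂ) • φ + NonlinearResonance.toL2 (h (a, τ)) ∧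
          inner ℂ φ (NonlinearResonance.toL2 (h (a, τ))) = 0) ∧
        -- local uniqueness, up to a phase factor, in a neighbourhood that does not depend on (a, τ)
        (∃ ρ > (0 : ℝ), ∀ a τ : ℝ, (a, τ) ∈ NonlinearResonance.paramRegion δ →
          (‖(Real.sqrt τ : ℂ) * ω (a, τ) - ((1 / Real.sqrt lam : ℝ) : ℂ)‖ < ρ ∧
            ‖u (a, τ)‖ < ρ) ∧
          ∀ (ω' : ℂ) (u' : NonlinearResonance.H2 D),
            NonlinearResonance.IsNonlinearResonance D τ ω' u' →
            ‖(Real.sqrt τ : ℂ) * ω' - ((1 / Real.sqrt lam : ℝ) : ℂ)‖ < ρ →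
            ‖u'‖ < ρ → ‖inner ℂ φ (NonlinearResonance.toL2 u')‖ = a →
            ω' = ω (a, τ) ∧
              ∃ θ : ℝ, u' = Complex.exp (Complex.I * (θ : ℂ)) • u (a, τ)) ∧
        -- real analyticity
        AnalyticOnNhd ℝ ω (NonlinearResonance.paramRegion δ) ∧
        AnalyticOnNhd ℝ u (NonlinearResonance.paramRegion δ) ∧
        -- asymptotics, with a constant that does not depend on (a, τ)
        ∃ C : ℝ, ∀ a τ : ℝ, (a, τ) ∈ NonlinearResonance.paramRegion δ →
          ‖ω (a, τ) - ωs τ‖ ≤ C * (a ^ 2 / Real.sqrt τ + a / τ) ∧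
          ‖u (a, τ) - (a : ℂ) • φs τ‖ ≤ C * a ^ 2 ∧
          ‖h (a, τ)‖ ≤ C * (a ^ 2 + 1 / τ) ∧
          ‖ω (a, τ) - (((1 / Real.sqrt (lam * τ) : ℝ) : ℂ) -
              Complex.I / (8 * Real.pi * lam ^ 2 * τ) *
                ((‖∫ x in D, φ x‖ ^ 2 : ℝ) : ℂ))‖
            ≤ C * (a ^ 2 / Real.sqrt τ + 1 / τ ^ (3 / 2 : ℝ)) := by
  obtain ⟨r, hr0, hr⟩ := hD_bdd.subset_ball_lt 0 0
  have hfin : IsFiniteMeasure (volume.restrict D) :=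
    ⟨by rw [Measure.restrict_apply_univ]; exact hD_bdd.measure_lt_top⟩
  have hcompl := NonlinearResonance.completeSpace_H2 hD_open.measurableSet hr
  obtain ⟨Q, hlam, hφQ, hι, hpot, hpotX, hcubic, hm⟩ :=
    NonlinearResonance.exists_cavityModel hD_open hr0 hr hφ
  subst hlam
  subst hφQ
  have hu : ∀ u, NonlinearResonance.toL2 u = Q.ι u := fun u => by rw [hι]; rfl
  simp only [NonlinearResonance.isLinearResonanceFamily_iff hι hpot,
    NonlinearResonance.isNonlinearResonance_iff hι hpot hpotX hcubic, hu]
  refine ⟨Q.exists_isLinFamily, fun ωs φs hf => ?_⟩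
  -- The abstract slope κ₀⁴m/2 is evaluated with κ₀⁴ = λ^{-2} and m = i/(4π)|∫φ|².
  have e : ∀ τ : ℝ, Complex.I / (8 * Real.pi * Q.lam ^ 2 * τ) *
      ((‖∫ x in D, Q.φ x‖ ^ 2 : ℝ) : ℂ) = Q.κ₀ ^ 4 * Q.m / 2 / τ := by
    intro τ
    have h1 := Q.κ₀_sq_mul
    have h2 : (Q.lam : ℂ) ≠ 0 := by exact_mod_cast Q.lam_pos.ne'
    have h3 : (Q.κ₀ : ℂ) ^ 4 = ((Q.lam : ℂ) ^ 2)⁻¹ := by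
      refine eq_inv_of_mul_eq_one_left ?_
      linear_combination ((Q.κ₀ : ℂ) ^ 2 * Q.lam + 1) * h1
    have hpi : (Real.pi : ℂ) ≠ 0 := by exact_mod_cast Real.pi_ne_zero
    rw [h3, hm]
    field_simp
    ring
  simp only [e]
  exact Q.exists_nonlinear_family hf
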